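/- Let $d\ge 1$, $\alpha\in(1,2)$, $T>0$. Let $(L_t)_{t\ge0}$ be the $d$-dimensional symmetric, rotationally invariant $\alpha$-stable process with Lévy measure $|z|^{-d-\alpha}\,dz$, i.e. the càdlàg Lévy process with $$\mathbb E e^{i\xi\cdot L_t}=e^{t\psi(\xi)},\qquad \psi(\xi)=\int_{\mathbb R^d}\big(e^{i\xi\cdot z}-1-i\xi\cdot z\,\mathbf 1_{|z|\le1}\big)|z|^{-d-\alpha}\,dz ,$$ and let $p_\alpha(t,x)=(2\pi)^{-d}\int_{\mathbb R^d}e^{-ix\cdot\xi}e^{t\psi(\xi)}\,d\xi$ be its density at time $t>0$. Let $b:\mathbb R_+\times\mathbb R^d\to\mathbb R^d$ be Borel measurable and bounded, with $\|b\|_\infty=\sup_{s,x}|b(s,x)|$, and let $X_0$ be an $\mathbb R^d$-valued random variable, independent of $L$, with law $\mu_0$. For $N\ge1$ put $h=T/N$ and $\phi_N(s)=kh$ for $s\in[kh,(k+1)h)$, and let $X^N$ be the Euler scheme $$X^N_t=X_0+\int_0^t b\big(s,X^N_{\phi_N(s)}\big)\,ds+L_t,\qquad t\in[0,T].$$ Then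 for every $t\in(0,T]$ the random variable $X^N_t$ has a (unique) continuous density $p^N_{X_0}(t,\cdot)$ with respect to Lebesgue measure, and the following holds. (i) There is a constant $c=c(d,\alpha,T,\|b\|_\infty)>0$ such that for all $N\ge 1$, $t\in(0,T]$ and $y\in\mathbb R^d$, $$p^N_{X_0}(t,y)\le c\int_{\mathbb R^d}p_\alpha(t,x-y)\,\mu_0(dx).$$ (ii) For every $\beta\in(0,\alpha-1)$ there is a constant $c=c(d,\alpha,T,\|b\|_\infty,\beta)>0$ such that for all $N\ge1$, $t\in(0,T]$ and $y_1,y_2\in\mathbb R^d$, $$|p^N_{X_0}(t,y_2)-p^N_{X_0}(t,y_1)|\le c\,|y_2-y_1|^{\beta}\,t^{-\beta/\alpha}\sum_{i=1,2}\int_{\mathbb R^d}p_\alpha(t,x-y_i)\,\mu_0(dx).$$ (iii) For every $\beta\in(0,\alpha-1)$ there is a constant $c=c(d,\alpha,T,\|b\|_\infty,\beta)>0$ such that for all $N\ge1$, $t_1,t_2\in(0,T]$ and $y\in\mathbb R^d$, $$|p^N_{X_0}(t_2,y)-p^N_{X_0}(t_1,y)|\le c\,|t_2-t_1|^{\beta/\alpha}\sum_{i=1,2}t_i^{-\beta/\alpha}\int_{\mathbb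 R^d}p_\alpha(t_i,x-y)\,\mu_0(dx).$$ The constants do not depend on $N$, on $\mu_0$, or on $b$ other than through an upper bound for $\|b\|_\infty$. -/

import Mathlib

open MeasureTheory ProbabilityTheory Topology Filter
open scoped NNReal ENNReal RealInnerProductSpace

noncomputable section

namespace StableEuler

/-- The Euclidean space `ℝ^d`. -/
abbrev Rd (d : ℕ) : Type := EuclideanSpace ℝ (Fin d)

/-- The rotationally invariant `α`-stable Lévy measure `|z|^{-d-α} dz` on `ℝ^d`. -/
def levyMeasure (d : ℕ) (α : ℝ) : Measure (Rd d) :=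
  volume.withDensity fun z => ENNReal.ofReal (‖z‖ ^ (-(d : ℝ) - α))

/-- The Lévy–Khintchine exponent of the characteristic triplet `(0, |z|^{-d-α} dz, 0)`:
`ψ(ξ) = ∫ (e^{i ξ·z} - 1 - i ξ·z 1_{|z| ≤ 1}) |z|^{-d-α} dz`. -/
def levyExponent (d : ℕ) (α : ℝ) (ξ : Rd d) : ℂ :=
  ∫ z, (Complex.exp ((⟪z, ξ⟫ : ℝ) * Complex.I) - 1
      - (if ‖z‖ ≤ 1 then ((⟪z, ξ⟫ : ℝ) : ℂ) * Complex.I else 0)) ∂(levyMeasure d α)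

/-- The density `p_α(t, ·)` of the `α`-stable process at time `t`, as the inverse Fourier
transform of the characteristic function `E e^{i ξ·L_t} = e^{t ψ(ξ)}`. -/
def stableDensity (d : ℕ) (α t : ℝ) (x : Rd d) : ℝ :=
  ((2 * Real.pi) ^ d)⁻¹ *
    (∫ ξ : Rd d, Complex.exp (-((⟪x, ξ⟫ : ℝ) * Complex.I)) *
      Complex.exp (t * levyExponent d α ξ)).re

/-- Almost surely, the paths are right continuous with left limits. -/
def IsCadlag {d : ℕ} {Ω : Type*} [MeasurableSpace Ω] (L : ℝ≥0 → Ω → Rd d)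
    (P : Measure Ω) : Prop :=
  ∀ᵐ ω ∂P, ∀ t : ℝ≥0, ContinuousWithinAt (fun s => L s ω) (Set.Ici t) t ∧
    ∃ l : Rd d, Tendsto (fun s => L s ω) (𝓝[<] t) (𝓝 l)

/-- `L` is a Lévy process on `ℝ^d`. -/
structure IsLevyProcess {d : ℕ} {Ω : Type*} [MeasurableSpace Ω] (L : ℝ≥0 → Ω → Rd d)
    (P : Measure Ω) : Prop where
  measurable : ∀ t, Measurable (L t)
  cadlag : IsCadlag L P
  zero : ∀ᵐ ω ∂P, L 0 ω = 0
  indep_increments : HasIndepIncrements L P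
  stationary_increments : ∀ s t : ℝ≥0, s ≤ t →
    P.map (fun ω => L t ω - L s ω) = P.map (L (t - s))

/-- `L` is the symmetric, rotationally invariant `α`-stable process on `ℝ^d` whose Lévy measure is
`|z|^{-d-α} dz`, i.e. the Lévy process with characteristic triplet `(0, |z|^{-d-α} dz, 0)`. -/
structure IsStableProcess {d : ℕ} {Ω : Type*} [MeasurableSpace Ω] (α : ℝ)
    (L : ℝ≥0 → Ω → Rd d) (P : Measure Ω) : Prop extends IsLevyProcess L P where
  charFun_eq : ∀ (t : ℝ≥0) (ξ : Rd d),
    charFun (P.map (L t)) ξ = Complex.exp (((t : ℝ) : ℂ) * levyExponent d α ξ)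

/-- The discretised time `φ_N(s) = k h` for `s ∈ [k h, (k+1) h)`, where `h = T / N`. -/
def gridTime (T : ℝ≥0) (N : ℕ) (s : ℝ≥0) : ℝ≥0 :=
  (⌊s / (T / N)⌋₊ : ℝ≥0) * (T / N)

/-- `X` is the Euler scheme with step `T / N` on `[0, T]`, drift `b`, initial value `X₀` and
noise `L`, where `L` is an `α`-stable process independent of `X₀`:
`X_t = X₀ + ∫_0^t b(s, X_{φ_N(s)}) ds + L_t` almost surely, for each `t ∈ [0, T]`. -/
structure IsEulerScheme {d : ℕ} {Ω : Type*} [MeasurableSpace Ω] (α : ℝ) (T : ℝ≥0) (N : ℕ)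
    (b : ℝ≥0 → Rd d → Rd d) (X₀ : Ω → Rd d) (L X : ℝ≥0 → Ω → Rd d)
    (P : Measure Ω) : Prop where
  measurable_init : Measurable X₀
  stable : IsStableProcess α L P
  indep : IndepFun X₀ (fun ω (t : ℝ≥0) => L t ω) P
  eq : ∀ t : ℝ≥0, t ≤ T → ∀ᵐ ω ∂P,
    X t ω = X₀ ω + (∫ s in (0 : ℝ)..t, b s.toNNReal (X (gridTime T N s.toNNReal) ω)) + L t ω

/-- `f` is a continuous probability density of `μ` with respect to Lebesgue measure
(there is at most one such `f`). -/
structure IsContinuousDensity {d : ℕ} (μ : Measure (Rd d)) (f : Rd d → ℝ) : Prop where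
  continuous : Continuous f
  nonneg : ∀ y, 0 ≤ f y
  eq_withDensity : μ = volume.withDensity fun y => ENNReal.ofReal (f y)

/-- The convolution `∫ p_α(t, x - y) μ₀(dx)`. -/
def stableAverage {d : ℕ} (α : ℝ) (μ₀ : Measure (Rd d)) (t : ℝ) (y : Rd d) : ℝ :=
  ∫ x, stableDensity d α t (x - y) ∂μ₀

end StableEuler

end

/-!
The drift of size `|b| ≤ B` is a subcritical perturbation of the stable noise: over a time `r` it
displaces by at most `B r`, which is at most a constant times the stable scale `r ^ (1 / α)` because
`α > 1`. So everything reduces to how `p_α` reacts to displacements, measured against `p_α` itself,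
and to the summability of one singularity `(t - s) ^ (-γ)` with `γ < 1` along the grid.

*The stable density.* The Lévy exponent is `-κ ‖ξ‖ ^ α` (`exists_levyExponent_eq`), so `p_α` is a
mixture of centred Gaussian densities over the one-sided `α / 2`-stable law
(`IsSubordination.stableDensity_eq`). The one-sided law is constructed as a limit of normalized sums
of Pareto variables (`exists_isOneSidedStable`); beyond positivity only its Laplace transform is used:
it gives the lower bound `c (1 + ‖x‖²) ^ (-(d + α) / 2)` for the mixture, and the matching upper
bound for any mixture of functions dominated by `gaussWeight`. Derivatives of order one and two of
Gaussian densities, in space and in scale, are so dominated. Hence first and second differences of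
`p_α` in `x` and `t` are at most the relative size of the increments times `p_α` itself
(`IsSubordination.exists_abs_stableDensity_sub_le` and the lemmas following it).

*The scheme.* For a fixed pair `(t, y)`, the semigroup property of `p_α` lets the density of `X_t`
at `y` be telescoped over the grid points `τ_k < t`:
`p(t, y) = ∫ p_α(t, x - y) μ₀(dx) + ∑ₖ ∫ (p_α(t - τ_k, x + D_k - y) - p_α(t - τ_k, x - y)) μ_k(dx)`,
where `μ_k` is the law of the scheme at `τ_k` and `D_k` the displacement by the drift in the `k`-th
step (`IsDriftChain.chainDensity_eq`). The `k`-th term is at most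
`C |D_k| (t - τ_k) ^ (-1 / α) ∫ p_α(t - τ_k, x - y) μ_k(dx)`, and a discrete Grönwall argument with
`(t, y)` frozen (`IsSubordination.exists_average_le`) replaces the last integral by
`∫ p_α(t, x - y) μ₀(dx)`. Summation gives the upper bound. For the Hölder bounds the terms are second
differences, the singularity becomes `(t - τ_k) ^ (-(1 + β) / α)`, and it is summable exactly when
`β < α - 1`. All constants come from `p_α`, `B` and `T` alone.
-/


noncomputable section
namespace StableEuler

/-! ### The one-sided stable law -/

section Subordinator

lemma integrableOn_one_sub_exp_mul_rpow {a : ℝ} (h0 : 0 < a) (h1 : a < 1) :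
    IntegrableOn (fun v : ℝ => (1 - Real.exp (-v)) * (a * v ^ (-(a + 1)))) (Set.Ioi 0) := by
  have hm : ∀ s : Set ℝ, AEStronglyMeasurable
      (fun v : ℝ => (1 - Real.exp (-v)) * (a * v ^ (-(a + 1)))) (volume.restrict s) := by
    intro s
    apply Measurable.aestronglyMeasurable
    fun_prop
  rw [← Set.Ioc_union_Ioi_eq_Ioi (zero_le_one (α := ℝ))]
  refine IntegrableOn.union ?_ ?_
  · have : IntegrableOn (fun v : ℝ => a * v ^ (-a)) (Set.Ioc 0 1) := by
      refine Integrable.const_mul ?_ _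
      rw [← IntegrableOn, ← intervalIntegrable_iff_integrableOn_Ioc_of_le zero_le_one]
      exact intervalIntegral.intervalIntegrable_rpow' (by linarith)
    refine Integrable.mono' this (hm _) ?_
    filter_upwards [ae_restrict_mem measurableSet_Ioc] with v hv
    have hv0 : 0 < v := hv.1
    have e1 : 1 - Real.exp (-v) ≤ v := by linarith [Real.add_one_le_exp (-v)]
    have e2 : 0 ≤ 1 - Real.exp (-v) := by
      have := Real.exp_le_one_iff.2 (by linarith : -v ≤ 0); linarith
    have e3 : v ^ (-a) = v * v ^ (-(a + 1)) := by
      rw [show -a = 1 + -(a + 1) by ring, Real.rpow_add hv0, Real.rpow_one]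
    have e4 : 0 ≤ v ^ (-(a + 1)) := Real.rpow_nonneg hv0.le _
    rw [Real.norm_of_nonneg (by positivity), e3]
    nlinarith [mul_nonneg h0.le e4]
  · have : IntegrableOn (fun v : ℝ => a * v ^ (-(a + 1))) (Set.Ioi 1) :=
      Integrable.const_mul (integrableOn_Ioi_rpow_of_lt (by linarith) one_pos) _
    refine Integrable.mono' this (hm _) ?_
    filter_upwards [ae_restrict_mem measurableSet_Ioi] with v hv
    have hv0 : 0 < v := lt_trans one_pos hv
    have e2 : 0 ≤ 1 - Real.exp (-v) := by
      have := Real.exp_le_one_iff.2 (by linarith : -v ≤ 0); linarith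
    have e4 : 0 ≤ a * v ^ (-(a + 1)) := mul_nonneg h0.le (Real.rpow_nonneg hv0.le _)
    rw [Real.norm_of_nonneg (by positivity)]
    nlinarith [Real.exp_pos (-v)]

/-- The tail integral of the one-sided stable Lévy measure against `1 - e^{-v}`. -/
def tailExponent (a s : ℝ) : ℝ :=
  ∫ v in Set.Ioi s, (1 - Real.exp (-v)) * (a * v ^ (-(a + 1)))

lemma tailExponent_zero_pos {a : ℝ} (h0 : 0 < a) (h1 : a < 1) : 0 < tailExponent a 0 := by
  unfold tailExponent
  rw [setIntegral_pos_iff_support_of_nonneg_ae _ (integrableOn_one_sub_exp_mul_rpow h0 h1)]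
  · have : Set.Ioi (0 : ℝ) ⊆ Function.support
        (fun v : ℝ => (1 - Real.exp (-v)) * (a * v ^ (-(a + 1)))) ∩ Set.Ioi 0 := by
      intro v hv
      refine ⟨?_, hv⟩
      have hv0 : 0 < v := hv
      have e2 : 0 < 1 - Real.exp (-v) := by
        have := Real.exp_lt_one_iff.2 (by linarith : -v < 0); linarith
      simp only [Function.mem_support]
      positivity
    exact lt_of_lt_of_le (by simp) (measure_mono this)
  · filter_upwards [ae_restrict_mem measurableSet_Ioi] with v hv
    have hv0 : 0 < v := hv
    have e2 : 0 ≤ 1 - Real.exp (-v) := by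
      have := Real.exp_le_one_iff.2 (by linarith : -v ≤ 0); linarith
    simp only [Pi.zero_apply]
    positivity

/-- The truncation at `s` is the cutoff of the Pareto law at `1` seen after rescaling by `s`. -/
lemma tendsto_tailExponent {a : ℝ} (h0 : 0 < a) (h1 : a < 1) {s : ℕ → ℝ}
    (hs : Tendsto s atTop (𝓝 0)) (hs0 : ∀ᶠ n in atTop, 0 ≤ s n) :
    Tendsto (fun n => tailExponent a (s n)) atTop (𝓝 (tailExponent a 0)) := by
  have := (aecover_Ioi_of_Ioi (μ := (volume : Measure ℝ)) hs).integral_tendsto_of_countably_generated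
    (integrableOn_one_sub_exp_mul_rpow h0 h1)
  refine this.congr' ?_
  filter_upwards [hs0] with n hn
  rw [Measure.restrict_restrict measurableSet_Ioi, Set.inter_eq_left.2 (Set.Ioi_subset_Ioi hn)]
  rfl

/-- The Laplace transform of the Pareto law with tail `y ^ (-a)` on `[1, ∞)`. -/
lemma integral_exp_paretoMeasure {a : ℝ} (h0 : 0 < a) {s : ℝ} (hs : 0 < s) :
    ∫ y, Real.exp (-(s * |y|)) ∂(paretoMeasure 1 a) = 1 - s ^ a * tailExponent a s := by
  have hP : IsProbabilityMeasure (paretoMeasure 1 a) := isProbabilityMeasure_paretoMeasure one_pos h0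
  have hI : Integrable (fun y => Real.exp (-(s * |y|))) (paretoMeasure 1 a) := by
    refine Integrable.of_bound (by fun_prop) 1 (ae_of_all _ fun y => ?_)
    rw [Real.norm_of_nonneg (Real.exp_nonneg _), Real.exp_le_one_iff]
    have := mul_nonneg hs.le (abs_nonneg y)
    linarith
  have h : ∫ y, (1 - Real.exp (-(s * |y|))) ∂(paretoMeasure 1 a) = s ^ a * tailExponent a s := by
    have hm : Measurable (paretoPDF 1 a) := (measurable_paretoPDFReal 1 a).ennreal_ofReal
    rw [paretoMeasure, integral_withDensity_eq_integral_toReal_smul hm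
      (ae_of_all _ fun y => ENNReal.ofReal_lt_top)]
    have e1 : ∀ y : ℝ, (paretoPDF 1 a y).toReal • (1 - Real.exp (-(s * |y|)))
        = (Set.Ici (1:ℝ)).indicator (fun y => s ^ (a + 1) *
          ((1 - Real.exp (-(s * y))) * (a * (s * y) ^ (-(a + 1))))) y := by
      intro y
      by_cases hy : 1 ≤ y
      · have hy0 : 0 < y := by linarith
        rw [Set.indicator_of_mem (show y ∈ Set.Ici (1:ℝ) from hy), paretoPDF_of_le hy,
          ENNReal.toReal_ofReal (by positivity), Real.one_rpow, abs_of_pos hy0,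
          Real.mul_rpow hs.le hy0.le, Real.rpow_neg hs.le]
        have := (Real.rpow_pos_of_pos hs (a + 1)).ne'
        simp only [smul_eq_mul]
        field_simp
      · rw [Set.indicator_of_notMem (show y ∉ Set.Ici (1:ℝ) from hy), paretoPDF_of_lt (not_le.1 hy)]
        simp
    simp_rw [e1]
    rw [integral_indicator measurableSet_Ici, integral_Ici_eq_integral_Ioi, integral_const_mul,
      integral_comp_mul_left_Ioi (fun v => (1 - Real.exp (-v)) * (a * v ^ (-(a + 1)))) 1 hs,
      mul_one, Real.rpow_add hs, Real.rpow_one, smul_eq_mul, tailExponent]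
    rw [← mul_assoc, mul_assoc (s ^ a), mul_inv_cancel₀ hs.ne', mul_one]
  rw [integral_sub (integrable_const _) hI] at h
  simp at h
  linarith

/-- The point `exp (-ε ∑ |y i|)` of the unit interval. -/
def expNegSum (ε : ℝ≥0) {n : ℕ} (y : Fin n → ℝ) : unitInterval :=
  ⟨Real.exp (-(ε * ∑ i, |y i|)), (Real.exp_pos _).le, by
    rw [Real.exp_le_one_iff, neg_nonpos]
    exact mul_nonneg ε.2 (Finset.sum_nonneg fun i _ => abs_nonneg _)⟩

lemma measurable_expNegSum (ε : ℝ≥0) {n : ℕ} :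
    Measurable (expNegSum ε : (Fin n → ℝ) → unitInterval) := by
  refine Measurable.subtype_mk ?_
  fun_prop

/-- The moments of a normalized sum of Pareto variables, in the exponential coordinate. -/
lemma integral_rpow_map_expNegSum {a : ℝ} (h0 : 0 < a) {ε : ℝ≥0} (hε : 0 < ε) (n : ℕ) {l : ℝ}
    (hl : 0 < l) :
    ∫ x : unitInterval, (x : ℝ) ^ l
        ∂((Measure.pi fun _ : Fin n => paretoMeasure 1 a).map (expNegSum ε))
      = (1 - (l * ε) ^ a * tailExponent a (l * ε)) ^ n := by
  have hP : IsProbabilityMeasure (paretoMeasure 1 a) := isProbabilityMeasure_paretoMeasure one_pos h0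
  have hle : 0 < l * ε := mul_pos hl (by exact_mod_cast hε)
  rw [integral_map (measurable_expNegSum ε).aemeasurable, ← integral_exp_paretoMeasure h0 hle]
  · have : ∀ y : Fin n → ℝ, ((expNegSum ε y : unitInterval) : ℝ) ^ l
        = ∏ i, Real.exp (-(l * ε * |y i|)) := by
      intro y
      rw [← Real.exp_sum, expNegSum, ← Real.exp_mul]
      congr 1
      rw [Finset.sum_neg_distrib, ← Finset.mul_sum]
      ring
    simp_rw [this]
    rw [integral_fintype_prod_eq_pow (fun y => Real.exp (-(l * ε * |y|)))]
    simp
  · apply Measurable.aestronglyMeasurable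
    fun_prop

/-- In the coordinate `x = e^{-u}` on the unit interval, the one-sided stable law: the limit of the
laws of normalized sums of Pareto variables. -/
lemma exists_moment_eq {a : ℝ} (h0 : 0 < a) (h1 : a < 1) :
    ∃ ν : ProbabilityMeasure unitInterval, ∀ l : ℝ, 0 < l →
      ∫ x : unitInterval, (x : ℝ) ^ l ∂(ν : Measure unitInterval)
        = Real.exp (-(l ^ a * tailExponent a 0)) := by
  have hP : IsProbabilityMeasure (paretoMeasure 1 a) := isProbabilityMeasure_paretoMeasure one_pos h0
  let ε : ℕ → ℝ≥0 := fun n => ((n : ℝ≥0) + 1) ^ (-(1 / a))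
  have hε : ∀ n, 0 < ε n := fun n => NNReal.rpow_pos (by positivity)
  let Q : ℕ → ProbabilityMeasure unitInterval := fun n =>
    ⟨(Measure.pi fun _ : Fin (n + 1) => paretoMeasure 1 a).map (expNegSum (ε n)),
      Measure.isProbabilityMeasure_map (measurable_expNegSum _).aemeasurable⟩
  -- a limit along an ultrafilter exists by compactness; its moments do not depend on the ultrafilter
  obtain ⟨ν, -, hν⟩ := isCompact_univ.ultrafilter_le_nhds ((hyperfilter ℕ).map Q) (by simp)
  have hν' : Tendsto Q (hyperfilter ℕ) (𝓝 ν) := hν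
  refine ⟨ν, fun l hl => ?_⟩
  have hc : Continuous fun x : unitInterval => (x : ℝ) ^ l :=
    continuous_subtype_val.rpow_const fun x => Or.inr hl.le
  have t1 := ProbabilityMeasure.tendsto_iff_forall_integral_tendsto.1 hν'
    (BoundedContinuousFunction.mkOfCompact ⟨_, hc⟩)
  simp only [BoundedContinuousFunction.mkOfCompact_apply, ContinuousMap.coe_mk] at t1
  refine tendsto_nhds_unique t1 (Tendsto.mono_left ?_ Nat.hyperfilter_le_atTop)
  have e : ∀ n, ∫ x : unitInterval, (x : ℝ) ^ l ∂(Q n : Measure unitInterval)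
      = (1 + -((l * ε n) ^ a * tailExponent a (l * ε n))) ^ (n + 1) := by
    intro n
    rw [← sub_eq_add_neg, ← integral_rpow_map_expNegSum h0 (hε n) (n + 1) hl]
    rfl
  simp_rw [e]
  have hεt : Tendsto (fun n => l * (ε n : ℝ)) atTop (𝓝 0) := by
    rw [← mul_zero l]
    refine Tendsto.const_mul l ?_
    have : Tendsto (fun n : ℕ => (n : ℝ) + 1) atTop atTop :=
      tendsto_atTop_add_const_right _ _ tendsto_natCast_atTop_atTop
    have := (tendsto_rpow_neg_atTop (show 0 < 1 / a by positivity)).comp this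
    refine this.congr fun n => ?_
    simp [ε]
  have key : Tendsto (fun n : ℕ => ((n : ℝ) + 1) *
      -((l * ε n) ^ a * tailExponent a (l * ε n))) atTop (𝓝 (-(l ^ a * tailExponent a 0))) := by
    have t2 : Tendsto (fun n => -(l ^ a * tailExponent a (l * ε n))) atTop
        (𝓝 (-(l ^ a * tailExponent a 0))) :=
      ((tendsto_tailExponent h0 h1 hεt (Eventually.of_forall fun n => by positivity)).const_mul _).neg
    refine t2.congr fun n => ?_
    have hn : (0:ℝ) < (n : ℝ) + 1 := by positivity
    have : ((ε n : ℝ≥0) : ℝ) ^ a = ((n : ℝ) + 1)⁻¹ := by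
      simp only [ε, NNReal.coe_rpow, NNReal.coe_add, NNReal.coe_natCast, NNReal.coe_one]
      rw [← Real.rpow_mul hn.le, show -(1 / a) * a = -1 by field_simp, Real.rpow_neg_one]
    rw [Real.mul_rpow hl.le (by positivity), this]
    field_simp
  have := (tendsto_add_atTop_iff_nat 1).2 (Real.tendsto_one_add_pow_exp_of_tendsto
    (g := fun n : ℕ => -((l * ε (n - 1)) ^ a * tailExponent a (l * ε (n - 1))))
    (t := -(l ^ a * tailExponent a 0)) ?_)
  · simpa using this
  · refine (tendsto_add_atTop_iff_nat 1).1 ?_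
    simpa using key

/-- A law on `(0, ∞)` with Laplace transform `e^{-l^a}`: the one-sided `a`-stable law. -/
structure IsOneSidedStable (a : ℝ) (η : Measure ℝ) : Prop where
  isProbabilityMeasure : IsProbabilityMeasure η
  pos : ∀ᵐ u ∂η, 0 < u
  laplace : ∀ l : ℝ, 0 < l → ∫ u, Real.exp (-(l * u)) ∂η = Real.exp (-l ^ a)

/-- Existence of the one-sided stable law: the law of `-log x` under the measure of
`exists_moment_eq`, up to a scaling. -/
theorem exists_isOneSidedStable {a : ℝ} (h0 : 0 < a) (h1 : a < 1) :
    ∃ η : Measure ℝ, IsOneSidedStable a η := by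
  obtain ⟨ν, hν⟩ := exists_moment_eq h0 h1
  set c := tailExponent a 0 with hc
  have hc0 : 0 < c := tailExponent_zero_pos h0 h1
  have hmeas : ∀ l : ℝ, 0 < l → AEStronglyMeasurable (fun x : unitInterval => (x : ℝ) ^ l)
      (ν : Measure unitInterval) := fun l hl =>
    (continuous_subtype_val.rpow_const fun x => Or.inr hl.le).aestronglyMeasurable
  have hbd : ∀ (l : ℝ), 0 < l → ∀ x : unitInterval, ‖(x : ℝ) ^ l‖ ≤ 1 := fun l hl x => by
    rw [Real.norm_of_nonneg (Real.rpow_nonneg x.2.1 _)]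
    exact Real.rpow_le_one x.2.1 x.2.2 hl.le
  -- small exponents: no mass at `0`
  have hz : ∀ᵐ x : unitInterval ∂(ν : Measure unitInterval), (x : ℝ) ≠ 0 := by
    have hl : Tendsto (fun n : ℕ => 1 / ((n : ℝ) + 1)) atTop (𝓝 0) :=
      tendsto_one_div_add_atTop_nhds_zero_nat
    have t1 : Tendsto (fun n : ℕ => ∫ x : unitInterval, (x : ℝ) ^ (1 / ((n : ℝ) + 1))
        ∂(ν : Measure unitInterval)) atTop
        (𝓝 (∫ x : unitInterval, (if (x : ℝ) = 0 then 0 else 1) ∂(ν : Measure unitInterval))) := by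
      refine tendsto_integral_of_dominated_convergence (fun _ => 1)
        (fun n => hmeas _ (by positivity)) (integrable_const _)
        (fun n => ae_of_all _ (hbd _ (by positivity))) (ae_of_all _ fun x => ?_)
      split_ifs with hx
      · rw [hx]
        refine tendsto_const_nhds.congr fun n => ?_
        rw [Real.zero_rpow (by positivity)]
      · have := (Real.continuous_const_rpow hx).tendsto 0
        rw [Real.rpow_zero] at this
        exact this.comp hl
    have t2 : Tendsto (fun n : ℕ => ∫ x : unitInterval, (x : ℝ) ^ (1 / ((n : ℝ) + 1))
        ∂(ν : Measure unitInterval)) atTop (𝓝 1) := by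
      have : Tendsto (fun n : ℕ => Real.exp (-((1 / ((n : ℝ) + 1)) ^ a * c))) atTop (𝓝 1) := by
        have h := (hl.rpow_const (p := a) (Or.inr h0.le)).mul_const c
        rw [Real.zero_rpow h0.ne', zero_mul] at h
        have h2 := h.neg.rexp
        rwa [neg_zero, Real.exp_zero] at h2
      exact this.congr fun n => (hν _ (by positivity)).symm
    have e := tendsto_nhds_unique t1 t2
    have e2 : ∫ x : unitInterval, (if (x : ℝ) = 0 then (1:ℝ) else 0) ∂(ν : Measure unitInterval) = 0 := by
      have hs : MeasurableSet {x : unitInterval | (x : ℝ) = 0} :=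
        measurable_subtype_coe (measurableSet_singleton (0:ℝ))
      have hi : Integrable (fun x : unitInterval => if (x : ℝ) = 0 then (0:ℝ) else 1)
          (ν : Measure unitInterval) :=
        Integrable.of_bound (Measurable.ite hs measurable_const measurable_const).aestronglyMeasurable
          1 (ae_of_all _ fun x => by split_ifs <;> simp)
      have : (fun x : unitInterval => if (x : ℝ) = 0 then (1:ℝ) else 0)
          = fun x : unitInterval => 1 - (if (x : ℝ) = 0 then (0:ℝ) else 1) := by
        funext x; split_ifs <;> simp
      rw [this, integral_sub (integrable_const _) hi, e]
      simp
    have hs : MeasurableSet {x : unitInterval | (x : ℝ) = 0} :=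
        measurable_subtype_coe (measurableSet_singleton (0:ℝ))
    rw [integral_eq_zero_iff_of_nonneg (fun x => by dsimp only; split_ifs <;> simp)
      (Integrable.of_bound (Measurable.ite hs measurable_const measurable_const).aestronglyMeasurable
          1 (ae_of_all _ fun x => by split_ifs <;> simp))] at e2
    filter_upwards [e2] with x hx h
    simp [h] at hx
  -- large exponents: no mass at `1`
  have ho : ∀ᵐ x : unitInterval ∂(ν : Measure unitInterval), (x : ℝ) ≠ 1 := by
    have hl : Tendsto (fun n : ℕ => ((n : ℝ) + 1)) atTop atTop :=
      tendsto_atTop_add_const_right _ _ tendsto_natCast_atTop_atTop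
    have t1 : Tendsto (fun n : ℕ => ∫ x : unitInterval, (x : ℝ) ^ ((n : ℝ) + 1)
        ∂(ν : Measure unitInterval)) atTop
        (𝓝 (∫ x : unitInterval, (if (x : ℝ) = 1 then 1 else 0) ∂(ν : Measure unitInterval))) := by
      refine tendsto_integral_of_dominated_convergence (fun _ => 1)
        (fun n => hmeas _ (by positivity)) (integrable_const _)
        (fun n => ae_of_all _ (hbd _ (by positivity))) (ae_of_all _ fun x => ?_)
      split_ifs with hx
      · rw [hx]
        simp
      · exact (tendsto_rpow_atTop_of_base_lt_one _ (by linarith [x.2.1])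
          (lt_of_le_of_ne x.2.2 hx)).comp hl
    have t2 : Tendsto (fun n : ℕ => ∫ x : unitInterval, (x : ℝ) ^ ((n : ℝ) + 1)
        ∂(ν : Measure unitInterval)) atTop (𝓝 0) := by
      have : Tendsto (fun n : ℕ => Real.exp (-(((n : ℝ) + 1) ^ a * c))) atTop (𝓝 0) :=
        Real.tendsto_exp_neg_atTop_nhds_zero.comp
          (((tendsto_rpow_atTop h0).comp hl).atTop_mul_const hc0)
      exact this.congr fun n => (hν _ (by positivity)).symm
    have e2 := tendsto_nhds_unique t1 t2
    have hs : MeasurableSet {x : unitInterval | (x : ℝ) = 1} :=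
        measurable_subtype_coe (measurableSet_singleton (1:ℝ))
    rw [integral_eq_zero_iff_of_nonneg (fun x => by dsimp only; split_ifs <;> simp)
      (Integrable.of_bound (Measurable.ite hs measurable_const measurable_const).aestronglyMeasurable
          1 (ae_of_all _ fun x => by split_ifs <;> simp))] at e2
    filter_upwards [e2] with x hx h
    simp [h] at hx
  have hfm : Measurable fun x : unitInterval => c ^ (-(1 / a)) * -Real.log (x : ℝ) := by fun_prop
  refine ⟨(ν : Measure unitInterval).map fun x : unitInterval => c ^ (-(1 / a)) * -Real.log (x : ℝ),
    Measure.isProbabilityMeasure_map hfm.aemeasurable, ?_, fun l hl => ?_⟩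
  · refine (ae_map_iff (p := fun u : ℝ => 0 < u) hfm.aemeasurable measurableSet_Ioi).2 ?_
    filter_upwards [hz, ho] with x hx0 hx1
    have : Real.log x < 0 := Real.log_neg (lt_of_le_of_ne x.2.1 (Ne.symm hx0))
      (lt_of_le_of_ne x.2.2 hx1)
    have := Real.rpow_pos_of_pos hc0 (-(1 / a))
    exact mul_pos this (by linarith)
  · rw [integral_map hfm.aemeasurable (by apply Measurable.aestronglyMeasurable; fun_prop)]
    have hlc : 0 < l * c ^ (-(1 / a)) := mul_pos hl (Real.rpow_pos_of_pos hc0 _)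
    have e : Real.exp (-l ^ a) = Real.exp (-((l * c ^ (-(1 / a))) ^ a * c)) := by
      rw [Real.mul_rpow hl.le (Real.rpow_nonneg hc0.le _), ← Real.rpow_mul hc0.le,
        show -(1 / a) * a = -1 by field_simp, Real.rpow_neg_one]
      congr 1
      field_simp
    rw [e, ← hν _ hlc]
    refine integral_congr_ae ?_
    filter_upwards [hz] with x hx0
    rw [Real.rpow_def_of_pos (lt_of_le_of_ne x.2.1 (Ne.symm hx0))]
    congr 1
    ring

end Subordinator

/-! ### Moments and tails of the one-sided stable law -/

section Tails

lemma min_one_le_two_mul_one_sub_exp {x : ℝ} (hx : 0 ≤ x) :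
    min 1 x ≤ 2 * (1 - Real.exp (-x)) := by
  have h1 : Real.exp (-x) ≤ 1 / (1 + x) := by
    rw [Real.exp_neg, inv_eq_one_div]
    exact one_div_le_one_div_of_le (by positivity) (by linarith [Real.add_one_le_exp x])
  have h2 : min 1 x ≤ 2 * (1 - 1 / (1 + x)) := by
    have e : 2 * (1 - 1 / (1 + x)) = 2 * x / (1 + x) := by field_simp; ring
    rw [e, le_div_iff₀ (by positivity)]
    rcases le_total 1 x with h | h
    · rw [min_eq_left h]; linarith
    · rw [min_eq_right h]; nlinarith
  linarith

variable {a : ℝ} {η : Measure ℝ}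

lemma IsOneSidedStable.integrable_exp (h : IsOneSidedStable a η) {l : ℝ} (hl : 0 ≤ l) :
    Integrable (fun u => Real.exp (-(l * u))) η := by
  have := h.isProbabilityMeasure
  refine Integrable.of_bound (by apply Measurable.aestronglyMeasurable; fun_prop) 1 ?_
  filter_upwards [h.pos] with u hu
  rw [Real.norm_of_nonneg (Real.exp_nonneg _), Real.exp_le_one_iff]
  have := mul_nonneg hl hu.le
  linarith

lemma IsOneSidedStable.integral_one_sub_exp (h : IsOneSidedStable a η) {l : ℝ} (hl : 0 < l) :
    ∫ u, (1 - Real.exp (-(l * u))) ∂η = 1 - Real.exp (-l ^ a) := by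
  have := h.isProbabilityMeasure
  rw [integral_sub (integrable_const _) (h.integrable_exp hl.le), h.laplace l hl]
  simp

lemma IsOneSidedStable.integrable_rpow_neg (h : IsOneSidedStable a η) (h0 : 0 < a) {k : ℝ}
    (hk : 0 < k) : Integrable (fun u => u ^ (-k)) η := by
  have := h.isProbabilityMeasure
  refine ⟨by apply Measurable.aestronglyMeasurable; fun_prop, ?_⟩
  -- `Γ(k) u^{-k} = ∫ l^{k-1} e^{-lu} dl`, so the moment is an integral of the Laplace transform
  have e1 : ∀ᵐ u ∂η, ‖u ^ (-k)‖ₑ = ENNReal.ofReal (1 / Real.Gamma k) *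
      ∫⁻ l in Set.Ioi (0:ℝ), ENNReal.ofReal (l ^ (k - 1) * Real.exp (-(l * u))) := by
    filter_upwards [h.pos] with u hu
    have e := Real.integral_rpow_mul_exp_neg_mul_Ioi hk hu
    have hi : Integrable (fun l : ℝ => l ^ (k - 1) * Real.exp (-(u * l)))
        (volume.restrict (Set.Ioi 0)) := by
      refine Integrable.of_integral_ne_zero ?_
      rw [e]
      have := Real.Gamma_pos_of_pos hk
      positivity
    have hG := Real.Gamma_pos_of_pos hk
    simp_rw [mul_comm _ u]
    rw [← ofReal_integral_eq_lintegral_ofReal hi, e, ← ENNReal.ofReal_mul (by positivity),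
      Real.enorm_of_nonneg (Real.rpow_nonneg hu.le _), Real.rpow_neg hu.le, one_div u,
      Real.inv_rpow hu.le]
    · congr 1
      field_simp
    · filter_upwards [ae_restrict_mem measurableSet_Ioi] with l hl
      have hl0 : (0:ℝ) < l := hl
      simp only [Pi.zero_apply]
      positivity
  rw [HasFiniteIntegral, lintegral_congr_ae e1, lintegral_const_mul' _ _ ENNReal.ofReal_ne_top,
    lintegral_lintegral_swap (by apply Measurable.aemeasurable; fun_prop)]
  refine ENNReal.mul_lt_top ENNReal.ofReal_lt_top ?_
  have e2 : ∫⁻ l in Set.Ioi (0:ℝ), ∫⁻ u, ENNReal.ofReal (l ^ (k - 1) * Real.exp (-(l * u))) ∂η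
      = ∫⁻ l in Set.Ioi (0:ℝ), ENNReal.ofReal (l ^ (k - 1) * Real.exp (-l ^ a)) := by
    refine setLIntegral_congr_fun measurableSet_Ioi fun l hl => ?_
    have hl0 : (0:ℝ) < l := hl
    rw [← h.laplace l hl0, ← integral_const_mul, ofReal_integral_eq_lintegral_ofReal
      ((h.integrable_exp hl0.le).const_mul _) (ae_of_all _ fun u => by
        have := Real.rpow_nonneg hl0.le (k - 1); simp only [Pi.zero_apply]; positivity)]
  rw [e2]
  have hi : Integrable (fun l : ℝ => l ^ (k - 1) * Real.exp (-l ^ a))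
        (volume.restrict (Set.Ioi 0)) := by
    refine Integrable.of_integral_ne_zero ?_
    rw [integral_rpow_mul_exp_neg_rpow h0 (by linarith)]
    have := Real.Gamma_pos_of_pos (show 0 < (k - 1 + 1) / a by rw [sub_add_cancel]; positivity)
    positivity
  exact hi.lintegral_lt_top

lemma IsOneSidedStable.integrable_min (h : IsOneSidedStable a η) {R : ℝ} (hR : 1 ≤ R) :
    Integrable (fun u => min 1 ((1 + u) / R)) η := by
  have := h.isProbabilityMeasure
  refine Integrable.of_bound (by apply Measurable.aestronglyMeasurable; fun_prop) 1 ?_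
  filter_upwards [h.pos] with u hu
  rw [Real.norm_of_nonneg (le_min zero_le_one (by positivity))]
  exact min_le_left _ _

/-- The tail of the one-sided stable law, read off its Laplace transform at `1 / R`. -/
lemma IsOneSidedStable.integral_min_le (h : IsOneSidedStable a η) (h1 : a < 1)
    {R : ℝ} (hR : 1 ≤ R) : ∫ u, min 1 ((1 + u) / R) ∂η ≤ 4 * R ^ (-a) := by
  have := h.isProbabilityMeasure
  have hR0 : 0 < R := by linarith
  have hi := h.integrable_exp (inv_pos.2 hR0).le
  calc ∫ u, min 1 ((1 + u) / R) ∂η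
      ≤ ∫ u, 2 * (1 - Real.exp (-R⁻¹) * Real.exp (-(R⁻¹ * u))) ∂η := by
        refine integral_mono_ae (h.integrable_min hR)
          (((integrable_const _).sub (hi.const_mul _)).const_mul _) ?_
        filter_upwards [h.pos] with u hu
        have := min_one_le_two_mul_one_sub_exp (x := (1 + u) / R) (by positivity)
        rw [← Real.exp_add, show -R⁻¹ + -(R⁻¹ * u) = -((1 + u) / R) by field_simp; ring]
        exact this
    _ = 2 * (1 - Real.exp (-(R⁻¹ + R⁻¹ ^ a))) := by
        rw [integral_const_mul, integral_sub (integrable_const _) (hi.const_mul _),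
          integral_const_mul, h.laplace _ (inv_pos.2 hR0), ← Real.exp_add]
        simp
        ring_nf
    _ ≤ 4 * R ^ (-a) := by
        have e1 := Real.add_one_le_exp (-(R⁻¹ + R⁻¹ ^ a))
        have e2 : R⁻¹ ^ a = R ^ (-a) := by rw [Real.inv_rpow hR0.le, Real.rpow_neg hR0.le]
        have e3 : R⁻¹ ≤ R ^ (-a) := by
          rw [← Real.rpow_neg_one]
          exact Real.rpow_le_rpow_of_exponent_le hR (by linarith)
        rw [e2] at e1 ⊢
        linarith

/-- At every scale `R ≥ 1` the one-sided stable law charges a window of size comparable to `R`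
with mass at least a multiple of `R ^ (-a)`. -/
lemma IsOneSidedStable.exists_window (h : IsOneSidedStable a η) (h0 : 0 < a) (h1 : a < 1) :
    ∃ δ K : ℝ, 0 < δ ∧ 0 < K ∧ ∀ R : ℝ, 1 ≤ R →
      4⁻¹ * R ^ (-a) ≤ η.real (Set.Icc (δ * R) (K * R)) := by
  have := h.isProbabilityMeasure
  -- `δ` and `K` are such that `[0, δR)` and `(KR, ∞)` contribute at most `R ^ (-a) / 8` each to the
  -- integral of `1 - e^{-u/R}`, which is at least `R ^ (-a) / 2`
  set δ : ℝ := (16⁻¹ : ℝ) ^ (1 / (1 - a)) with hδ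
  set K : ℝ := (16 : ℝ) ^ (1 / a) with hK
  have hδ0 : 0 < δ := by positivity
  have hK0 : 0 < K := by positivity
  have hδ1 : δ * δ ^ (-a) = 16⁻¹ := by
    nth_rewrite 1 [← Real.rpow_one δ]
    rw [← Real.rpow_add hδ0, hδ, ← Real.rpow_mul (by norm_num)]
    rw [show 1 / (1 - a) * (1 + -a) = 1 by
      have : 1 - a ≠ 0 := by linarith
      field_simp; ring, Real.rpow_one]
  have hK1 : K ^ (-a) = 16⁻¹ := by
    rw [hK, ← Real.rpow_mul (by norm_num), show 1 / a * -a = -1 by field_simp, Real.rpow_neg_one]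
  refine ⟨δ, K, hδ0, hK0, fun R hR => ?_⟩
  have hR0 : 0 < R := by linarith
  have hl0 : 0 < R⁻¹ := inv_pos.2 hR0
  have hl1 : 0 < (δ * R)⁻¹ := by positivity
  have hl2 : 0 < (K * R)⁻¹ := by positivity
  have i0 : Integrable (fun u => 1 - Real.exp (-(R⁻¹ * u))) η :=
    (integrable_const (1:ℝ)).sub (h.integrable_exp hl0.le)
  have i1 : Integrable (fun u => 2 * δ * (1 - Real.exp (-((δ * R)⁻¹ * u)))) η :=
    ((integrable_const (1:ℝ)).sub (h.integrable_exp hl1.le)).const_mul (2 * δ)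
  have i2 : Integrable (fun u => 2 * (1 - Real.exp (-((K * R)⁻¹ * u)))) η :=
    ((integrable_const (1:ℝ)).sub (h.integrable_exp hl2.le)).const_mul 2
  have i3 : Integrable ((Set.Icc (δ * R) (K * R)).indicator (fun _ : ℝ => (1:ℝ))) η :=
    (integrable_const _).indicator measurableSet_Icc
  have key : ∫ u, (1 - Real.exp (-(R⁻¹ * u))) ∂η ≤
      ∫ u, ((Set.Icc (δ * R) (K * R)).indicator (fun _ : ℝ => (1:ℝ)) u
        + 2 * δ * (1 - Real.exp (-((δ * R)⁻¹ * u)))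
        + 2 * (1 - Real.exp (-((K * R)⁻¹ * u)))) ∂η := by
    refine integral_mono_ae i0 ((i3.add i1).add i2) ?_
    filter_upwards [h.pos] with u hu
    have n1 : 0 ≤ 1 - Real.exp (-((δ * R)⁻¹ * u)) := by
      have := Real.exp_le_one_iff.2 (show -((δ * R)⁻¹ * u) ≤ 0 by
        have : 0 < (δ * R)⁻¹ * u := by positivity
        linarith)
      linarith
    have n2 : 0 ≤ 1 - Real.exp (-((K * R)⁻¹ * u)) := by
      have := Real.exp_le_one_iff.2 (show -((K * R)⁻¹ * u) ≤ 0 by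
        have : 0 < (K * R)⁻¹ * u := by positivity
        linarith)
      linarith
    have n3 : 1 - Real.exp (-(R⁻¹ * u)) ≤ 1 := by linarith [Real.exp_pos (-(R⁻¹ * u))]
    have n4 : 0 ≤ (Set.Icc (δ * R) (K * R)).indicator (fun _ : ℝ => (1:ℝ)) u :=
      Set.indicator_nonneg (fun _ _ => zero_le_one) _
    have n5 : 0 ≤ 2 * δ * (1 - Real.exp (-((δ * R)⁻¹ * u))) := by positivity
    rcases lt_or_ge u (δ * R) with hu1 | hu1
    · have m := min_one_le_two_mul_one_sub_exp (x := (δ * R)⁻¹ * u) (by positivity)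
      rw [min_eq_right (by rw [inv_mul_le_iff₀ (by positivity)]; linarith)] at m
      have e : R⁻¹ * u = δ * ((δ * R)⁻¹ * u) := by field_simp
      have := Real.add_one_le_exp (-(R⁻¹ * u))
      have := mul_le_mul_of_nonneg_left m hδ0.le
      linarith
    · rcases le_or_gt u (K * R) with hu2 | hu2
      · rw [Set.indicator_of_mem (show u ∈ Set.Icc (δ * R) (K * R) from ⟨hu1, hu2⟩)]
        linarith
      · have m := min_one_le_two_mul_one_sub_exp (x := (K * R)⁻¹ * u) (by positivity)
        rw [min_eq_left (by rw [← div_eq_inv_mul, le_div_iff₀ (by positivity)]; linarith)] at m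
        linarith
  rw [integral_add (by exact i3.add i1) i2, integral_add i3 i1, integral_const_mul, integral_const_mul,
    h.integral_one_sub_exp hl0, h.integral_one_sub_exp hl1, h.integral_one_sub_exp hl2,
    integral_indicator_const _ measurableSet_Icc] at key
  simp only [smul_eq_mul, mul_one] at key
  have b1 := Real.add_one_le_exp (-((δ * R)⁻¹) ^ a)
  have b2 := Real.add_one_le_exp (-((K * R)⁻¹) ^ a)
  have e0 : R⁻¹ ^ a = R ^ (-a) := by rw [Real.inv_rpow hR0.le, Real.rpow_neg hR0.le]
  have e1 : (δ * R)⁻¹ ^ a = δ ^ (-a) * R ^ (-a) := by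
    rw [Real.inv_rpow (by positivity), ← Real.rpow_neg (by positivity),
      Real.mul_rpow hδ0.le hR0.le]
  have e2 : (K * R)⁻¹ ^ a = 16⁻¹ * R ^ (-a) := by
    rw [Real.inv_rpow (by positivity), ← Real.rpow_neg (by positivity),
      Real.mul_rpow hK0.le hR0.le, hK1]
  have b3 := min_one_le_two_mul_one_sub_exp (x := R ^ (-a)) (by positivity)
  rw [min_eq_right (Real.rpow_le_one_of_one_le_of_nonpos hR (by linarith))] at b3
  rw [e0, e1, e2] at key
  rw [e1] at b1
  rw [e2] at b2
  have b4 : 2 * δ * (1 - Real.exp (-(δ ^ (-a) * R ^ (-a)))) ≤ 8⁻¹ * R ^ (-a) := by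
    calc 2 * δ * (1 - Real.exp (-(δ ^ (-a) * R ^ (-a)))) ≤ 2 * δ * (δ ^ (-a) * R ^ (-a)) := by
          gcongr; linarith
      _ = 2 * (δ * δ ^ (-a)) * R ^ (-a) := by ring
      _ = 8⁻¹ * R ^ (-a) := by rw [hδ1]; norm_num
  linarith

/-- The weight dominating a Gaussian density of variance parameter `u` at squared distance `R - 1`,
together with its rescaled derivatives. -/
def gaussWeight (d : ℕ) (R u : ℝ) : ℝ :=
  u ^ (-((d : ℝ) / 2)) * ((1 + 1 / u) * min 1 ((1 + u) / R) ^ (d + 1))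

lemma gaussWeight_nonneg {d : ℕ} {R u : ℝ} (hR : 1 ≤ R) (hu : 0 < u) : 0 ≤ gaussWeight d R u := by
  have : 0 ≤ min 1 ((1 + u) / R) := le_min zero_le_one (by positivity)
  unfold gaussWeight
  positivity

/-- Large `u` are controlled by the tail of the one-sided law, small `u` by its negative moments. -/
lemma gaussWeight_le (d : ℕ) (h0 : 0 < a) (h1 : a < 1) {R u : ℝ} (hR : 1 ≤ R) (hu : 0 < u) :
    gaussWeight d R u ≤ 2 * 2 ^ ((d : ℝ) / 2) * R ^ (-((d : ℝ) / 2)) * min 1 ((1 + u) / R)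
      + 2 * 2 ^ (d + 1) * R ^ (-((d : ℝ) / 2) - a) * u ^ (-((d : ℝ) / 2 + 1)) := by
  have hR0 : 0 < R := by linarith
  set q := min 1 ((1 + u) / R) with hq
  have hq0 : 0 < q := lt_min one_pos (by positivity)
  have hq1 : q ≤ 1 := min_le_left _ _
  have hq2 : q ≤ (1 + u) / R := min_le_right _ _
  set s : ℝ := (d : ℝ) / 2 with hs
  have hs0 : 0 ≤ s := by positivity
  have hd : ((d + 1 : ℕ) : ℝ) = 2 * s + 1 := by rw [hs]; push_cast; ring
  unfold gaussWeight
  rw [← hq, ← hs]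
  rcases le_or_gt 1 u with h | h
  · have t1 : q ^ (d + 1) ≤ ((1 + u) / R) ^ s * q := by
      calc q ^ (d + 1) = q ^ (2 * s + 1) := by rw [← hd, Real.rpow_natCast]
        _ ≤ q ^ (s + 1) := Real.rpow_le_rpow_of_exponent_ge hq0 hq1 (by linarith)
        _ = q ^ s * q := by rw [Real.rpow_add hq0, Real.rpow_one]
        _ ≤ ((1 + u) / R) ^ s * q := by gcongr
    have t2 : u ^ (-s) * (1 + u) ^ s ≤ 2 ^ s := by
      rw [Real.rpow_neg hu.le, ← div_eq_inv_mul, ← Real.div_rpow (by positivity) hu.le]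
      refine Real.rpow_le_rpow (by positivity) ?_ hs0
      rw [div_le_iff₀ hu]; linarith
    have t3 : 1 + 1 / u ≤ 2 := by
      have : 1 / u ≤ 1 := by rw [div_le_one hu]; exact h
      linarith
    calc u ^ (-s) * ((1 + 1 / u) * q ^ (d + 1))
        ≤ u ^ (-s) * (2 * (((1 + u) / R) ^ s * q)) := by gcongr
      _ = 2 * (u ^ (-s) * (1 + u) ^ s) * R ^ (-s) * q := by
          rw [Real.div_rpow (by positivity) hR0.le, Real.rpow_neg hR0.le]; ring
      _ ≤ 2 * 2 ^ s * R ^ (-s) * q := by gcongr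
      _ ≤ _ := le_add_of_nonneg_right (by positivity)
  · have t1 : q ^ (d + 1) ≤ 2 ^ (d + 1) * R ^ (-s - a) := by
      calc q ^ (d + 1) ≤ (2 / R) ^ (d + 1) := by
            gcongr
            exact hq2.trans (by gcongr; linarith)
        _ = 2 ^ (d + 1) * R ^ (-(2 * s + 1)) := by
            rw [div_pow, Real.rpow_neg hR0.le, ← hd, Real.rpow_natCast]; rfl
        _ ≤ 2 ^ (d + 1) * R ^ (-s - a) := by
            gcongr 2 ^ (d + 1) * ?_
            exact Real.rpow_le_rpow_of_exponent_le hR (by linarith)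
    have t3 : 1 + 1 / u ≤ 2 * u ^ (-(1:ℝ)) := by
      rw [Real.rpow_neg_one, ← one_div]
      have : 1 ≤ 1 / u := by rw [le_div_iff₀ hu]; linarith
      linarith
    calc u ^ (-s) * ((1 + 1 / u) * q ^ (d + 1))
        ≤ u ^ (-s) * (2 * u ^ (-(1:ℝ)) * (2 ^ (d + 1) * R ^ (-s - a))) := by gcongr
      _ = 2 * 2 ^ (d + 1) * R ^ (-s - a) * (u ^ (-s) * u ^ (-(1:ℝ))) := by ring
      _ = 2 * 2 ^ (d + 1) * R ^ (-s - a) * u ^ (-(s + 1)) := by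
          rw [← Real.rpow_add hu]; congr 2; ring
      _ ≤ _ := le_add_of_nonneg_left (by positivity)

lemma IsOneSidedStable.integrable_gaussWeight (h : IsOneSidedStable a η) (h0 : 0 < a) (h1 : a < 1)
    (d : ℕ) {R : ℝ} (hR : 1 ≤ R) : Integrable (gaussWeight d R) η := by
  refine Integrable.mono' (((h.integrable_min hR).const_mul
    (2 * 2 ^ ((d : ℝ) / 2) * R ^ (-((d : ℝ) / 2)))).add
    ((h.integrable_rpow_neg h0 (show 0 < (d : ℝ) / 2 + 1 by positivity)).const_mul
    (2 * 2 ^ (d + 1) * R ^ (-((d : ℝ) / 2) - a))))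
    (by apply Measurable.aestronglyMeasurable; unfold gaussWeight; fun_prop) ?_
  · filter_upwards [h.pos] with u hu
    rw [Real.norm_of_nonneg (gaussWeight_nonneg hR hu)]
    exact gaussWeight_le d h0 h1 hR hu

lemma IsOneSidedStable.exists_integral_gaussWeight_le (h : IsOneSidedStable a η) (h0 : 0 < a)
    (h1 : a < 1) (d : ℕ) :
    ∃ C : ℝ, 0 < C ∧ ∀ R : ℝ, 1 ≤ R →
      ∫ u, gaussWeight d R u ∂η ≤ C * R ^ (-((d : ℝ) / 2) - a) := by
  set I := ∫ u, u ^ (-((d : ℝ) / 2 + 1)) ∂η with hI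
  have hI0 : 0 ≤ I := integral_nonneg_of_ae (by
    filter_upwards [h.pos] with u hu using Real.rpow_nonneg hu.le _)
  refine ⟨2 * 2 ^ ((d : ℝ) / 2) * 4 + 2 * 2 ^ (d + 1) * I, by positivity, fun R hR => ?_⟩
  have hR0 : 0 < R := by linarith
  have i1 := (h.integrable_min hR).const_mul (2 * 2 ^ ((d : ℝ) / 2) * R ^ (-((d : ℝ) / 2)))
  have i2 := (h.integrable_rpow_neg h0 (show 0 < (d : ℝ) / 2 + 1 by positivity)).const_mul
    (2 * 2 ^ (d + 1) * R ^ (-((d : ℝ) / 2) - a))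
  calc ∫ u, gaussWeight d R u ∂η
      ≤ ∫ u, (2 * 2 ^ ((d : ℝ) / 2) * R ^ (-((d : ℝ) / 2)) * min 1 ((1 + u) / R)
      + 2 * 2 ^ (d + 1) * R ^ (-((d : ℝ) / 2) - a) * u ^ (-((d : ℝ) / 2 + 1))) ∂η := by
        refine integral_mono_ae (h.integrable_gaussWeight h0 h1 d hR) (i1.add i2) ?_
        filter_upwards [h.pos] with u hu using gaussWeight_le d h0 h1 hR hu
    _ = 2 * 2 ^ ((d : ℝ) / 2) * R ^ (-((d : ℝ) / 2)) * ∫ u, min 1 ((1 + u) / R) ∂η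
      + 2 * 2 ^ (d + 1) * R ^ (-((d : ℝ) / 2) - a) * I := by
        rw [integral_add i1 i2, integral_const_mul, integral_const_mul]
    _ ≤ 2 * 2 ^ ((d : ℝ) / 2) * R ^ (-((d : ℝ) / 2)) * (4 * R ^ (-a))
      + 2 * 2 ^ (d + 1) * R ^ (-((d : ℝ) / 2) - a) * I := by
        gcongr
        exact h.integral_min_le h1 hR
    _ = _ := by
        rw [sub_eq_add_neg, Real.rpow_add hR0]
        ring

end Tails

/-! ### The Lévy exponent -/

section Exponent

variable {d : ℕ} {α : ℝ}

/-- The Lévy measure integrates `min 1 ‖z‖²`. -/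
lemma integrable_levyDensity_mul_min (hd : 1 ≤ d) (h0 : 0 < α) (h2 : α < 2) :
    Integrable (fun z : Rd d => ‖z‖ ^ (-(d : ℝ) - α) * min 1 (‖z‖ ^ 2)) := by
  have : Nonempty (Fin d) := ⟨⟨0, hd⟩⟩
  rw [integrable_fun_norm_addHaar (volume : Measure (Rd d))
    (f := fun r : ℝ => r ^ (-(d : ℝ) - α) * min 1 (r ^ 2))]
  have hf : Module.finrank ℝ (Rd d) = d := by simp
  rw [hf]
  have hm : Measurable fun y : ℝ => y ^ (d - 1) • (y ^ (-(d : ℝ) - α) * min 1 (y ^ 2)) := by fun_prop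
  have hpow : ∀ y : ℝ, 0 < y → y ^ (d - 1) * y ^ (-(d : ℝ) - α) = y ^ (-1 - α) := by
    intro y hy
    rw [← Real.rpow_natCast, ← Real.rpow_add hy, Nat.cast_sub hd]
    congr 1
    push_cast
    ring
  rw [← Set.Ioc_union_Ioi_eq_Ioi (zero_le_one (α := ℝ))]
  refine IntegrableOn.union ?_ ?_
  · have : IntegrableOn (fun v : ℝ => v ^ (1 - α)) (Set.Ioc 0 1) := by
      rw [← intervalIntegrable_iff_integrableOn_Ioc_of_le zero_le_one]
      exact intervalIntegral.intervalIntegrable_rpow' (by linarith)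
    refine Integrable.mono' this hm.aestronglyMeasurable ?_
    filter_upwards [ae_restrict_mem measurableSet_Ioc] with v hv
    have hv0 : 0 < v := hv.1
    have e : v ^ (1 - α) = v ^ (-1 - α) * v ^ 2 := by
      rw [← Real.rpow_natCast, ← Real.rpow_add hv0]
      congr 1
      push_cast
      ring
    rw [Real.norm_of_nonneg (by positivity), smul_eq_mul, ← mul_assoc, hpow v hv0, e]
    gcongr
    exact min_le_right _ _
  · have : IntegrableOn (fun v : ℝ => v ^ (-1 - α)) (Set.Ioi 1) :=
      integrableOn_Ioi_rpow_of_lt (by linarith) one_pos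
    refine Integrable.mono' this hm.aestronglyMeasurable ?_
    filter_upwards [ae_restrict_mem measurableSet_Ioi] with v hv
    have hv0 : 0 < v := lt_trans one_pos hv
    rw [Real.norm_of_nonneg (by positivity), smul_eq_mul, ← mul_assoc, hpow v hv0]
    exact mul_le_of_le_one_right (by positivity) (min_le_left _ _)

/-- The real Lévy exponent `∫ (1 - cos (ξ·z)) |z|^{-d-α} dz`. -/
def cosExponent (d : ℕ) (α : ℝ) (ξ : Rd d) : ℝ :=
  ∫ z : Rd d, ‖z‖ ^ (-(d : ℝ) - α) * (1 - Real.cos ⟪z, ξ⟫)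

lemma norm_exp_I_sub_one_le (x : ℝ) : ‖Complex.exp (x * Complex.I) - 1‖ ≤ 2 := by
  refine (norm_sub_le _ _).trans ?_
  rw [Complex.norm_exp_ofReal_mul_I]
  norm_num

lemma norm_exp_I_sub_one_sub_le (x : ℝ) :
    ‖Complex.exp (x * Complex.I) - 1 - x * Complex.I‖ ≤ 3 * x ^ 2 := by
  have hn : ‖(x : ℂ) * Complex.I‖ = |x| := by simp
  rcases le_or_gt |x| 1 with h | h
  · refine (Complex.norm_exp_sub_one_sub_id_le (by rwa [hn])).trans ?_
    rw [hn, sq_abs]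
    nlinarith [sq_nonneg x]
  · refine (norm_sub_le _ _).trans ?_
    rw [hn, ← sq_abs x]
    have := norm_exp_I_sub_one_le x
    nlinarith

lemma norm_levy_integrand_le (ξ z : Rd d) :
    ‖Complex.exp ((⟪z, ξ⟫ : ℝ) * Complex.I) - 1
      - (if ‖z‖ ≤ 1 then ((⟪z, ξ⟫ : ℝ) : ℂ) * Complex.I else 0)‖
      ≤ (2 + 3 * ‖ξ‖ ^ 2) * min 1 (‖z‖ ^ 2) := by
  split_ifs with h
  · rw [min_eq_right (by nlinarith [norm_nonneg z])]
    refine (norm_exp_I_sub_one_sub_le _).trans ?_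
    have h1 : (⟪z, ξ⟫ : ℝ) ^ 2 ≤ (‖z‖ * ‖ξ‖) ^ 2 := by
      rw [← sq_abs]
      gcongr
      exact abs_real_inner_le_norm z ξ
    nlinarith [sq_nonneg ‖z‖]
  · rw [min_eq_left (by nlinarith), sub_zero]
    refine (norm_exp_I_sub_one_le _).trans ?_
    nlinarith [sq_nonneg ‖ξ‖]

lemma integrable_cosExponent (hd : 1 ≤ d) (h0 : 0 < α) (h2 : α < 2) (ξ : Rd d) :
    Integrable (fun z : Rd d => ‖z‖ ^ (-(d : ℝ) - α) * (1 - Real.cos ⟪z, ξ⟫)) := by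
  refine Integrable.mono' ((integrable_levyDensity_mul_min hd h0 h2).const_mul (2 + 3 * ‖ξ‖ ^ 2))
    (by apply Measurable.aestronglyMeasurable; fun_prop) (ae_of_all _ fun z => ?_)
  have h1 := norm_levy_integrand_le ξ z
  have h3 := (Complex.abs_re_le_norm _).trans h1
  have h4 : (Complex.exp ((⟪z, ξ⟫ : ℝ) * Complex.I) - 1
      - (if ‖z‖ ≤ 1 then ((⟪z, ξ⟫ : ℝ) : ℂ) * Complex.I else 0)).re = Real.cos ⟪z, ξ⟫ - 1 := by
    split_ifs <;> simp [Complex.exp_ofReal_mul_I_re]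
  rw [h4, abs_sub_comm] at h3
  rw [norm_mul, Real.norm_of_nonneg (by positivity), Real.norm_eq_abs]
  calc _ ≤ ‖z‖ ^ (-(d : ℝ) - α) * ((2 + 3 * ‖ξ‖ ^ 2) * min 1 (‖z‖ ^ 2)) := by gcongr
    _ = _ := by ring

lemma levyExponent_eq_neg_cosExponent (hd : 1 ≤ d) (h0 : 0 < α) (h2 : α < 2) (ξ : Rd d) :
    levyExponent d α ξ = -(cosExponent d α ξ : ℂ) := by
  set F : Rd d → ℂ := fun z => Complex.exp ((⟪z, ξ⟫ : ℝ) * Complex.I) - 1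
      - (if ‖z‖ ≤ 1 then ((⟪z, ξ⟫ : ℝ) : ℂ) * Complex.I else 0) with hF
  have hFm : Measurable F := by
    refine Measurable.sub (by fun_prop) (Measurable.ite ?_ (by fun_prop) measurable_const)
    exact measurableSet_le measurable_norm measurable_const
  have e1 : levyExponent d α ξ = ∫ z : Rd d, ‖z‖ ^ (-(d : ℝ) - α) • F z := by
    rw [levyExponent, levyMeasure, integral_withDensity_eq_integral_toReal_smul (by fun_prop)
      (ae_of_all _ fun y => ENNReal.ofReal_lt_top)]
    refine integral_congr_ae (ae_of_all _ fun z => ?_)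
    dsimp only
    rw [ENNReal.toReal_ofReal (by positivity)]
  have hI : Integrable (fun z : Rd d => ‖z‖ ^ (-(d : ℝ) - α) • F z) := by
    refine Integrable.mono' ((integrable_levyDensity_mul_min hd h0 h2).const_mul (2 + 3 * ‖ξ‖ ^ 2))
      (Measurable.aestronglyMeasurable (by fun_prop)) (ae_of_all _ fun z => ?_)
    rw [norm_smul, Real.norm_of_nonneg (by positivity)]
    calc _ ≤ ‖z‖ ^ (-(d : ℝ) - α) * ((2 + 3 * ‖ξ‖ ^ 2) * min 1 (‖z‖ ^ 2)) := by
          gcongr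
          exact norm_levy_integrand_le ξ z
      _ = _ := by ring
  -- the integrand is symmetrized under `z ↦ -z`, which cancels the compensator
  have e2 : ∫ z : Rd d, ‖-z‖ ^ (-(d : ℝ) - α) • F (-z) = levyExponent d α ξ := by
    rw [e1]
    exact integral_neg_eq_self (fun z : Rd d => ‖z‖ ^ (-(d : ℝ) - α) • F z) volume
  have e3 : levyExponent d α ξ + levyExponent d α ξ = ∫ z : Rd d,
      ((-2 * (‖z‖ ^ (-(d : ℝ) - α) * (1 - Real.cos ⟪z, ξ⟫)) : ℝ) : ℂ) := by
    nth_rewrite 1 [← e2]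
    rw [e1, ← integral_add (by exact hI.comp_neg) hI]
    refine integral_congr_ae (ae_of_all _ fun z => ?_)
    simp only [hF, norm_neg, inner_neg_left, Complex.real_smul, Complex.exp_mul_I,
      Complex.ofReal_neg, Complex.cos_neg, Complex.sin_neg]
    push_cast
    split_ifs <;> ring
  rw [integral_complex_ofReal, integral_const_mul] at e3
  have : (2 : ℂ) * levyExponent d α ξ = 2 * -(cosExponent d α ξ : ℂ) := by
    rw [two_mul, e3, cosExponent]
    push_cast
    ring
  exact mul_left_cancel₀ two_ne_zero this

lemma cosExponent_map (U : Rd d ≃ₗᵢ[ℝ] Rd d) (ξ : Rd d) :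
    cosExponent d α (U ξ) = cosExponent d α ξ := by
  rw [cosExponent, ← U.measurePreserving.integral_comp U.toHomeomorph.measurableEmbedding]
  simp [cosExponent]

lemma cosExponent_smul {r : ℝ} (hr : 0 < r) (ξ : Rd d) :
    cosExponent d α (r • ξ) = r ^ α * cosExponent d α ξ := by
  have h := Measure.integral_comp_smul (volume : Measure (Rd d))
    (fun z : Rd d => ‖z‖ ^ (-(d : ℝ) - α) * (1 - Real.cos ⟪z, ξ⟫)) r
  have hf : Module.finrank ℝ (Rd d) = d := by simp
  rw [hf, abs_of_pos (by positivity), smul_eq_mul] at h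
  have e : ∀ z : Rd d, ‖r • z‖ ^ (-(d : ℝ) - α) * (1 - Real.cos ⟪r • z, ξ⟫)
      = r ^ (-(d : ℝ) - α) * (‖z‖ ^ (-(d : ℝ) - α) * (1 - Real.cos ⟪z, r • ξ⟫)) := by
    intro z
    rw [norm_smul, Real.norm_of_nonneg hr.le, Real.mul_rpow hr.le (norm_nonneg z), inner_smul_left,
      inner_smul_right]
    simp only [conj_trivial]
    ring
  simp_rw [e] at h
  rw [integral_const_mul] at h
  have hp : r ^ (-(d : ℝ) - α) = (r ^ d)⁻¹ * (r ^ α)⁻¹ := by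
    rw [sub_eq_add_neg, Real.rpow_add hr, Real.rpow_neg hr.le, Real.rpow_neg hr.le,
      Real.rpow_natCast]
  rw [hp] at h
  have h1 : 0 < r ^ d := by positivity
  have h2 : 0 < r ^ α := by positivity
  change (r ^ d)⁻¹ * (r ^ α)⁻¹ * cosExponent d α (r • ξ) = (r ^ d)⁻¹ * cosExponent d α ξ at h
  rw [mul_assoc] at h
  have h3 := mul_left_cancel₀ (inv_pos.2 h1).ne' h
  rw [← h3]
  field_simp

lemma cosExponent_pos (hd : 1 ≤ d) (h0 : 0 < α) (h2 : α < 2) {ξ : Rd d} (hξ : ‖ξ‖ = 1) :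
    0 < cosExponent d α ξ := by
  rw [cosExponent, integral_pos_iff_support_of_nonneg (fun z => ?_)
    (integrable_cosExponent hd h0 h2 ξ)]
  · have ho : IsOpen {z : Rd d | (⟪z, ξ⟫ : ℝ) ∈ Set.Ioo (0:ℝ) 2} :=
      isOpen_Ioo.preimage (by fun_prop)
    have hne : {z : Rd d | (⟪z, ξ⟫ : ℝ) ∈ Set.Ioo (0:ℝ) 2}.Nonempty := by
      refine ⟨ξ, ?_⟩
      simp [hξ]
    refine lt_of_lt_of_le (ho.measure_pos volume hne) (measure_mono fun z hz => ?_)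
    have hz1 : 0 < (⟪z, ξ⟫ : ℝ) := hz.1
    have hz2 : (⟪z, ξ⟫ : ℝ) < 2 := hz.2
    have hc : Real.cos (⟪z, ξ⟫ : ℝ) < 1 := by
      rw [← Real.cos_zero]
      exact Real.cos_lt_cos_of_nonneg_of_le_pi le_rfl (by linarith [Real.pi_gt_three]) hz1
    have hn : 0 < ‖z‖ := by
      rw [norm_pos_iff]
      rintro rfl
      simp at hz1
    have : 0 < ‖z‖ ^ (-(d : ℝ) - α) := by positivity
    exact (mul_pos this (by linarith)).ne'
  · have := Real.cos_le_one (⟪z, ξ⟫ : ℝ)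
    exact mul_nonneg (by positivity) (by linarith)

/-- The Lévy exponent is a negative multiple of `‖ξ‖ ^ α`. -/
theorem exists_levyExponent_eq (hd : 1 ≤ d) (h0 : 0 < α) (h2 : α < 2) :
    ∃ κ : ℝ, 0 < κ ∧ ∀ ξ : Rd d, levyExponent d α ξ = ((-(κ * ‖ξ‖ ^ α) : ℝ) : ℂ) := by
  set e₀ : Rd d := EuclideanSpace.single ⟨0, hd⟩ 1 with he
  have he1 : ‖e₀‖ = 1 := by simp [he]
  refine ⟨cosExponent d α e₀, cosExponent_pos hd h0 h2 he1, fun ξ => ?_⟩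
  rw [levyExponent_eq_neg_cosExponent hd h0 h2, Complex.ofReal_neg]
  congr 2
  rcases eq_or_ne ξ 0 with rfl | hξ
  · simp [cosExponent, Real.zero_rpow h0.ne']
  · have hn : 0 < ‖ξ‖ := norm_pos_iff.2 hξ
    have h1 : ‖‖ξ‖ • e₀‖ = ‖ξ‖ := by rw [norm_smul, norm_norm, he1, mul_one]
    calc cosExponent d α ξ
        = cosExponent d α ((ℝ ∙ (‖ξ‖ • e₀ - ξ))ᗮ.reflection (‖ξ‖ • e₀)) := by
          rw [Submodule.reflection_sub h1]
      _ = cosExponent d α e₀ * ‖ξ‖ ^ α := by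
          rw [cosExponent_map, cosExponent_smul hn, mul_comm]

end Exponent

/-! ### The stable density as a mixture of Gaussian densities -/

section Mixture

/-- The constant `κ` and the measure `η` represent the stable law of index `α` on `ℝ^d`: the Lévy
exponent is `-κ ‖ξ‖ ^ α`, and `η` is the one-sided `α / 2`-stable law. -/
structure IsSubordination (d : ℕ) (α κ : ℝ) (η : Measure ℝ) : Prop where
  one_le_dim : 1 ≤ d
  one_lt : 1 < α
  lt_two : α < 2
  scale_pos : 0 < κ
  levyExponent_eq : ∀ ξ : Rd d, levyExponent d α ξ = ((-(κ * ‖ξ‖ ^ α) : ℝ) : ℂ)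
  oneSided : IsOneSidedStable (α / 2) η

/-- Existence of the representation, by rotation invariance and scaling of the Lévy exponent. -/
lemma exists_isSubordination {d : ℕ} {α : ℝ} (hd : 1 ≤ d) (h1 : 1 < α) (h2 : α < 2) :
    ∃ κ η, IsSubordination d α κ η := by
  obtain ⟨κ, hκ, h⟩ := exists_levyExponent_eq hd (by linarith : 0 < α) h2
  obtain ⟨η, hη⟩ := exists_isOneSidedStable (a := α / 2) (by linarith) (by linarith)
  exact ⟨κ, η, hd, h1, h2, hκ, h, hη⟩

/-- The mixture of centred Gaussian densities of covariance `2u` with respect to `η (du)`. -/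
def gaussMix (d : ℕ) (η : Measure ℝ) (x : Rd d) : ℝ :=
  ∫ u, (4 * Real.pi * u) ^ (-((d : ℝ) / 2)) * Real.exp (-(‖x‖ ^ 2 / (4 * u))) ∂η

variable {d : ℕ} {α κ : ℝ} {η : Measure ℝ}

lemma integral_exp_inner_mul_gaussian {b : ℝ} (hb : 0 < b) (w : Rd d) :
    ∫ v : Rd d, Complex.exp ((⟪w, v⟫ : ℝ) * Complex.I) * (Real.exp (-(b * ‖v‖ ^ 2)) : ℂ)
      = (((Real.pi / b) ^ ((d : ℝ) / 2) * Real.exp (-(‖w‖ ^ 2 / (4 * b))) : ℝ) : ℂ) := by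
  have h := GaussianFourier.integral_cexp_neg_mul_sq_norm_add (V := Rd d) (b := (b : ℂ))
    (by simpa using hb) Complex.I w
  have hf : Module.finrank ℝ (Rd d) = d := by simp
  rw [hf] at h
  calc _ = ∫ v : Rd d, Complex.exp (-(b : ℂ) * (‖v‖ : ℂ) ^ 2 + Complex.I * ((⟪w, v⟫ : ℝ) : ℂ)) := by
        refine integral_congr_ae (ae_of_all _ fun v => ?_)
        dsimp only
        rw [Complex.ofReal_exp, ← Complex.exp_add]
        congr 1
        push_cast
        ring
    _ = _ := by
        rw [h, Complex.ofReal_mul, Complex.ofReal_cpow (by positivity), Complex.ofReal_exp,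
          Complex.I_sq]
        push_cast
        congr 2
        ring

lemma integrable_exp_neg_mul_norm_sq {b : ℝ} (hb : 0 < b) :
    Integrable (fun v : Rd d => Real.exp (-(b * ‖v‖ ^ 2))) := by
  have h := GaussianFourier.integrable_cexp_neg_mul_sq_norm_add (V := Rd d) (b := (b : ℂ))
    (by simpa using hb) 0 0
  refine h.norm.congr (ae_of_all _ fun v => ?_)
  dsimp only
  rw [Complex.norm_exp]
  congr 1
  simp [← Complex.ofReal_pow]

lemma integral_exp_neg_mul_norm_sq {b : ℝ} (hb : 0 < b) :
    ∫ v : Rd d, Real.exp (-(b * ‖v‖ ^ 2)) = (Real.pi / b) ^ ((d : ℝ) / 2) := by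
  have h := integral_exp_inner_mul_gaussian (d := d) hb 0
  simp only [inner_zero_left, Complex.ofReal_zero, zero_mul, Complex.exp_zero, one_mul,
    norm_zero] at h
  rw [integral_complex_ofReal] at h
  have := Complex.ofReal_injective h
  simpa using this

lemma norm_exp_ofReal_mul_I_mul (x : ℝ) {y : ℝ} (hy : 0 ≤ y) :
    ‖Complex.exp (x * Complex.I) * (y : ℂ)‖ = y := by
  rw [norm_mul, Complex.norm_exp_ofReal_mul_I, one_mul, Complex.norm_real, Real.norm_of_nonneg hy]

namespace IsSubordination

lemma dim_half_pos (h : IsSubordination d α κ η) : 0 < (d : ℝ) / 2 := by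
  have : (1:ℝ) ≤ d := by exact_mod_cast h.one_le_dim
  linarith

lemma pos (h : IsSubordination d α κ η) : 0 < α := by linarith [h.one_lt]

lemma laplace_norm (h : IsSubordination d α κ η) (ξ : Rd d) :
    ∫ u, Real.exp (-(u * ‖ξ‖ ^ 2)) ∂η = Real.exp (-‖ξ‖ ^ α) := by
  have := h.oneSided.isProbabilityMeasure
  rcases eq_or_ne ξ 0 with rfl | hξ
  · simp [Real.zero_rpow h.pos.ne']
  · have hn : 0 < ‖ξ‖ := norm_pos_iff.2 hξ
    simp_rw [mul_comm _ (‖ξ‖ ^ 2)]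
    rw [h.oneSided.laplace _ (by positivity), ← Real.rpow_natCast, ← Real.rpow_mul hn.le]
    congr 3
    push_cast
    ring

lemma integrable_gaussMix (h : IsSubordination d α κ η) (x : Rd d) :
    Integrable (fun u => (4 * Real.pi * u) ^ (-((d : ℝ) / 2)) * Real.exp (-(‖x‖ ^ 2 / (4 * u)))) η := by
  refine Integrable.mono' ((h.oneSided.integrable_rpow_neg (by linarith [h.pos])
    h.dim_half_pos).const_mul ((4 * Real.pi) ^ (-((d : ℝ) / 2))))
    (by apply Measurable.aestronglyMeasurable; fun_prop) ?_
  filter_upwards [h.oneSided.pos] with u hu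
  rw [Real.norm_of_nonneg (by positivity), Real.mul_rpow (by positivity) hu.le]
  refine mul_le_of_le_one_right (by positivity) ?_
  rw [Real.exp_le_one_iff]
  have : 0 ≤ ‖x‖ ^ 2 / (4 * u) := by positivity
  linarith

lemma gaussMix_nonneg (h : IsSubordination d α κ η) (x : Rd d) : 0 ≤ gaussMix d η x := by
  refine integral_nonneg_of_ae ?_
  filter_upwards [h.oneSided.pos] with u hu
  simp only [Pi.zero_apply]
  positivity

lemma gaussMix_le (h : IsSubordination d α κ η) (x : Rd d) : gaussMix d η x ≤ gaussMix d η 0 := by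
  refine integral_mono_ae (h.integrable_gaussMix x) (h.integrable_gaussMix 0) ?_
  filter_upwards [h.oneSided.pos] with u hu
  have : 0 ≤ ‖x‖ ^ 2 / (4 * u) := by positivity
  gcongr
  simp

/-- Fourier inversion for the mixture, at unit scale. -/
lemma integral_exp_mul_exp_neg_rpow (h : IsSubordination d α κ η) (x : Rd d) :
    ∫ ξ : Rd d, Complex.exp ((⟪x, ξ⟫ : ℝ) * Complex.I) * (Real.exp (-‖ξ‖ ^ α) : ℂ)
      = (((2 * Real.pi) ^ d * gaussMix d η x : ℝ) : ℂ) := by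
  have := h.oneSided.isProbabilityMeasure
  have e1 : ∀ ξ : Rd d, Complex.exp ((⟪x, ξ⟫ : ℝ) * Complex.I) * (Real.exp (-‖ξ‖ ^ α) : ℂ)
      = ∫ u, Complex.exp ((⟪x, ξ⟫ : ℝ) * Complex.I) * (Real.exp (-(u * ‖ξ‖ ^ 2)) : ℂ) ∂η := by
    intro ξ
    rw [integral_const_mul, integral_complex_ofReal, h.laplace_norm]
  have hint : Integrable (Function.uncurry fun (ξ : Rd d) (u : ℝ) =>
      Complex.exp ((⟪x, ξ⟫ : ℝ) * Complex.I) * (Real.exp (-(u * ‖ξ‖ ^ 2)) : ℂ))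
      ((volume : Measure (Rd d)).prod η) := by
    rw [integrable_prod_iff' (by apply Measurable.aestronglyMeasurable; fun_prop)]
    simp only [Function.uncurry_apply_pair]
    have hn : ∀ (ξ : Rd d) (u : ℝ), ‖Complex.exp ((⟪x, ξ⟫ : ℝ) * Complex.I) *
        (Real.exp (-(u * ‖ξ‖ ^ 2)) : ℂ)‖ = Real.exp (-(u * ‖ξ‖ ^ 2)) := fun ξ u =>
      norm_exp_ofReal_mul_I_mul _ (Real.exp_nonneg _)
    simp_rw [hn]
    refine ⟨?_, ?_⟩
    · filter_upwards [h.oneSided.pos] with u hu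
      refine Integrable.mono' (integrable_exp_neg_mul_norm_sq hu)
        (by apply Measurable.aestronglyMeasurable; fun_prop) (ae_of_all _ fun ξ => (hn ξ u).le)
    · refine ((h.oneSided.integrable_rpow_neg (by linarith [h.pos]) h.dim_half_pos).const_mul
        (Real.pi ^ ((d : ℝ) / 2))).congr ?_
      filter_upwards [h.oneSided.pos] with u hu
      rw [integral_exp_neg_mul_norm_sq hu, Real.div_rpow (by positivity) hu.le,
        Real.rpow_neg hu.le, div_eq_mul_inv (Real.pi ^ _)]
  simp_rw [e1]
  rw [integral_integral_swap hint]
  have e2 : ∀ᵐ u ∂η, ∫ ξ : Rd d, Complex.exp ((⟪x, ξ⟫ : ℝ) * Complex.I) *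
      (Real.exp (-(u * ‖ξ‖ ^ 2)) : ℂ) = (((2 * Real.pi) ^ d * ((4 * Real.pi * u) ^ (-((d : ℝ) / 2)) *
        Real.exp (-(‖x‖ ^ 2 / (4 * u)))) : ℝ) : ℂ) := by
    filter_upwards [h.oneSided.pos] with u hu
    rw [integral_exp_inner_mul_gaussian hu, ← mul_assoc]
    congr 2
    have : (2 * Real.pi) ^ d = ((2 * Real.pi) ^ 2) ^ ((d : ℝ) / 2) := by
      rw [← Real.rpow_natCast (2 * Real.pi) d, ← Real.rpow_natCast (2 * Real.pi) 2,
        ← Real.rpow_mul (by positivity)]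
      congr 1
      push_cast
      ring
    rw [this, Real.rpow_neg (by positivity), ← div_eq_mul_inv, ← Real.div_rpow (by positivity)
      (by positivity)]
    congr 1
    field_simp
    ring
  rw [integral_congr_ae e2, integral_complex_ofReal, integral_const_mul]
  rfl

/-- The characteristic function of the mixture, at unit scale. -/
lemma integral_exp_mul_gaussMix (h : IsSubordination d α κ η) (ξ : Rd d) :
    Integrable (gaussMix d η) ∧
    ∫ x : Rd d, Complex.exp ((⟪ξ, x⟫ : ℝ) * Complex.I) * (gaussMix d η x : ℂ)
      = (Real.exp (-‖ξ‖ ^ α) : ℂ) := by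
  have := h.oneSided.isProbabilityMeasure
  have e1 : ∀ x : Rd d, Complex.exp ((⟪ξ, x⟫ : ℝ) * Complex.I) * (gaussMix d η x : ℂ)
      = ∫ u, Complex.exp ((⟪ξ, x⟫ : ℝ) * Complex.I) * (((4 * Real.pi * u) ^ (-((d : ℝ) / 2)) *
        Real.exp (-(‖x‖ ^ 2 / (4 * u))) : ℝ) : ℂ) ∂η := by
    intro x
    rw [integral_const_mul, integral_complex_ofReal]
    rfl
  have hb : ∀ u : ℝ, ∀ x : Rd d, -(‖x‖ ^ 2 / (4 * u)) = -((4 * u)⁻¹ * ‖x‖ ^ 2) := by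
    intro u x
    rw [div_eq_inv_mul]
  have hint0 : Integrable (Function.uncurry fun (x : Rd d) (u : ℝ) =>
      (4 * Real.pi * u) ^ (-((d : ℝ) / 2)) * Real.exp (-(‖x‖ ^ 2 / (4 * u))))
      ((volume : Measure (Rd d)).prod η) := by
    rw [integrable_prod_iff' (by apply Measurable.aestronglyMeasurable; fun_prop)]
    simp only [Function.uncurry_apply_pair]
    refine ⟨?_, ?_⟩
    · filter_upwards [h.oneSided.pos] with u hu
      simp_rw [hb u]
      exact (integrable_exp_neg_mul_norm_sq (by positivity)).const_mul _
    · refine (integrable_const (1:ℝ)).congr ?_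
      filter_upwards [h.oneSided.pos] with u hu
      have : ∀ x : Rd d, ‖(4 * Real.pi * u) ^ (-((d : ℝ) / 2)) * Real.exp (-(‖x‖ ^ 2 / (4 * u)))‖
          = (4 * Real.pi * u) ^ (-((d : ℝ) / 2)) * Real.exp (-((4 * u)⁻¹ * ‖x‖ ^ 2)) := by
        intro x
        rw [Real.norm_of_nonneg (by positivity), hb]
      simp_rw [this]
      rw [integral_const_mul, integral_exp_neg_mul_norm_sq (by positivity), Real.rpow_neg
        (by positivity), show Real.pi / (4 * u)⁻¹ = 4 * Real.pi * u by field_simp]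
      exact (inv_mul_cancel₀ (by positivity)).symm
  have hint : Integrable (Function.uncurry fun (x : Rd d) (u : ℝ) =>
      Complex.exp ((⟪ξ, x⟫ : ℝ) * Complex.I) * (((4 * Real.pi * u) ^ (-((d : ℝ) / 2)) *
        Real.exp (-(‖x‖ ^ 2 / (4 * u))) : ℝ) : ℂ)) ((volume : Measure (Rd d)).prod η) := by
    refine Integrable.mono' hint0.norm (by apply Measurable.aestronglyMeasurable; fun_prop)
      (ae_of_all _ fun p => ?_)
    rw [Function.uncurry, norm_mul, Complex.norm_exp_ofReal_mul_I, one_mul, Complex.norm_real]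
    rfl
  refine ⟨hint0.integral_prod_left, ?_⟩
  simp_rw [e1]
  rw [integral_integral_swap hint, ← h.laplace_norm, ← integral_complex_ofReal]
  refine integral_congr_ae ?_
  filter_upwards [h.oneSided.pos] with u hu
  have e3 : ∀ x : Rd d, Complex.exp ((⟪ξ, x⟫ : ℝ) * Complex.I) * (((4 * Real.pi * u) ^ (-((d : ℝ) / 2)) *
        Real.exp (-(‖x‖ ^ 2 / (4 * u))) : ℝ) : ℂ) = (((4 * Real.pi * u) ^ (-((d : ℝ) / 2)) : ℝ) : ℂ) *
        (Complex.exp ((⟪ξ, x⟫ : ℝ) * Complex.I) * (Real.exp (-((4 * u)⁻¹ * ‖x‖ ^ 2)) : ℂ)) := by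
    intro x
    rw [hb, Complex.ofReal_mul]
    ring
  simp_rw [e3]
  rw [integral_const_mul, integral_exp_inner_mul_gaussian (by positivity), ← Complex.ofReal_mul,
    ← mul_assoc, Real.rpow_neg (by positivity), show Real.pi / (4 * u)⁻¹ = 4 * Real.pi * u by field_simp,
    inv_mul_cancel₀ (by positivity), one_mul]
  congr 4
  field_simp

end IsSubordination

end Mixture

/-! ### The stable density: scaling, law and semigroup property -/

section Density

variable {d : ℕ} {α κ : ℝ} {η : Measure ℝ}

/-- The space scale `(κ t) ^ (1 / α)` of the stable law at time `t`. -/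
def scaleAt (α κ t : ℝ) : ℝ := (κ * t) ^ (1 / α)

lemma scaleAt_pos (hκ : 0 < κ) {t : ℝ} (ht : 0 < t) : 0 < scaleAt α κ t :=
  Real.rpow_pos_of_pos (mul_pos hκ ht) _

lemma scaleAt_rpow (hα : 0 < α) (hκ : 0 < κ) {t : ℝ} (ht : 0 < t) :
    scaleAt α κ t ^ α = κ * t := by
  rw [scaleAt, ← Real.rpow_mul (mul_pos hκ ht).le, one_div_mul_cancel hα.ne', Real.rpow_one]

namespace IsSubordination

lemma cexp_levyExponent (h : IsSubordination d α κ η) (t : ℝ) (ξ : Rd d) :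
    Complex.exp (t * levyExponent d α ξ) = (Real.exp (-(κ * t * ‖ξ‖ ^ α)) : ℂ) := by
  rw [h.levyExponent_eq, Complex.ofReal_exp, ← Complex.ofReal_mul]
  congr 2
  ring

lemma cexp_levyExponent_scale (h : IsSubordination d α κ η) {t : ℝ} (ht : 0 < t) (ξ : Rd d) :
    Complex.exp (t * levyExponent d α ξ) = (Real.exp (-‖scaleAt α κ t • ξ‖ ^ α) : ℂ) := by
  have hs := scaleAt_pos (α := α) h.scale_pos ht
  rw [h.cexp_levyExponent, norm_smul, Real.norm_of_nonneg hs.le, Real.mul_rpow hs.le (norm_nonneg _),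
    scaleAt_rpow h.pos h.scale_pos ht]

lemma integral_inversion (h : IsSubordination d α κ η) {t : ℝ} (ht : 0 < t) (x : Rd d) :
    ∫ ξ : Rd d, Complex.exp (-((⟪x, ξ⟫ : ℝ) * Complex.I)) *
      Complex.exp (t * levyExponent d α ξ)
      = (((2 * Real.pi) ^ d * ((scaleAt α κ t ^ d)⁻¹ * gaussMix d η ((scaleAt α κ t)⁻¹ • x)) : ℝ) : ℂ) := by
  set σ := scaleAt α κ t with hσ
  have hs : 0 < σ := scaleAt_pos h.scale_pos ht
  have hf : Module.finrank ℝ (Rd d) = d := by simp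
  have e := Measure.integral_comp_smul (volume : Measure (Rd d))
    (fun ξ : Rd d => Complex.exp ((⟪-(σ⁻¹ • x), ξ⟫ : ℝ) * Complex.I) * (Real.exp (-‖ξ‖ ^ α) : ℂ)) σ
  rw [h.integral_exp_mul_exp_neg_rpow, hf, abs_of_pos (by positivity)] at e
  calc _ = ∫ ξ : Rd d, Complex.exp ((⟪-(σ⁻¹ • x), σ • ξ⟫ : ℝ) * Complex.I) *
        (Real.exp (-‖σ • ξ‖ ^ α) : ℂ) := by
        refine integral_congr_ae (ae_of_all _ fun ξ => ?_)
        dsimp only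
        rw [h.cexp_levyExponent_scale ht]
        congr 2
        rw [inner_neg_left, inner_smul_left, inner_smul_right, conj_trivial, inv_mul_cancel_left₀ hs.ne']
        push_cast
        ring
    _ = _ := by
        rw [e, Complex.real_smul, ← Complex.ofReal_mul]
        have : gaussMix d η (-(σ⁻¹ • x)) = gaussMix d η (σ⁻¹ • x) := by simp [gaussMix]
        rw [this]
        congr 1
        ring

lemma stableDensity_eq (h : IsSubordination d α κ η) {t : ℝ} (ht : 0 < t) (x : Rd d) :
    stableDensity d α t x = (scaleAt α κ t ^ d)⁻¹ * gaussMix d η ((scaleAt α κ t)⁻¹ • x) := by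
  rw [stableDensity, h.integral_inversion ht, Complex.ofReal_re, inv_mul_cancel_left₀]
  positivity

lemma ofReal_stableDensity (h : IsSubordination d α κ η) {t : ℝ} (ht : 0 < t) (x : Rd d) :
    (stableDensity d α t x : ℂ) = (((2 * Real.pi) ^ d)⁻¹ : ℝ) *
    ∫ ξ : Rd d, Complex.exp (-((⟪x, ξ⟫ : ℝ) * Complex.I)) *
      Complex.exp (t * levyExponent d α ξ) := by
  rw [stableDensity, h.integral_inversion ht, Complex.ofReal_re, ← Complex.ofReal_mul]

lemma stableDensity_nonneg (h : IsSubordination d α κ η) {t : ℝ} (ht : 0 < t) (x : Rd d) :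
    0 ≤ stableDensity d α t x := by
  rw [h.stableDensity_eq ht]
  have := h.gaussMix_nonneg ((scaleAt α κ t)⁻¹ • x)
  have := scaleAt_pos (α := α) h.scale_pos ht
  positivity

lemma stableDensity_neg (h : IsSubordination d α κ η) {t : ℝ} (ht : 0 < t) (x : Rd d) :
    stableDensity d α t (-x) = stableDensity d α t x := by
  rw [h.stableDensity_eq ht, h.stableDensity_eq ht]
  simp [gaussMix]

lemma stableDensity_le (h : IsSubordination d α κ η) {t : ℝ} (ht : 0 < t) (x : Rd d) :
    stableDensity d α t x ≤ stableDensity d α t 0 := by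
  rw [h.stableDensity_eq ht, h.stableDensity_eq ht, smul_zero]
  have := scaleAt_pos (α := α) h.scale_pos ht
  gcongr
  exact h.gaussMix_le _

lemma norm_stableDensity_le (h : IsSubordination d α κ η) {t : ℝ} (ht : 0 < t) (x : Rd d) :
    ‖stableDensity d α t x‖ ≤ stableDensity d α t 0 := by
  rw [Real.norm_of_nonneg (h.stableDensity_nonneg ht x)]
  exact h.stableDensity_le ht x

lemma integrable_cexp_levyExponent (h : IsSubordination d α κ η) {t : ℝ} (ht : 0 < t) :
    Integrable (fun ξ : Rd d => Complex.exp (t * levyExponent d α ξ)) := by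
  have := h.oneSided.isProbabilityMeasure
  have hI : Integrable (fun ξ : Rd d => (Real.exp (-‖ξ‖ ^ α) : ℂ)) := by
    refine Integrable.of_integral_ne_zero ?_
    have e := h.integral_exp_mul_exp_neg_rpow 0
    simp only [inner_zero_left, Complex.ofReal_zero, zero_mul, Complex.exp_zero, one_mul] at e
    rw [e, Complex.ofReal_ne_zero]
    refine mul_ne_zero (by positivity) (ne_of_gt ?_)
    rw [gaussMix, integral_pos_iff_support_of_nonneg_ae _ (h.integrable_gaussMix 0)]
    · rw [pos_iff_ne_zero]
      intro h0
      have h1 : ∀ᵐ u ∂η, (4 * Real.pi * u) ^ (-((d : ℝ) / 2)) *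
          Real.exp (-(‖(0 : Rd d)‖ ^ 2 / (4 * u))) = 0 := by
        rw [ae_iff]; exact h0
      obtain ⟨u, hu, hu0⟩ := (h1.and h.oneSided.pos).exists
      have : 0 < (4 * Real.pi * u) ^ (-((d : ℝ) / 2)) *
          Real.exp (-(‖(0 : Rd d)‖ ^ 2 / (4 * u))) := by positivity
      exact this.ne' hu
    · filter_upwards [h.oneSided.pos] with u hu
      simp only [Pi.zero_apply]
      positivity
  refine (hI.comp_smul (scaleAt_pos (α := α) h.scale_pos ht).ne').congr (ae_of_all _ fun ξ => ?_)
  dsimp only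
  rw [h.cexp_levyExponent_scale ht]

lemma continuous_stableDensity (h : IsSubordination d α κ η) {t : ℝ} (ht : 0 < t) :
    Continuous (stableDensity d α t) := by
  unfold stableDensity
  refine continuous_const.mul (Complex.continuous_re.comp ?_)
  have hI := h.integrable_cexp_levyExponent ht
  refine continuous_of_dominated (bound := fun ξ => ‖Complex.exp (t * levyExponent d α ξ)‖)
    (fun x => ?_) (fun x => ae_of_all _ fun ξ => ?_) hI.norm (ae_of_all _ fun ξ => by fun_prop)
  · exact (Measurable.aestronglyMeasurable (by fun_prop)).mul hI.aestronglyMeasurable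
  · rw [norm_mul, ← neg_mul, ← Complex.ofReal_neg, Complex.norm_exp_ofReal_mul_I, one_mul]

/-- The stable density has characteristic function `e^{tψ}`. -/
lemma integrable_stableDensity_and_integral (h : IsSubordination d α κ η) {t : ℝ} (ht : 0 < t) :
    Integrable (stableDensity d α t) ∧ ∀ ξ : Rd d,
    ∫ x : Rd d, Complex.exp ((⟪x, ξ⟫ : ℝ) * Complex.I) * (stableDensity d α t x : ℂ)
      = Complex.exp (t * levyExponent d α ξ) := by
  set σ := scaleAt α κ t with hσ
  have hs : 0 < σ := scaleAt_pos h.scale_pos ht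
  have hf : Module.finrank ℝ (Rd d) = d := by simp
  refine ⟨?_, fun ξ => ?_⟩
  · refine (((h.integral_exp_mul_gaussMix 0).1.comp_smul (inv_pos.2 hs).ne').const_mul
      (σ ^ d)⁻¹).congr (ae_of_all _ fun x => ?_)
    rw [h.stableDensity_eq ht]
  · have e := Measure.integral_comp_smul (volume : Measure (Rd d))
      (fun x : Rd d => Complex.exp ((⟪σ • ξ, x⟫ : ℝ) * Complex.I) * (gaussMix d η x : ℂ)) σ⁻¹
    rw [(h.integral_exp_mul_gaussMix _).2, hf, abs_of_pos (by positivity)] at e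
    calc _ = ∫ x : Rd d, (((σ ^ d)⁻¹ : ℝ) : ℂ) * (Complex.exp ((⟪σ • ξ, σ⁻¹ • x⟫ : ℝ) * Complex.I) *
          (gaussMix d η (σ⁻¹ • x) : ℂ)) := by
          refine integral_congr_ae (ae_of_all _ fun x => ?_)
          dsimp only
          rw [h.stableDensity_eq ht, inner_smul_left, inner_smul_right, conj_trivial,
            mul_inv_cancel_left₀ hs.ne', real_inner_comm, Complex.ofReal_mul]
          ring
      _ = _ := by
          rw [integral_const_mul, e, h.cexp_levyExponent_scale ht, Complex.real_smul, ← mul_assoc,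
            ← Complex.ofReal_mul]
          have : (σ ^ d)⁻¹ * (σ⁻¹ ^ d)⁻¹ = 1 := by
            rw [inv_pow, inv_inv, inv_mul_cancel₀ (by positivity)]
          rw [this, Complex.ofReal_one, one_mul]

/-- A finite measure with characteristic function `e^{tψ}` has density `p_α(t, ·)`. -/
lemma eq_withDensity_of_charFun (h : IsSubordination d α κ η) {t : ℝ} (ht : 0 < t)
    (m : Measure (Rd d)) [IsFiniteMeasure m]
    (hm : ∀ ξ, charFun m ξ = Complex.exp (t * levyExponent d α ξ)) :
    m = volume.withDensity fun x => ENNReal.ofReal (stableDensity d α t x) := by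
  obtain ⟨hI, hc⟩ := h.integrable_stableDensity_and_integral ht
  have : IsFiniteMeasure (volume.withDensity fun x => ENNReal.ofReal (stableDensity d α t x)) :=
    isFiniteMeasure_withDensity_ofReal hI.2
  refine Measure.ext_of_charFun (funext fun ξ => ?_)
  rw [hm, charFun_apply, integral_withDensity_eq_integral_toReal_smul
    (h.continuous_stableDensity ht).measurable.ennreal_ofReal
    (ae_of_all _ fun y => ENNReal.ofReal_lt_top), ← hc]
  refine integral_congr_ae (ae_of_all _ fun x => ?_)
  dsimp only
  rw [ENNReal.toReal_ofReal (h.stableDensity_nonneg ht x), Complex.real_smul, mul_comm]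

/-- The semigroup property: averaging `p_α(t, ·)` over the law with characteristic function `e^{sψ}`
gives `p_α(t + s, ·)`. -/
lemma integral_stableDensity_add (h : IsSubordination d α κ η) {s t : ℝ} (ht : 0 < t) (hs : 0 ≤ s)
    (m : Measure (Rd d)) [IsFiniteMeasure m]
    (hm : ∀ ξ, charFun m ξ = Complex.exp (s * levyExponent d α ξ)) (w : Rd d) :
    ∫ z, stableDensity d α t (w + z) ∂m = stableDensity d α (t + s) w := by
  have hI := h.integrable_cexp_levyExponent ht
  have hint : Integrable (Function.uncurry fun (z ξ : Rd d) =>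
      Complex.exp (-((⟪w + z, ξ⟫ : ℝ) * Complex.I)) * Complex.exp (t * levyExponent d α ξ))
      (m.prod volume) := by
    refine Integrable.mono' (hI.norm.comp_snd m) ?_ (ae_of_all _ fun p => ?_)
    · exact (Measurable.aestronglyMeasurable (by fun_prop)).mul
        (hI.aestronglyMeasurable.comp_snd)
    · rw [Function.uncurry, norm_mul, ← neg_mul, ← Complex.ofReal_neg,
        Complex.norm_exp_ofReal_mul_I, one_mul]
  apply Complex.ofReal_injective
  rw [← integral_complex_ofReal, h.ofReal_stableDensity (by linarith)]
  simp_rw [h.ofReal_stableDensity ht]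
  rw [integral_const_mul, integral_integral_swap hint]
  congr 1
  refine integral_congr_ae (ae_of_all _ fun ξ => ?_)
  dsimp only
  have e1 : ∀ z : Rd d, Complex.exp (-((⟪w + z, ξ⟫ : ℝ) * Complex.I)) *
      Complex.exp (t * levyExponent d α ξ) = Complex.exp (-((⟪w, ξ⟫ : ℝ) * Complex.I)) *
      Complex.exp (t * levyExponent d α ξ) * Complex.exp ((⟪z, -ξ⟫ : ℝ) * Complex.I) := by
    intro z
    rw [inner_add_left, inner_neg_right, ← Complex.exp_add, ← Complex.exp_add, ← Complex.exp_add]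
    congr 1
    push_cast
    ring
  simp_rw [e1]
  rw [integral_const_mul, ← charFun_apply, hm, h.levyExponent_eq, h.levyExponent_eq, norm_neg,
    mul_assoc, ← Complex.exp_add]
  congr 2
  push_cast
  ring

lemma integrable_stableDensity_of_isFiniteMeasure (h : IsSubordination d α κ η) {t : ℝ} (ht : 0 < t)
    (μ : Measure (Rd d)) [IsFiniteMeasure μ] {g : Rd d → Rd d} (hg : Measurable g) :
    Integrable (fun x => stableDensity d α t (g x)) μ :=
  Integrable.of_bound ((h.continuous_stableDensity ht).measurable.comp hg).aestronglyMeasurable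
    (stableDensity d α t 0) (ae_of_all _ fun _ => h.norm_stableDensity_le ht _)

lemma stableAverage_conv (h : IsSubordination d α κ η) {s t : ℝ} (ht : 0 < t) (hs : 0 ≤ s)
    (ν m : Measure (Rd d)) [IsFiniteMeasure ν] [IsFiniteMeasure m]
    (hm : ∀ ξ, charFun m ξ = Complex.exp (s * levyExponent d α ξ)) (y : Rd d) :
    stableAverage α (ν ∗ m) t y = stableAverage α ν (t + s) y := by
  unfold stableAverage
  rw [integral_conv (h.integrable_stableDensity_of_isFiniteMeasure ht _ (by fun_prop))]
  refine integral_congr_ae (ae_of_all _ fun x => ?_)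
  dsimp only
  rw [← h.integral_stableDensity_add ht hs m hm]
  simp_rw [add_sub_right_comm]

lemma stableAverage_nonneg (h : IsSubordination d α κ η) {t : ℝ} (ht : 0 < t)
    (ν : Measure (Rd d)) (y : Rd d) : 0 ≤ stableAverage α ν t y :=
  integral_nonneg fun _ => h.stableDensity_nonneg ht _

lemma isContinuousDensity_conv (h : IsSubordination d α κ η) {t : ℝ} (ht : 0 < t)
    (ν m : Measure (Rd d)) [IsFiniteMeasure ν] [IsFiniteMeasure m]
    (hm : ∀ ξ, charFun m ξ = Complex.exp (t * levyExponent d α ξ)) :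
    IsContinuousDensity (ν ∗ m) (stableAverage α ν t) := by
  have hcont := h.continuous_stableDensity ht
  refine ⟨?_, fun y => h.stableAverage_nonneg ht ν y, ?_⟩
  · exact continuous_of_dominated (bound := fun _ => stableDensity d α t 0)
      (fun y => (hcont.comp (by fun_prop)).aestronglyMeasurable)
      (fun _ => ae_of_all _ fun _ => h.norm_stableDensity_le ht _) (integrable_const _)
      (ae_of_all _ fun _ => hcont.comp (by fun_prop))
  · ext s hs
    rw [withDensity_apply _ hs]
    have e1 : ∀ y, ENNReal.ofReal (stableAverage α ν t y)
        = ∫⁻ x, ENNReal.ofReal (stableDensity d α t (x - y)) ∂ν := fun y =>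
      ofReal_integral_eq_lintegral_ofReal
        (h.integrable_stableDensity_of_isFiniteMeasure ht ν (by fun_prop))
        (ae_of_all _ fun x => h.stableDensity_nonneg ht _)
    have hmeas : Measurable fun p : Rd d × Rd d => ENNReal.ofReal (stableDensity d α t (p.2 - p.1)) :=
      (hcont.measurable.comp (by fun_prop)).ennreal_ofReal
    simp_rw [e1]
    rw [lintegral_lintegral_swap hmeas.aemeasurable, ← lintegral_indicator_one hs,
      Measure.lintegral_conv (measurable_one.indicator hs)]
    refine lintegral_congr fun x => ?_
    have hg : Measurable fun y => s.indicator (1 : Rd d → ℝ≥0∞) (x + y) :=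
      (measurable_one.indicator hs).comp (measurable_const_add x)
    rw [h.eq_withDensity_of_charFun ht m hm, lintegral_withDensity_eq_lintegral_mul _
      hcont.measurable.ennreal_ofReal hg,
      ← lintegral_indicator hs, ← lintegral_sub_right_eq_self _ x]
    refine lintegral_congr fun y => ?_
    simp only [Pi.mul_apply, add_sub_cancel]
    by_cases hy : y ∈ s
    · rw [Set.indicator_of_mem hy, Set.indicator_of_mem hy, Pi.one_apply, mul_one,
        ← neg_sub, h.stableDensity_neg ht]
    · rw [Set.indicator_of_notMem hy, Set.indicator_of_notMem hy, mul_zero]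

end IsSubordination

end Density

/-! ### First and second differences of Gaussian functions -/

section Gaussian

variable {d : ℕ}

/-- The Gaussian `τ^d exp (-θ τ² ‖x‖²)`; the parameter `τ` is an inverse space scale. -/
def gaussFun (d : ℕ) (θ τ : ℝ) (x : Rd d) : ℝ := τ ^ d * Real.exp (-(θ * τ ^ 2 * ‖x‖ ^ 2))

/-- Space derivative of `gaussFun` in the direction `z`. -/
def gaussFunZ (d : ℕ) (θ τ : ℝ) (z x : Rd d) : ℝ :=
  -(2 * θ * τ ^ 2 * ⟪x, z⟫) * gaussFun d θ τ x

/-- Mixed space derivative of `gaussFun` in the directions `z` and `y`. -/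
def gaussFunZZ (d : ℕ) (θ τ : ℝ) (z y x : Rd d) : ℝ :=
  (-(2 * θ * τ ^ 2 * ⟪y, z⟫) + 2 * θ * τ ^ 2 * ⟪x, z⟫ * (2 * θ * τ ^ 2 * ⟪x, y⟫)) * gaussFun d θ τ x

/-- Derivative of `gaussFun` in the scale parameter. -/
def gaussFunT (d : ℕ) (θ τ : ℝ) (x : Rd d) : ℝ :=
  (d * τ ^ (d - 1) - 2 * θ * τ * ‖x‖ ^ 2 * τ ^ d) * Real.exp (-(θ * τ ^ 2 * ‖x‖ ^ 2))

/-- Mixed derivative of `gaussFun` in the scale parameter and in the direction `z`. -/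
def gaussFunTZ (d : ℕ) (θ τ : ℝ) (z x : Rd d) : ℝ :=
  (-(4 * θ * τ * ⟪x, z⟫ * τ ^ d) - (d * τ ^ (d - 1) - 2 * θ * τ * ‖x‖ ^ 2 * τ ^ d) *
    (2 * θ * τ ^ 2 * ⟪x, z⟫)) * Real.exp (-(θ * τ ^ 2 * ‖x‖ ^ 2))

lemma hasDerivAt_line (x z : Rd d) (s : ℝ) : HasDerivAt (fun s : ℝ => x + s • z) z s := by
  simpa using ((hasDerivAt_id s).smul_const z).const_add x

lemma hasDerivAt_norm_sq_line (x z : Rd d) (s : ℝ) :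
    HasDerivAt (fun s : ℝ => ‖x + s • z‖ ^ 2) (2 * ⟪x + s • z, z⟫) s :=
  (hasDerivAt_line x z s).norm_sq

lemma hasDerivAt_inner_line (x z w : Rd d) (s : ℝ) :
    HasDerivAt (fun s : ℝ => (⟪x + s • z, w⟫ : ℝ)) ⟪z, w⟫ s := by
  simpa using (hasDerivAt_line x z s).inner ℝ (hasDerivAt_const s w)

lemma hasDerivAt_exp_line (c : ℝ) (x z : Rd d) (s : ℝ) :
    HasDerivAt (fun s : ℝ => Real.exp (-(c * ‖x + s • z‖ ^ 2)))
      (-(2 * c * ⟪x + s • z, z⟫) * Real.exp (-(c * ‖x + s • z‖ ^ 2))) s := by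
  refine ((hasDerivAt_norm_sq_line x z s).const_mul c).fun_neg.exp.congr_deriv ?_
  ring

lemma hasDerivAt_gaussFun (θ τ : ℝ) (x z : Rd d) (s : ℝ) :
    HasDerivAt (fun s : ℝ => gaussFun d θ τ (x + s • z)) (gaussFunZ d θ τ z (x + s • z)) s := by
  refine ((hasDerivAt_exp_line (θ * τ ^ 2) x z s).const_mul (τ ^ d)).congr_deriv ?_
  rw [gaussFunZ, gaussFun]
  ring

lemma hasDerivAt_gaussFunZ (θ τ : ℝ) (x z y : Rd d) (s : ℝ) :
    HasDerivAt (fun s : ℝ => gaussFunZ d θ τ z (x + s • y)) (gaussFunZZ d θ τ z y (x + s • y)) s := by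
  refine ((((hasDerivAt_inner_line x y z s).const_mul (2 * θ * τ ^ 2)).fun_neg).fun_mul
    (hasDerivAt_gaussFun θ τ x y s)).congr_deriv ?_
  rw [gaussFunZZ, gaussFunZ]
  ring

lemma hasDerivAt_gaussFun_scale (θ τ : ℝ) (x : Rd d) :
    HasDerivAt (fun τ : ℝ => gaussFun d θ τ x) (gaussFunT d θ τ x) τ := by
  have h1 := hasDerivAt_pow d τ
  have h2 : HasDerivAt (fun τ : ℝ => -(θ * τ ^ 2 * ‖x‖ ^ 2)) (-(θ * (2 * τ) * ‖x‖ ^ 2)) τ := by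
    simpa using (((hasDerivAt_pow 2 τ).const_mul θ).mul_const (‖x‖ ^ 2)).fun_neg
  refine (h1.fun_mul h2.exp).congr_deriv ?_
  rw [gaussFunT]
  ring

lemma hasDerivAt_gaussFunT (θ τ : ℝ) (x z : Rd d) (s : ℝ) :
    HasDerivAt (fun s : ℝ => gaussFunT d θ τ (x + s • z)) (gaussFunTZ d θ τ z (x + s • z)) s := by
  refine (((((hasDerivAt_norm_sq_line x z s).const_mul (2 * θ * τ)).mul_const (τ ^ d)).const_sub
    (d * τ ^ (d - 1))).fun_mul (hasDerivAt_exp_line (θ * τ ^ 2) x z s)).congr_deriv ?_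
  rw [gaussFunTZ]
  ring

/-- Common bound for the derivatives of `gaussFun` of order one and two, for scale parameters in
`[1/2, 1]`. -/
def gaussEnvelope (d : ℕ) (θ : ℝ) (x : Rd d) : ℝ :=
  (2 * d + 8) * ((1 + θ) * (1 + θ * ‖x‖ ^ 2) ^ 2 * Real.exp (-(θ * ‖x‖ ^ 2 / 4)))

section Bounds

variable {θ τ : ℝ}

lemma exp_scale_le (hθ : 0 ≤ θ) (hτ : τ ∈ Set.Icc (2⁻¹ : ℝ) 1) (x : Rd d) :
    Real.exp (-(θ * τ ^ 2 * ‖x‖ ^ 2)) ≤ Real.exp (-(θ * ‖x‖ ^ 2 / 4)) := by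
  apply Real.exp_le_exp.2
  have h1 : (4:ℝ)⁻¹ ≤ τ ^ 2 := by nlinarith [hτ.1]
  have h2 : 0 ≤ θ * ‖x‖ ^ 2 := by positivity
  nlinarith

lemma abs_gaussFun_le (hθ : 0 ≤ θ) (hτ : τ ∈ Set.Icc (2⁻¹ : ℝ) 1) (x : Rd d) :
    |gaussFun d θ τ x| ≤ Real.exp (-(θ * ‖x‖ ^ 2 / 4)) := by
  have h0 : 0 ≤ τ := by linarith [hτ.1]
  rw [gaussFun, abs_of_nonneg (by positivity)]
  calc _ ≤ 1 * Real.exp (-(θ * ‖x‖ ^ 2 / 4)) := by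
        exact mul_le_mul (pow_le_one₀ h0 hτ.2) (exp_scale_le hθ hτ x) (Real.exp_nonneg _) zero_le_one
    _ = _ := one_mul _

lemma abs_inner_mul_le (hθ : 0 ≤ θ) (x z : Rd d) :
    θ * |⟪x, z⟫| ≤ ‖z‖ * ((1 + θ) * (1 + θ * ‖x‖ ^ 2)) := by
  have h1 := abs_real_inner_le_norm x z
  have h2 : θ * ‖x‖ ≤ (1 + θ) * (1 + θ * ‖x‖ ^ 2) := by
    nlinarith [sq_nonneg (‖x‖ - 1), mul_nonneg hθ (sq_nonneg ‖x‖),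
      mul_nonneg hθ (sq_nonneg (‖x‖ - 1)), mul_nonneg (mul_nonneg hθ hθ) (sq_nonneg ‖x‖)]
  calc θ * |⟪x, z⟫| ≤ θ * (‖x‖ * ‖z‖) := by gcongr
    _ = ‖z‖ * (θ * ‖x‖) := by ring
    _ ≤ _ := by gcongr

lemma abs_gaussFunZ_le (hθ : 0 ≤ θ) (hτ : τ ∈ Set.Icc (2⁻¹ : ℝ) 1) (z x : Rd d) :
    |gaussFunZ d θ τ z x| ≤ ‖z‖ * gaussEnvelope d θ x := by
  have h0 : 0 ≤ τ := by linarith [hτ.1]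
  have h1 : τ ^ 2 ≤ 1 := pow_le_one₀ h0 hτ.2
  have hr : 0 ≤ θ * ‖x‖ ^ 2 := by positivity
  rw [gaussFunZ, abs_mul, abs_neg]
  have e : |2 * θ * τ ^ 2 * ⟪x, z⟫| = 2 * τ ^ 2 * (θ * |⟪x, z⟫|) := by
    rw [abs_mul, abs_of_nonneg (by positivity)]; ring
  rw [e]
  calc _ ≤ 2 * 1 * (‖z‖ * ((1 + θ) * (1 + θ * ‖x‖ ^ 2))) * Real.exp (-(θ * ‖x‖ ^ 2 / 4)) := by
        have hi := abs_inner_mul_le hθ x z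
        have hg := abs_gaussFun_le hθ hτ x
        gcongr
    _ = ‖z‖ * (2 * ((1 + θ) * (1 + θ * ‖x‖ ^ 2) ^ 1 * Real.exp (-(θ * ‖x‖ ^ 2 / 4)))) := by ring
    _ ≤ _ := by
        unfold gaussEnvelope
        gcongr
        · have : (0:ℝ) ≤ d := Nat.cast_nonneg d
          linarith
        · linarith
        · norm_num

lemma abs_gaussFunZZ_le (hθ : 0 ≤ θ) (hτ : τ ∈ Set.Icc (2⁻¹ : ℝ) 1) (z y x : Rd d) :
    |gaussFunZZ d θ τ z y x| ≤ ‖z‖ * ‖y‖ * gaussEnvelope d θ x := by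
  have h0 : 0 ≤ τ := by linarith [hτ.1]
  have h1 : τ ^ 2 ≤ 1 := pow_le_one₀ h0 hτ.2
  have hr : 0 ≤ θ * ‖x‖ ^ 2 := by positivity
  rw [gaussFunZZ, abs_mul]
  have e : |-(2 * θ * τ ^ 2 * ⟪y, z⟫) + 2 * θ * τ ^ 2 * ⟪x, z⟫ * (2 * θ * τ ^ 2 * ⟪x, y⟫)|
      ≤ ‖z‖ * ‖y‖ * (4 * ((1 + θ) * (1 + θ * ‖x‖ ^ 2))) := by
    refine (abs_add_le _ _).trans ?_
    have a1 : |-(2 * θ * τ ^ 2 * ⟪y, z⟫)| ≤ 2 * θ * 1 * (‖y‖ * ‖z‖) := by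
      rw [abs_neg, abs_mul, abs_of_nonneg (by positivity : 0 ≤ 2 * θ * τ ^ 2)]
      gcongr
      exact abs_real_inner_le_norm y z
    have a2 : |2 * θ * τ ^ 2 * ⟪x, z⟫ * (2 * θ * τ ^ 2 * ⟪x, y⟫)|
        ≤ 2 * θ * 1 * (‖x‖ * ‖z‖) * (2 * θ * 1 * (‖x‖ * ‖y‖)) := by
      rw [abs_mul, abs_mul, abs_mul (2 * θ * τ ^ 2), abs_of_nonneg (by positivity : 0 ≤ 2 * θ * τ ^ 2)]
      gcongr
      · exact abs_real_inner_le_norm x z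
      · exact abs_real_inner_le_norm x y
    have a3 : 0 ≤ ‖z‖ * ‖y‖ := by positivity
    have a4 : 2 * θ + 4 * θ * (θ * ‖x‖ ^ 2) ≤ 4 * ((1 + θ) * (1 + θ * ‖x‖ ^ 2)) := by nlinarith
    calc _ ≤ 2 * θ * 1 * (‖y‖ * ‖z‖) + 2 * θ * 1 * (‖x‖ * ‖z‖) * (2 * θ * 1 * (‖x‖ * ‖y‖)) :=
          add_le_add a1 a2
      _ = ‖z‖ * ‖y‖ * (2 * θ + 4 * θ * (θ * ‖x‖ ^ 2)) := by ring
      _ ≤ _ := by gcongr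
  calc _ ≤ ‖z‖ * ‖y‖ * (4 * ((1 + θ) * (1 + θ * ‖x‖ ^ 2))) * Real.exp (-(θ * ‖x‖ ^ 2 / 4)) := by
        gcongr
        exact abs_gaussFun_le hθ hτ x
    _ = ‖z‖ * ‖y‖ * (4 * ((1 + θ) * (1 + θ * ‖x‖ ^ 2) ^ 1 * Real.exp (-(θ * ‖x‖ ^ 2 / 4)))) := by ring
    _ ≤ _ := by
        unfold gaussEnvelope
        gcongr
        · have : (0:ℝ) ≤ d := Nat.cast_nonneg d
          linarith
        · linarith
        · norm_num

lemma abs_scale_factor_le (hθ : 0 ≤ θ) (hτ : τ ∈ Set.Icc (2⁻¹ : ℝ) 1) (x : Rd d) :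
    |d * τ ^ (d - 1) - 2 * θ * τ * ‖x‖ ^ 2 * τ ^ d| ≤ (d + 2) * (1 + θ * ‖x‖ ^ 2) := by
  have h0 : 0 ≤ τ := by linarith [hτ.1]
  have hr : 0 ≤ θ * ‖x‖ ^ 2 := by positivity
  have hd : (0:ℝ) ≤ d := Nat.cast_nonneg d
  refine (abs_sub _ _).trans ?_
  rw [abs_of_nonneg (by positivity), abs_of_nonneg (by positivity)]
  have b1 : τ ^ (d - 1) ≤ 1 := pow_le_one₀ h0 hτ.2
  have b2 : τ * τ ^ d ≤ 1 := by
    rw [← pow_succ']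
    exact pow_le_one₀ h0 hτ.2
  calc _ = d * τ ^ (d - 1) + 2 * (θ * ‖x‖ ^ 2) * (τ * τ ^ d) := by ring
    _ ≤ d * 1 + 2 * (θ * ‖x‖ ^ 2) * 1 := by gcongr
    _ ≤ _ := by nlinarith

lemma abs_gaussFunT_le (hθ : 0 ≤ θ) (hτ : τ ∈ Set.Icc (2⁻¹ : ℝ) 1) (x : Rd d) :
    |gaussFunT d θ τ x| ≤ gaussEnvelope d θ x := by
  have hr : 0 ≤ θ * ‖x‖ ^ 2 := by positivity
  have hd : (0:ℝ) ≤ d := Nat.cast_nonneg d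
  rw [gaussFunT, abs_mul, Real.abs_exp]
  calc _ ≤ (d + 2) * (1 + θ * ‖x‖ ^ 2) * Real.exp (-(θ * ‖x‖ ^ 2 / 4)) := by
        exact mul_le_mul (abs_scale_factor_le hθ hτ x) (exp_scale_le hθ hτ x) (Real.exp_nonneg _)
          (by positivity)
    _ = (d + 2) * (1 * (1 + θ * ‖x‖ ^ 2) ^ 1 * Real.exp (-(θ * ‖x‖ ^ 2 / 4))) := by ring
    _ ≤ _ := by
        unfold gaussEnvelope
        gcongr
        · linarith
        · linarith
        · linarith
        · linarith
        · norm_num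

lemma abs_gaussFunTZ_le (hθ : 0 ≤ θ) (hτ : τ ∈ Set.Icc (2⁻¹ : ℝ) 1) (z x : Rd d) :
    |gaussFunTZ d θ τ z x| ≤ ‖z‖ * gaussEnvelope d θ x := by
  have h0 : 0 ≤ τ := by linarith [hτ.1]
  have h1 : τ ^ 2 ≤ 1 := pow_le_one₀ h0 hτ.2
  have hr : 0 ≤ θ * ‖x‖ ^ 2 := by positivity
  have hd : (0:ℝ) ≤ d := Nat.cast_nonneg d
  have b2 : τ * τ ^ d ≤ 1 := by
    rw [← pow_succ']
    exact pow_le_one₀ h0 hτ.2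
  have hi := abs_inner_mul_le hθ x z
  set q := θ * |(⟪x, z⟫ : ℝ)| with hq
  have hq0 : 0 ≤ q := by positivity
  rw [gaussFunTZ, abs_mul, Real.abs_exp]
  have e : |-(4 * θ * τ * ⟪x, z⟫ * τ ^ d) - (d * τ ^ (d - 1) - 2 * θ * τ * ‖x‖ ^ 2 * τ ^ d) *
    (2 * θ * τ ^ 2 * ⟪x, z⟫)| ≤ 4 * q * 1 + (d + 2) * (1 + θ * ‖x‖ ^ 2) * (2 * 1 * q) := by
    refine (abs_sub _ _).trans ?_
    rw [abs_neg]
    refine add_le_add ?_ ?_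
    · have : |4 * θ * τ * ⟪x, z⟫ * τ ^ d| = 4 * q * (τ * τ ^ d) := by
        rw [abs_mul, abs_mul, abs_of_nonneg (by positivity : 0 ≤ 4 * θ * τ),
          abs_of_nonneg (by positivity : 0 ≤ τ ^ d), hq]
        ring
      rw [this]
      gcongr
    · rw [abs_mul]
      have : |2 * θ * τ ^ 2 * ⟪x, z⟫| = 2 * τ ^ 2 * q := by
        rw [abs_mul, abs_of_nonneg (by positivity : 0 ≤ 2 * θ * τ ^ 2), hq]
        ring
      rw [this]
      gcongr
      exact abs_scale_factor_le hθ hτ x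
  calc _ ≤ (4 * q * 1 + (d + 2) * (1 + θ * ‖x‖ ^ 2) * (2 * 1 * q)) *
        Real.exp (-(θ * ‖x‖ ^ 2 / 4)) := by
        exact mul_le_mul e (exp_scale_le hθ hτ x) (Real.exp_nonneg _) (by positivity)
    _ ≤ ((2 * d + 8) * (1 + θ * ‖x‖ ^ 2) * q) * Real.exp (-(θ * ‖x‖ ^ 2 / 4)) := by
        gcongr
        nlinarith [mul_nonneg hr hq0]
    _ ≤ ((2 * d + 8) * (1 + θ * ‖x‖ ^ 2) * (‖z‖ * ((1 + θ) * (1 + θ * ‖x‖ ^ 2)))) *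
        Real.exp (-(θ * ‖x‖ ^ 2 / 4)) := by gcongr
    _ = _ := by unfold gaussEnvelope; ring

end Bounds

section Differences

variable {θ τ S M : ℝ} {x : Rd d}

lemma abs_image_sub_le {f f' : ℝ → ℝ} {C a b : ℝ} (hab : a ≤ b)
    (hf : ∀ s, HasDerivAt f (f' s) s) (hC : ∀ s ∈ Set.Icc a b, |f' s| ≤ C) :
    |f b - f a| ≤ C * (b - a) := by
  have := Convex.norm_image_sub_le_of_norm_hasDerivWithin_le (f := f) (f' := f') (C := C)
    (s := Set.Icc a b) (fun s _ => (hf s).hasDerivWithinAt) hC (convex_Icc a b)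
    (Set.left_mem_Icc.2 hab) (Set.right_mem_Icc.2 hab)
  rwa [Real.norm_eq_abs, Real.norm_eq_abs, abs_of_nonneg (sub_nonneg.2 hab)] at this

lemma norm_smul_le_of_mem {s : ℝ} (hs : s ∈ Set.Icc (0:ℝ) 1) (z : Rd d) : ‖s • z‖ ≤ ‖z‖ := by
  rw [norm_smul, Real.norm_of_nonneg hs.1]
  exact mul_le_of_le_one_left (norm_nonneg z) hs.2

lemma abs_gaussFun_sub_le (hθ : 0 ≤ θ) (hτ : τ ∈ Set.Icc (2⁻¹ : ℝ) 1)
    (hS : ∀ w : Rd d, ‖w‖ ≤ M → gaussEnvelope d θ (x + w) ≤ S) {z : Rd d} (hz : ‖z‖ ≤ M) :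
    |gaussFun d θ τ (x + z) - gaussFun d θ τ x| ≤ ‖z‖ * S := by
  have := abs_image_sub_le (C := ‖z‖ * S) zero_le_one (hasDerivAt_gaussFun θ τ x z) fun s hs =>
    (abs_gaussFunZ_le hθ hτ z _).trans (by
      gcongr
      exact hS _ ((norm_smul_le_of_mem hs z).trans hz))
  simpa using this

lemma abs_gaussFunZ_sub_le (hθ : 0 ≤ θ) (hτ : τ ∈ Set.Icc (2⁻¹ : ℝ) 1) {y z : Rd d}
    (hS : ∀ w : Rd d, ‖w‖ ≤ ‖y‖ → gaussEnvelope d θ (x + w) ≤ S) :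
    |gaussFunZ d θ τ z (x + y) - gaussFunZ d θ τ z x| ≤ ‖z‖ * ‖y‖ * S := by
  have := abs_image_sub_le (C := ‖z‖ * ‖y‖ * S) zero_le_one (hasDerivAt_gaussFunZ θ τ x z y)
    fun s hs => (abs_gaussFunZZ_le hθ hτ z y _).trans (by
      gcongr
      exact hS _ (norm_smul_le_of_mem hs y))
  simpa using this

lemma abs_gaussFun_second_sub_le (hθ : 0 ≤ θ) (hτ : τ ∈ Set.Icc (2⁻¹ : ℝ) 1)
    (hS : ∀ w : Rd d, ‖w‖ ≤ M → gaussEnvelope d θ (x + w) ≤ S) {y z : Rd d}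
    (hyz : ‖y‖ + ‖z‖ ≤ M) :
    |gaussFun d θ τ (x + y + z) - gaussFun d θ τ (x + y) - (gaussFun d θ τ (x + z) - gaussFun d θ τ x)|
      ≤ ‖z‖ * ‖y‖ * S := by
  have := abs_image_sub_le (C := ‖z‖ * ‖y‖ * S) zero_le_one
    (fun s => (hasDerivAt_gaussFun θ τ (x + y) z s).sub (hasDerivAt_gaussFun θ τ x z s))
    fun s hs => by
      have e : x + y + s • z = x + s • z + y := by abel
      rw [e]
      refine abs_gaussFunZ_sub_le hθ hτ fun w hw => ?_
      rw [add_assoc]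
      refine hS _ ((norm_add_le _ _).trans ?_)
      linarith [norm_smul_le_of_mem hs z]
  simp only [Pi.sub_apply, one_smul, zero_smul, add_zero, sub_zero, mul_one] at this
  convert this using 2
  ring

lemma abs_gaussFun_scale_sub_le (hθ : 0 ≤ θ) (hτ : τ ∈ Set.Icc (2⁻¹ : ℝ) 1)
    (hS : gaussEnvelope d θ x ≤ S) :
    |gaussFun d θ 1 x - gaussFun d θ τ x| ≤ (1 - τ) * S := by
  rw [mul_comm]
  exact abs_image_sub_le hτ.2 (fun s => hasDerivAt_gaussFun_scale θ s x) fun s hs =>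
    (abs_gaussFunT_le hθ ⟨hτ.1.trans hs.1, hs.2⟩ x).trans hS

lemma abs_gaussFun_scale_second_sub_le (hθ : 0 ≤ θ) (hτ : τ ∈ Set.Icc (2⁻¹ : ℝ) 1)
    (hS : ∀ w : Rd d, ‖w‖ ≤ M → gaussEnvelope d θ (x + w) ≤ S) {z : Rd d} (hz : ‖z‖ ≤ M) :
    |gaussFun d θ 1 (x + z) - gaussFun d θ 1 x - (gaussFun d θ τ (x + z) - gaussFun d θ τ x)|
      ≤ ‖z‖ * (1 - τ) * S := by
  have := abs_image_sub_le (C := ‖z‖ * S) hτ.2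
    (fun s => (hasDerivAt_gaussFun_scale θ s (x + z)).sub (hasDerivAt_gaussFun_scale θ s x))
    fun s hs => by
      have h := abs_image_sub_le (C := ‖z‖ * S) zero_le_one (hasDerivAt_gaussFunT θ s x z)
        fun r hr => (abs_gaussFunTZ_le hθ ⟨hτ.1.trans hs.1, hs.2⟩ z _).trans (by
          gcongr
          exact hS _ ((norm_smul_le_of_mem hr z).trans hz))
      simpa using h
  simp only [Pi.sub_apply] at this
  convert this using 1
  ring

end Differences

/-- The envelope near `x` is dominated by the weight whose `η`-integral is comparable to the stable
density at `x`. -/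
lemma exists_gaussEnvelope_le (d : ℕ) (M : ℝ) :
    ∃ C : ℝ, 0 < C ∧ ∀ u : ℝ, 0 < u → ∀ x w : Rd d, ‖w‖ ≤ M →
      gaussEnvelope d (1 / (4 * u)) (x + w)
        ≤ C * ((1 + 1 / u) * min 1 ((1 + u) / (1 + ‖x‖ ^ 2)) ^ (d + 1)) := by
  set A : ℝ := 9 + 2 * M ^ 2 with hA
  set B : ℝ := 4 ^ (d + 3) * (d + 3).factorial * Real.exp (1 / 4) with hB
  refine ⟨(2 * d + 8) * (B * A ^ (d + 1)), by positivity, fun u hu x w hw => ?_⟩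
  set θ : ℝ := 1 / (4 * u) with hθ
  set r : ℝ := θ * ‖x + w‖ ^ 2 with hr
  have hθ0 : 0 < θ := by positivity
  have hr0 : 0 ≤ r := by positivity
  have hR : 0 < 1 + ‖x‖ ^ 2 := by positivity
  set q := min 1 ((1 + u) / (1 + ‖x‖ ^ 2)) with hq
  have hq0 : 0 ≤ q := le_min zero_le_one (by positivity)
  have h1 : 1 + θ ≤ 1 + 1 / u := by
    rw [hθ]; gcongr; linarith
  have h2 : (1 + r)⁻¹ ≤ A * q := by
    rw [hq, mul_min_of_nonneg _ _ (by positivity)]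
    refine le_min ?_ ?_
    · rw [mul_one]
      have : (1 + r)⁻¹ ≤ 1 := inv_le_one_of_one_le₀ (by linarith)
      nlinarith [sq_nonneg M]
    · rw [← mul_div_assoc, le_div_iff₀ hR, inv_mul_le_iff₀ (by positivity)]
      have e1 : ‖x + w‖ ^ 2 = 4 * u * r := by rw [hr, hθ]; field_simp
      have e2 : ‖x‖ ^ 2 ≤ 2 * ‖x + w‖ ^ 2 + 2 * M ^ 2 := by
        have t1 : ‖x‖ ≤ ‖x + w‖ + ‖w‖ := by simpa using norm_sub_le (x + w) w
        have t2 : ‖x‖ ≤ ‖x + w‖ + M := by linarith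
        nlinarith [sq_nonneg (‖x + w‖ - M), norm_nonneg x, norm_nonneg (x + w)]
      rw [e1] at e2
      have := mul_nonneg hu.le hr0
      nlinarith [sq_nonneg M, mul_nonneg (sq_nonneg M) this, mul_nonneg (sq_nonneg M) hu.le,
        mul_nonneg (sq_nonneg M) hr0]
  have h3 : (1 + r) ^ 2 * Real.exp (-(r / 4)) ≤ B * (A * q) ^ (d + 1) := by
    have f1 := Real.pow_div_factorial_le_exp ((1 + r) / 4) (by positivity) (d + 3)
    rw [div_le_iff₀ (by positivity), div_pow, div_le_iff₀ (by positivity)] at f1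
    have f2 : Real.exp ((1 + r) / 4) * Real.exp (-(r / 4)) = Real.exp (1 / 4) := by
      rw [← Real.exp_add]; congr 1; ring
    calc (1 + r) ^ 2 * Real.exp (-(r / 4))
        = (1 + r) ^ (d + 3) * Real.exp (-(r / 4)) * ((1 + r)⁻¹) ^ (d + 1) := by
          rw [show d + 3 = 2 + (d + 1) by ring, pow_add, inv_pow]
          have : (1 + r) ^ (d + 1) ≠ 0 := by positivity
          field_simp
      _ ≤ (Real.exp ((1 + r) / 4) * (d + 3).factorial * 4 ^ (d + 3)) * Real.exp (-(r / 4)) *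
          (A * q) ^ (d + 1) := by gcongr
      _ = (Real.exp ((1 + r) / 4) * Real.exp (-(r / 4))) * (4 ^ (d + 3) * (d + 3).factorial) *
          (A * q) ^ (d + 1) := by ring
      _ = _ := by rw [f2, hB]; ring
  unfold gaussEnvelope
  rw [← hr]
  calc (2 * d + 8) * ((1 + θ) * (1 + r) ^ 2 * Real.exp (-(r / 4)))
      = (2 * d + 8) * ((1 + θ) * ((1 + r) ^ 2 * Real.exp (-(r / 4)))) := by ring
    _ ≤ (2 * d + 8) * ((1 + 1 / u) * (B * (A * q) ^ (d + 1))) := by gcongr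
    _ = _ := by rw [mul_pow]; ring

end Gaussian

/-! ### Regularity of the stable density relative to itself -/

section Regularity

variable {d : ℕ} {α κ : ℝ} {η : Measure ℝ}

namespace IsSubordination

/-- The mixture decays no faster than `‖x‖ ^ (-d - α)`: the variance parameters of order
`1 + ‖x‖²` already contribute that much. -/
lemma exists_le_gaussMix (h : IsSubordination d α κ η) :
    ∃ c : ℝ, 0 < c ∧ ∀ x : Rd d,
      c * (1 + ‖x‖ ^ 2) ^ (-((d : ℝ) / 2) - α / 2) ≤ gaussMix d η x := by
  have := h.oneSided.isProbabilityMeasure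
  obtain ⟨δ, K, hδ, hK, hw⟩ := h.oneSided.exists_window (by linarith [h.pos]) (by linarith [h.lt_two])
  refine ⟨(4 * Real.pi * K) ^ (-((d : ℝ) / 2)) * Real.exp (-(1 / (4 * δ))) * 4⁻¹,
    by positivity, fun x => ?_⟩
  set R := 1 + ‖x‖ ^ 2 with hR
  have hR1 : 1 ≤ R := by rw [hR]; nlinarith [sq_nonneg ‖x‖]
  have hR0 : 0 < R := by linarith
  set A := (4 * Real.pi * (K * R)) ^ (-((d : ℝ) / 2)) * Real.exp (-(1 / (4 * δ))) with hA
  have hA0 : 0 ≤ A := by positivity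
  calc _ = A * (4⁻¹ * R ^ (-(α / 2))) := by
        rw [hA, ← mul_assoc (4 * Real.pi), Real.mul_rpow (by positivity) hR0.le, sub_eq_add_neg,
          Real.rpow_add hR0]
        ring
    _ ≤ A * η.real (Set.Icc (δ * R) (K * R)) := by gcongr; exact hw R hR1
    _ = ∫ u, (Set.Icc (δ * R) (K * R)).indicator (fun _ => A) u ∂η := by
        rw [integral_indicator_const _ measurableSet_Icc, smul_eq_mul, mul_comm]
    _ ≤ gaussMix d η x := by
        refine integral_mono_ae ((integrable_const _).indicator measurableSet_Icc)
          (h.integrable_gaussMix x) ?_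
        filter_upwards [h.oneSided.pos] with u hu
        by_cases hm : u ∈ Set.Icc (δ * R) (K * R)
        · rw [Set.indicator_of_mem hm, hA]
          have e1 : (4 * Real.pi * (K * R)) ^ (-((d : ℝ) / 2)) ≤ (4 * Real.pi * u) ^ (-((d : ℝ) / 2)) :=
            Real.rpow_le_rpow_of_nonpos (by positivity) (by gcongr; exact hm.2)
              (by linarith [h.dim_half_pos])
          have e2 : ‖x‖ ^ 2 / (4 * u) ≤ 1 / (4 * δ) := by
            rw [div_le_div_iff₀ (by positivity) (by positivity)]
            nlinarith [hm.1, sq_nonneg ‖x‖]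
          gcongr
        · rw [Set.indicator_of_notMem hm]
          positivity

/-- An integrand dominated by the Gaussian weight at `x` integrates to at most a multiple of the
mixture at `x`. -/
lemma exists_abs_integral_le_gaussMix (h : IsSubordination d α κ η) :
    ∃ C : ℝ, 0 < C ∧ ∀ (D : ℝ → ℝ) (A : ℝ) (x : Rd d), 0 ≤ A →
      (∀ u : ℝ, 0 < u → |D u| ≤ A * ((1 + 1 / u) * min 1 ((1 + u) / (1 + ‖x‖ ^ 2)) ^ (d + 1))) →
      |∫ u, (4 * Real.pi * u) ^ (-((d : ℝ) / 2)) * D u ∂η| ≤ C * A * gaussMix d η x := by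
  have ha0 : 0 < α / 2 := by linarith [h.pos]
  have ha1 : α / 2 < 1 := by linarith [h.lt_two]
  obtain ⟨c, hc, hlow⟩ := h.exists_le_gaussMix
  obtain ⟨C, hC, hup⟩ := h.oneSided.exists_integral_gaussWeight_le ha0 ha1 d
  refine ⟨(4 * Real.pi) ^ (-((d : ℝ) / 2)) * C / c, by positivity, fun D A x hA hD => ?_⟩
  set R := 1 + ‖x‖ ^ 2 with hR
  have hR1 : 1 ≤ R := by rw [hR]; nlinarith [sq_nonneg ‖x‖]
  have hI := (h.oneSided.integrable_gaussWeight ha0 ha1 d hR1).const_mul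
    ((4 * Real.pi) ^ (-((d : ℝ) / 2)) * A)
  calc _ ≤ ∫ u, (4 * Real.pi) ^ (-((d : ℝ) / 2)) * A * gaussWeight d R u ∂η := by
        rw [← Real.norm_eq_abs]
        refine norm_integral_le_of_norm_le hI ?_
        filter_upwards [h.oneSided.pos] with u hu
        rw [norm_mul, Real.norm_of_nonneg (by positivity), Real.norm_eq_abs,
          Real.mul_rpow (by positivity) hu.le]
        calc _ ≤ (4 * Real.pi) ^ (-((d : ℝ) / 2)) * u ^ (-((d : ℝ) / 2)) *
              (A * ((1 + 1 / u) * min 1 ((1 + u) / R) ^ (d + 1))) := by gcongr; exact hD u hu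
          _ = _ := by rw [gaussWeight]; ring
    _ = (4 * Real.pi) ^ (-((d : ℝ) / 2)) * A * ∫ u, gaussWeight d R u ∂η := integral_const_mul _ _
    _ ≤ (4 * Real.pi) ^ (-((d : ℝ) / 2)) * A * (C * (gaussMix d η x / c)) := by
        gcongr
        refine (hup R hR1).trans ?_
        gcongr
        rw [le_div_iff₀ hc, mul_comm]
        exact hlow x
    _ = _ := by field_simp

/-- The mixture, dilated by `τ`, as an integral of `gaussFun`; this turns differences in time of the
stable density into differences in the scale parameter. -/
lemma integrable_gaussFun_mix (h : IsSubordination d α κ η) (τ : ℝ) (x : Rd d) :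
    Integrable (fun u => (4 * Real.pi * u) ^ (-((d : ℝ) / 2)) * gaussFun d (1 / (4 * u)) τ x) η ∧
    τ ^ d * gaussMix d η (τ • x)
      = ∫ u, (4 * Real.pi * u) ^ (-((d : ℝ) / 2)) * gaussFun d (1 / (4 * u)) τ x ∂η := by
  have e : (fun u => (4 * Real.pi * u) ^ (-((d : ℝ) / 2)) * gaussFun d (1 / (4 * u)) τ x)
      = fun u => τ ^ d * ((4 * Real.pi * u) ^ (-((d : ℝ) / 2)) *
        Real.exp (-(‖τ • x‖ ^ 2 / (4 * u)))) := by
    funext u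
    rw [gaussFun, norm_smul, mul_pow, Real.norm_eq_abs, sq_abs,
      show 1 / (4 * u) * τ ^ 2 * ‖x‖ ^ 2 = τ ^ 2 * ‖x‖ ^ 2 / (4 * u) by ring]
    ring
  rw [e]
  exact ⟨(h.integrable_gaussMix _).const_mul _, (integral_const_mul _ _).symm⟩

lemma gaussMix_eq (h : IsSubordination d α κ η) (x : Rd d) : gaussMix d η x
      = ∫ u, (4 * Real.pi * u) ^ (-((d : ℝ) / 2)) * gaussFun d (1 / (4 * u)) 1 x ∂η := by
  simpa using (h.integrable_gaussFun_mix 1 x).2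

variable (M : ℝ)

lemma exists_abs_gaussMix_sub_le (h : IsSubordination d α κ η) :
    ∃ C : ℝ, 0 < C ∧ ∀ x z : Rd d, ‖z‖ ≤ M →
      |gaussMix d η (x + z) - gaussMix d η x| ≤ C * ‖z‖ * gaussMix d η x := by
  obtain ⟨C₁, hC₁, h1⟩ := h.exists_abs_integral_le_gaussMix
  obtain ⟨C₂, hC₂, h2⟩ := exists_gaussEnvelope_le d M
  refine ⟨C₁ * C₂, by positivity, fun x z hz => ?_⟩
  rw [h.gaussMix_eq (x + z), h.gaussMix_eq x, ← integral_sub (h.integrable_gaussFun_mix 1 _).1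
    (h.integrable_gaussFun_mix 1 _).1, ← h.gaussMix_eq x]
  simp_rw [← mul_sub]
  refine (h1 _ (‖z‖ * C₂) x (by positivity) fun u hu => ?_).trans_eq (by ring)
  refine (abs_gaussFun_sub_le (by positivity) ⟨by norm_num, le_rfl⟩ (h2 u hu x) hz).trans_eq
    (by ring)

lemma exists_abs_gaussMix_second_sub_le (h : IsSubordination d α κ η) :
    ∃ C : ℝ, 0 < C ∧ ∀ x y z : Rd d, ‖y‖ + ‖z‖ ≤ M →
      |gaussMix d η (x + y + z) - gaussMix d η (x + y) - (gaussMix d η (x + z) - gaussMix d η x)|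
        ≤ C * ‖z‖ * ‖y‖ * gaussMix d η x := by
  obtain ⟨C₁, hC₁, h1⟩ := h.exists_abs_integral_le_gaussMix
  obtain ⟨C₂, hC₂, h2⟩ := exists_gaussEnvelope_le d M
  refine ⟨C₁ * C₂, by positivity, fun x y z hyz => ?_⟩
  have i := fun w : Rd d => (h.integrable_gaussFun_mix 1 w).1
  rw [h.gaussMix_eq (x + y + z), h.gaussMix_eq (x + y), h.gaussMix_eq (x + z), h.gaussMix_eq x,
    ← integral_sub (i _) (i _), ← integral_sub (i _) (i _),
    ← integral_sub (by exact (i _).sub (i _)) (by exact (i _).sub (i _)), ← h.gaussMix_eq x]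
  simp_rw [← mul_sub]
  refine (h1 _ (‖z‖ * ‖y‖ * C₂) x (by positivity) fun u hu => ?_).trans_eq (by ring)
  refine (abs_gaussFun_second_sub_le (by positivity) ⟨by norm_num, le_rfl⟩ (h2 u hu x) hyz).trans_eq
    (by ring)

lemma exists_abs_gaussMix_scale_sub_le (h : IsSubordination d α κ η) :
    ∃ C : ℝ, 0 < C ∧ ∀ (x : Rd d), ∀ τ ∈ Set.Icc (2⁻¹ : ℝ) 1,
      |gaussMix d η x - τ ^ d * gaussMix d η (τ • x)| ≤ C * (1 - τ) * gaussMix d η x := by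
  obtain ⟨C₁, hC₁, h1⟩ := h.exists_abs_integral_le_gaussMix
  obtain ⟨C₂, hC₂, h2⟩ := exists_gaussEnvelope_le d 0
  refine ⟨C₁ * C₂, by positivity, fun x τ hτ => ?_⟩
  have hτ1 : 0 ≤ 1 - τ := by linarith [hτ.2]
  rw [h.gaussMix_eq x, (h.integrable_gaussFun_mix τ x).2, ← integral_sub (h.integrable_gaussFun_mix 1 _).1
    (h.integrable_gaussFun_mix τ _).1, ← h.gaussMix_eq x]
  simp_rw [← mul_sub]
  refine (h1 _ ((1 - τ) * C₂) x (by positivity) fun u hu => ?_).trans_eq (by ring)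
  refine (abs_gaussFun_scale_sub_le (by positivity) hτ
    (by simpa using h2 u hu x 0 (by simp))).trans_eq (by ring)

lemma exists_abs_gaussMix_scale_second_sub_le (h : IsSubordination d α κ η) :
    ∃ C : ℝ, 0 < C ∧ ∀ (x z : Rd d), ‖z‖ ≤ M → ∀ τ ∈ Set.Icc (2⁻¹ : ℝ) 1,
      |gaussMix d η (x + z) - gaussMix d η x -
        (τ ^ d * gaussMix d η (τ • (x + z)) - τ ^ d * gaussMix d η (τ • x))|
        ≤ C * ‖z‖ * (1 - τ) * gaussMix d η x := by
  obtain ⟨C₁, hC₁, h1⟩ := h.exists_abs_integral_le_gaussMix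
  obtain ⟨C₂, hC₂, h2⟩ := exists_gaussEnvelope_le d M
  refine ⟨C₁ * C₂, by positivity, fun x z hz τ hτ => ?_⟩
  have hτ1 : 0 ≤ 1 - τ := by linarith [hτ.2]
  have i := fun (τ : ℝ) (w : Rd d) => (h.integrable_gaussFun_mix τ w).1
  rw [h.gaussMix_eq (x + z), h.gaussMix_eq x, (h.integrable_gaussFun_mix τ (x + z)).2,
    (h.integrable_gaussFun_mix τ x).2,
    ← integral_sub (i _ _) (i _ _), ← integral_sub (i _ _) (i _ _),
    ← integral_sub (by exact (i _ _).sub (i _ _)) (by exact (i _ _).sub (i _ _)),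
    ← h.gaussMix_eq x]
  simp_rw [← mul_sub]
  refine (h1 _ (‖z‖ * (1 - τ) * C₂) x (by positivity) fun u hu => ?_).trans_eq (by ring)
  refine (abs_gaussFun_scale_second_sub_le (by positivity) hτ (h2 u hu x) hz).trans_eq (by ring)

lemma scaleAt_eq (h : IsSubordination d α κ η) {t : ℝ} (ht : 0 < t) :
    scaleAt α κ t = κ ^ (1 / α) * t ^ (1 / α) :=
  Real.mul_rpow h.scale_pos.le ht.le

lemma norm_inv_scaleAt_smul (h : IsSubordination d α κ η) {t : ℝ} (ht : 0 < t) (z : Rd d) :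
    ‖(scaleAt α κ t)⁻¹ • z‖ = (κ ^ (1 / α))⁻¹ * (‖z‖ / t ^ (1 / α)) := by
  have hs := scaleAt_pos (α := α) h.scale_pos ht
  rw [norm_smul, Real.norm_of_nonneg (inv_pos.2 hs).le, h.scaleAt_eq ht, mul_inv]
  ring

lemma norm_inv_scaleAt_smul_le (h : IsSubordination d α κ η) {t : ℝ} (ht : 0 < t) {z : Rd d}
    (hz : ‖z‖ ≤ M * t ^ (1 / α)) :
    ‖(scaleAt α κ t)⁻¹ • z‖ ≤ (κ ^ (1 / α))⁻¹ * M := by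
  have := h.scale_pos
  rw [h.norm_inv_scaleAt_smul ht]
  gcongr
  rwa [div_le_iff₀ (by positivity)]

/-- A displacement of at most the order of the stable scale changes the stable density by at most
the relative displacement times the density itself. -/
lemma exists_abs_stableDensity_sub_le (h : IsSubordination d α κ η) :
    ∃ C : ℝ, 0 < C ∧ ∀ t : ℝ, 0 < t → ∀ x z : Rd d, ‖z‖ ≤ M * t ^ (1 / α) →
      |stableDensity d α t (x + z) - stableDensity d α t x|
        ≤ C * (‖z‖ / t ^ (1 / α)) * stableDensity d α t x := by
  obtain ⟨C, hC, hM⟩ := h.exists_abs_gaussMix_sub_le ((κ ^ (1 / α))⁻¹ * M)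
  have hκ : 0 < κ ^ (1 / α) := Real.rpow_pos_of_pos h.scale_pos _
  refine ⟨C * (κ ^ (1 / α))⁻¹, by positivity, fun t ht x z hz => ?_⟩
  have hs := scaleAt_pos (α := α) h.scale_pos ht
  have := hM ((scaleAt α κ t)⁻¹ • x) _ (h.norm_inv_scaleAt_smul_le M ht hz)
  rw [h.norm_inv_scaleAt_smul ht] at this
  simp only [h.stableDensity_eq ht, smul_add, ← mul_sub]
  rw [abs_mul, abs_of_pos (by positivity)]
  refine (mul_le_mul_of_nonneg_left this (by positivity)).trans_eq (by ring)

lemma exists_abs_stableDensity_second_sub_le (h : IsSubordination d α κ η) :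
    ∃ C : ℝ, 0 < C ∧ ∀ t : ℝ, 0 < t → ∀ x y z : Rd d, ‖y‖ ≤ t ^ (1 / α) → ‖z‖ ≤ M * t ^ (1 / α) →
      |stableDensity d α t (x + y + z) - stableDensity d α t (x + y) -
        (stableDensity d α t (x + z) - stableDensity d α t x)|
        ≤ C * (‖z‖ / t ^ (1 / α)) * (‖y‖ / t ^ (1 / α)) * stableDensity d α t x := by
  obtain ⟨C, hC, hM⟩ := h.exists_abs_gaussMix_second_sub_le
    ((κ ^ (1 / α))⁻¹ * 1 + (κ ^ (1 / α))⁻¹ * M)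
  have hκ : 0 < κ ^ (1 / α) := Real.rpow_pos_of_pos h.scale_pos _
  refine ⟨C * (κ ^ (1 / α))⁻¹ * (κ ^ (1 / α))⁻¹, by positivity, fun t ht x y z hy hz => ?_⟩
  have hs := scaleAt_pos (α := α) h.scale_pos ht
  have := hM ((scaleAt α κ t)⁻¹ • x) _ _ (add_le_add
    (h.norm_inv_scaleAt_smul_le 1 ht (by rwa [one_mul])) (h.norm_inv_scaleAt_smul_le M ht hz))
  rw [h.norm_inv_scaleAt_smul ht, h.norm_inv_scaleAt_smul ht] at this
  simp only [h.stableDensity_eq ht, smul_add, ← mul_sub]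
  rw [abs_mul, abs_of_pos (by positivity)]
  refine (mul_le_mul_of_nonneg_left this (by positivity)).trans_eq (by ring)

/-- The ratio of the space scales at times `s ≤ t ≤ 2 s`, and the density at time `t` seen from the
scale at time `s`. -/
lemma exists_scale_ratio (h : IsSubordination d α κ η) {s t : ℝ} (hs : 0 < s) (hst : s ≤ t)
    (hts : t ≤ 2 * s) :
    ∃ τ ∈ Set.Icc (2⁻¹ : ℝ) 1, 1 - τ ≤ (t - s) / s ∧ ∀ x : Rd d, stableDensity d α t x =
      (scaleAt α κ s ^ d)⁻¹ * (τ ^ d * gaussMix d η (τ • ((scaleAt α κ s)⁻¹ • x))) := by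
  have ht : 0 < t := by linarith
  have hα := h.one_lt
  have hσs := scaleAt_pos (α := α) h.scale_pos hs
  have hσt := scaleAt_pos (α := α) h.scale_pos ht
  have hκ : 0 < κ ^ (1 / α) := Real.rpow_pos_of_pos h.scale_pos _
  have hr0 : 0 < s / t := by positivity
  have hr1 : s / t ≤ 1 := by rw [div_le_one ht]; exact hst
  have hlow : s / t ≤ (s / t) ^ (1 / α) := by
    nth_rewrite 1 [← Real.rpow_one (s / t)]
    exact Real.rpow_le_rpow_of_exponent_ge hr0 hr1 (by rw [div_le_one (by linarith)]; exact hα.le)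
  have hτ : scaleAt α κ s / scaleAt α κ t = (s / t) ^ (1 / α) := by
    rw [h.scaleAt_eq hs, h.scaleAt_eq ht, Real.div_rpow hs.le ht.le, mul_div_mul_left _ _ hκ.ne']
  refine ⟨(s / t) ^ (1 / α), ⟨?_, ?_⟩, ?_, fun x => ?_⟩
  · refine le_trans ?_ hlow
    rw [inv_eq_one_div, div_le_div_iff₀ two_pos ht]
    linarith
  · exact Real.rpow_le_one hr0.le hr1 (by positivity)
  · refine (sub_le_sub_left hlow 1).trans ?_
    rw [one_sub_div ht.ne']
    gcongr
  · have e1 : (scaleAt α κ t ^ d)⁻¹ =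
        (scaleAt α κ s ^ d)⁻¹ * (scaleAt α κ s / scaleAt α κ t) ^ d := by
      rw [div_pow]
      field_simp
    have e2 : (scaleAt α κ t)⁻¹ = scaleAt α κ s / scaleAt α κ t * (scaleAt α κ s)⁻¹ := by
      field_simp
    rw [← hτ, h.stableDensity_eq ht, smul_smul, ← mul_assoc, ← e1, ← e2]

lemma exists_abs_stableDensity_time_sub_le (h : IsSubordination d α κ η) :
    ∃ C : ℝ, 0 < C ∧ ∀ s t : ℝ, 0 < s → s ≤ t → t ≤ 2 * s → ∀ x : Rd d,
      |stableDensity d α t x - stableDensity d α s x|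
        ≤ C * ((t - s) / s) * stableDensity d α s x := by
  obtain ⟨C, hC, hM⟩ := h.exists_abs_gaussMix_scale_sub_le
  refine ⟨C, hC, fun s t hs hst hts x => ?_⟩
  obtain ⟨τ, hτ, hτ1, he⟩ := h.exists_scale_ratio hs hst hts
  have hσs := scaleAt_pos (α := α) h.scale_pos hs
  have h0 := h.gaussMix_nonneg ((scaleAt α κ s)⁻¹ • x)
  rw [he, h.stableDensity_eq hs, ← mul_sub, abs_mul, abs_of_pos (by positivity), abs_sub_comm]
  calc _ ≤ (scaleAt α κ s ^ d)⁻¹ * (C * ((t - s) / s) * gaussMix d η ((scaleAt α κ s)⁻¹ • x)) := by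
        gcongr
        refine (hM _ τ hτ).trans ?_
        gcongr
    _ = _ := by ring

lemma exists_abs_stableDensity_time_second_sub_le (h : IsSubordination d α κ η) :
    ∃ C : ℝ, 0 < C ∧ ∀ s t : ℝ, 0 < s → s ≤ t → t ≤ 2 * s → ∀ x z : Rd d, ‖z‖ ≤ M * s ^ (1 / α) →
      |stableDensity d α t (x + z) - stableDensity d α t x -
        (stableDensity d α s (x + z) - stableDensity d α s x)|
        ≤ C * (‖z‖ / s ^ (1 / α)) * ((t - s) / s) * stableDensity d α s x := by
  obtain ⟨C, hC, hM⟩ := h.exists_abs_gaussMix_scale_second_sub_le ((κ ^ (1 / α))⁻¹ * M)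
  have hκ : 0 < κ ^ (1 / α) := Real.rpow_pos_of_pos h.scale_pos _
  refine ⟨C * (κ ^ (1 / α))⁻¹, by positivity, fun s t hs hst hts x z hz => ?_⟩
  obtain ⟨τ, hτ, hτ1, he⟩ := h.exists_scale_ratio hs hst hts
  have hσs := scaleAt_pos (α := α) h.scale_pos hs
  have h0 := h.gaussMix_nonneg ((scaleAt α κ s)⁻¹ • x)
  have := hM ((scaleAt α κ s)⁻¹ • x) _ (h.norm_inv_scaleAt_smul_le M hs hz) τ hτ
  rw [h.norm_inv_scaleAt_smul hs] at this
  simp only [he, h.stableDensity_eq hs, smul_add, ← mul_sub]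
  simp only [smul_add, ← mul_sub] at this
  rw [abs_mul, abs_of_pos (by positivity), abs_sub_comm]
  calc _ ≤ (scaleAt α κ s ^ d)⁻¹ * (C * ((κ ^ (1 / α))⁻¹ * (‖z‖ / s ^ (1 / α))) * ((t - s) / s) *
        gaussMix d η ((scaleAt α κ s)⁻¹ • x)) := by
        gcongr
        refine this.trans ?_
        gcongr
    _ = _ := by ring

end IsSubordination

end Regularity

section Hoelder

variable {d : ℕ} {α κ : ℝ} {η : Measure ℝ}

lemma le_rpow_of_le_one {r β : ℝ} (h0 : 0 ≤ r) (h1 : r ≤ 1) (hβ0 : 0 < β) (hβ1 : β ≤ 1) :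
    r ≤ r ^ β := by
  rcases h0.eq_or_lt with rfl | h0
  · rw [Real.zero_rpow hβ0.ne']
  · nth_rewrite 1 [← Real.rpow_one r]
    exact Real.rpow_le_rpow_of_exponent_ge h0 h1 hβ1

lemma abs_sub_le_add_of_nonneg {a b : ℝ} (ha : 0 ≤ a) (hb : 0 ≤ b) : |a - b| ≤ b + a := by
  rw [abs_le]; constructor <;> linarith

namespace IsSubordination

variable {β : ℝ} (M : ℝ)

/-- Hölder continuity of the stable density in space: the Lipschitz bound for small increments, the
trivial bound for large ones. -/
lemma exists_stableDensity_space_hoelder (h : IsSubordination d α κ η) (hβ0 : 0 < β) (hβ1 : β ≤ 1) :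
    ∃ C : ℝ, 0 < C ∧ ∀ t : ℝ, 0 < t → ∀ x₁ x₂ : Rd d,
      |stableDensity d α t x₂ - stableDensity d α t x₁|
        ≤ C * (‖x₂ - x₁‖ / t ^ (1 / α)) ^ β * (stableDensity d α t x₁ + stableDensity d α t x₂) := by
  obtain ⟨C, hC, hM⟩ := h.exists_abs_stableDensity_sub_le 1
  refine ⟨C + 1, by positivity, fun t ht x₁ x₂ => ?_⟩
  have hl : 0 < t ^ (1 / α) := Real.rpow_pos_of_pos ht _
  have h1 := h.stableDensity_nonneg ht x₁
  have h2 := h.stableDensity_nonneg ht x₂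
  set r := ‖x₂ - x₁‖ / t ^ (1 / α) with hr
  have hr0 : 0 ≤ r := by positivity
  have hrβ : 0 ≤ r ^ β := by positivity
  rcases le_or_gt r 1 with hr1 | hr1
  · have := hM t ht x₁ (x₂ - x₁) (by rwa [hr, div_le_iff₀ hl] at hr1)
    rw [add_sub_cancel] at this
    calc _ ≤ C * r * stableDensity d α t x₁ := this
      _ ≤ (C + 1) * r ^ β * (stableDensity d α t x₁ + stableDensity d α t x₂) := by
        gcongr
        · linarith
        · exact le_rpow_of_le_one hr0 hr1 hβ0 hβ1
        · linarith
  · have : 1 ≤ r ^ β := Real.one_le_rpow hr1.le hβ0.le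
    have hp : 1 ≤ (C + 1) * r ^ β := by nlinarith
    calc _ ≤ 1 * (stableDensity d α t x₁ + stableDensity d α t x₂) := by
          rw [one_mul]; exact abs_sub_le_add_of_nonneg h2 h1
      _ ≤ _ := by gcongr

/-- Hölder continuity in space of the increments of the stable density. -/
lemma exists_stableDensity_increment_space_hoelder (h : IsSubordination d α κ η) (hβ0 : 0 < β)
    (hβ1 : β ≤ 1) :
    ∃ C : ℝ, 0 < C ∧ ∀ t : ℝ, 0 < t → ∀ x₁ x₂ z : Rd d, ‖z‖ ≤ M * t ^ (1 / α) →
      |stableDensity d α t (x₂ + z) - stableDensity d α t x₂ -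
        (stableDensity d α t (x₁ + z) - stableDensity d α t x₁)|
        ≤ C * (‖z‖ / t ^ (1 / α)) * (‖x₂ - x₁‖ / t ^ (1 / α)) ^ β *
          (stableDensity d α t x₁ + stableDensity d α t x₂) := by
  obtain ⟨C, hC, hM⟩ := h.exists_abs_stableDensity_sub_le M
  obtain ⟨C', hC', hM'⟩ := h.exists_abs_stableDensity_second_sub_le M
  refine ⟨C + C', by positivity, fun t ht x₁ x₂ z hz => ?_⟩
  have hl : 0 < t ^ (1 / α) := Real.rpow_pos_of_pos ht _
  have h1 := h.stableDensity_nonneg ht x₁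
  have h2 := h.stableDensity_nonneg ht x₂
  set q := ‖z‖ / t ^ (1 / α) with hq
  have hq0 : 0 ≤ q := by positivity
  set r := ‖x₂ - x₁‖ / t ^ (1 / α) with hr
  have hr0 : 0 ≤ r := by positivity
  have hrβ : 0 ≤ r ^ β := by positivity
  rcases le_or_gt r 1 with hr1 | hr1
  · have := hM' t ht x₁ (x₂ - x₁) z (by rwa [hr, div_le_iff₀ hl, one_mul] at hr1) hz
    rw [add_sub_cancel] at this
    calc _ ≤ C' * q * r * stableDensity d α t x₁ := this
      _ ≤ (C + C') * q * r ^ β * (stableDensity d α t x₁ + stableDensity d α t x₂) := by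
        gcongr
        · linarith
        · exact le_rpow_of_le_one hr0 hr1 hβ0 hβ1
        · linarith
  · have hrb : 1 ≤ r ^ β := Real.one_le_rpow hr1.le hβ0.le
    calc _ ≤ |stableDensity d α t (x₂ + z) - stableDensity d α t x₂| +
          |stableDensity d α t (x₁ + z) - stableDensity d α t x₁| := abs_sub _ _
      _ ≤ C * q * stableDensity d α t x₂ + C * q * stableDensity d α t x₁ :=
          add_le_add (hM t ht x₂ z hz) (hM t ht x₁ z hz)
      _ = C * q * 1 * (stableDensity d α t x₁ + stableDensity d α t x₂) := by ring
      _ ≤ (C + C') * q * r ^ β * (stableDensity d α t x₁ + stableDensity d α t x₂) := by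
        gcongr
        linarith

/-- Hölder continuity of the stable density in time. -/
lemma exists_stableDensity_time_hoelder (h : IsSubordination d α κ η) (hβ0 : 0 < β) (hβ1 : β ≤ 1) :
    ∃ C : ℝ, 0 < C ∧ ∀ s t : ℝ, 0 < s → s ≤ t → ∀ x : Rd d,
      |stableDensity d α t x - stableDensity d α s x|
        ≤ C * (((t - s) / s) ^ β * stableDensity d α s x +
          ((t - s) / t) ^ β * stableDensity d α t x) := by
  obtain ⟨C, hC, hM⟩ := h.exists_abs_stableDensity_time_sub_le
  refine ⟨C + 2, by positivity, fun s t hs hst x => ?_⟩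
  have ht : 0 < t := by linarith
  have h1 := h.stableDensity_nonneg hs x
  have h2 := h.stableDensity_nonneg ht x
  have hts : 0 ≤ t - s := by linarith
  set r := (t - s) / s with hr
  have hr0 : 0 ≤ r := by positivity
  have hq0 : 0 ≤ ((t - s) / t) ^ β := by positivity
  rcases le_or_gt r 1 with hr1 | hr1
  · calc _ ≤ C * r * stableDensity d α s x :=
          hM s t hs hst (by rw [hr, div_le_one hs] at hr1; linarith) x
      _ ≤ (C + 2) * r ^ β * stableDensity d α s x := by
          gcongr
          · linarith
          · exact le_rpow_of_le_one hr0 hr1 hβ0 hβ1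
      _ ≤ _ := by
          have := mul_nonneg hq0 h2
          nlinarith
  · have hrb : 1 ≤ r ^ β := Real.one_le_rpow hr1.le hβ0.le
    -- here `t > 2 s`: both prefactors are bounded below, and the trivial bound suffices
    have hqb : 2⁻¹ ≤ ((t - s) / t) ^ β := by
      have e : 2⁻¹ ≤ (t - s) / t := by
        rw [hr, one_lt_div hs] at hr1
        rw [inv_eq_one_div, div_le_div_iff₀ two_pos ht]
        linarith
      have e2 : (t - s) / t ≤ 1 := by rw [div_le_one ht]; linarith
      exact e.trans (le_rpow_of_le_one (by linarith) e2 hβ0 hβ1)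
    have m1 := mul_le_mul_of_nonneg_right hrb h1
    have m2 := mul_le_mul_of_nonneg_right hqb h2
    have m3 := abs_sub_le_add_of_nonneg h2 h1
    have m4 : 0 ≤ C * (r ^ β * stableDensity d α s x + ((t - s) / t) ^ β * stableDensity d α t x) := by
      positivity
    linarith

/-- Hölder continuity in time of the increments of the stable density. -/
lemma exists_stableDensity_increment_time_hoelder (h : IsSubordination d α κ η) (hβ0 : 0 < β)
    (hβ1 : β ≤ 1) :
    ∃ C : ℝ, 0 < C ∧ ∀ s t : ℝ, 0 < s → s ≤ t → ∀ x z : Rd d, ‖z‖ ≤ M * s ^ (1 / α) →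
      |stableDensity d α t (x + z) - stableDensity d α t x -
        (stableDensity d α s (x + z) - stableDensity d α s x)|
        ≤ C * (‖z‖ / s ^ (1 / α)) * ((t - s) / s) ^ β *
          (stableDensity d α s x + stableDensity d α t x) := by
  obtain ⟨C, hC, hM⟩ := h.exists_abs_stableDensity_sub_le M
  obtain ⟨C', hC', hM'⟩ := h.exists_abs_stableDensity_time_second_sub_le M
  refine ⟨C + C', by positivity, fun s t hs hst x z hz => ?_⟩
  have ht : 0 < t := by linarith
  have hl : 0 < s ^ (1 / α) := Real.rpow_pos_of_pos hs _
  have hll : s ^ (1 / α) ≤ t ^ (1 / α) :=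
    Real.rpow_le_rpow hs.le hst (by have := h.pos; positivity)
  have h1 := h.stableDensity_nonneg hs x
  have h2 := h.stableDensity_nonneg ht x
  have hts : 0 ≤ t - s := by linarith
  set q := ‖z‖ / s ^ (1 / α) with hq
  have hq0 : 0 ≤ q := by positivity
  set r := (t - s) / s with hr
  have hr0 : 0 ≤ r := by positivity
  rcases le_or_gt r 1 with hr1 | hr1
  · calc _ ≤ C' * q * r * stableDensity d α s x :=
          hM' s t hs hst (by rw [hr, div_le_one hs] at hr1; linarith) x z hz
      _ ≤ (C + C') * q * r ^ β * (stableDensity d α s x + stableDensity d α t x) := by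
        gcongr
        · linarith
        · exact le_rpow_of_le_one hr0 hr1 hβ0 hβ1
        · linarith
  · have hrb : 1 ≤ r ^ β := Real.one_le_rpow hr1.le hβ0.le
    have hM0 : 0 ≤ M := by
      by_contra hneg
      have := mul_neg_of_neg_of_pos (not_le.1 hneg) hl
      linarith [norm_nonneg z]
    have hzt : ‖z‖ ≤ M * t ^ (1 / α) := hz.trans (by gcongr)
    calc _ ≤ |stableDensity d α t (x + z) - stableDensity d α t x| +
          |stableDensity d α s (x + z) - stableDensity d α s x| := abs_sub _ _
      _ ≤ C * (‖z‖ / t ^ (1 / α)) * stableDensity d α t x + C * q * stableDensity d α s x :=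
          add_le_add (hM t ht x z hzt) (hM s hs x z hz)
      _ ≤ C * q * stableDensity d α t x + C * q * stableDensity d α s x := by
          rw [hq]; gcongr
      _ = C * q * 1 * (stableDensity d α s x + stableDensity d α t x) := by ring
      _ ≤ (C + C') * q * r ^ β * (stableDensity d α s x + stableDensity d α t x) := by
        gcongr
        linarith

end IsSubordination

end Hoelder

/-! ### Telescoping along a chain with bounded drift -/

section Chain

/-- The `k`-th term of a left-endpoint Riemann sum of `(t - s) ^ (-γ)` over the partition `c`. -/
def singularWeight (γ : ℝ) (c : ℕ → ℝ) (t : ℝ) (k : ℕ) : ℝ :=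
  (c (k + 1) - c k) * (t - c k) ^ (-γ)

lemma singularWeight_nonneg {γ t : ℝ} {c : ℕ → ℝ} (hc : Monotone c) (hct : ∀ k, c k ≤ t) (k : ℕ) :
    0 ≤ singularWeight γ c t k :=
  mul_nonneg (sub_nonneg.2 (hc k.le_succ)) (Real.rpow_nonneg (sub_nonneg.2 (hct k)) _)

/-- The Riemann sum is at most the integral of `(t - s) ^ (-γ)`, since the left endpoint is the
smallest value on each interval. -/
lemma sum_singularWeight_le {γ t : ℝ} {c : ℕ → ℝ} (hγ0 : 0 < γ) (hγ1 : γ < 1) (hc : Monotone c)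
    (hct : ∀ k, c k ≤ t) (n : ℕ) :
    ∑ k ∈ Finset.range n, singularWeight γ c t k ≤ (t - c 0) ^ (1 - γ) / (1 - γ) := by
  have hγ : 0 < 1 - γ := by linarith
  have key : ∀ k, singularWeight γ c t k ≤
      (t - c k) ^ (1 - γ) / (1 - γ) - (t - c (k + 1)) ^ (1 - γ) / (1 - γ) := by
    intro k
    have h1 : 0 ≤ t - c (k + 1) := sub_nonneg.2 (hct _)
    have h2 : t - c (k + 1) ≤ t - c k := sub_le_sub_left (hc k.le_succ) t
    unfold singularWeight
    rw [show c (k + 1) - c k = (t - c k) - (t - c (k + 1)) by ring]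
    generalize t - c (k + 1) = s' at h1 h2
    generalize t - c k = s at h2
    rcases (h1.trans h2).eq_or_lt with rfl | hs
    · have : s' = 0 := le_antisymm h2 h1
      simp [this]
    · -- concavity of `r ↦ r ^ (1 - γ)`
      have hb := rpow_one_add_le_one_add_mul_self (s := s' / s - 1)
        (by have : 0 ≤ s' / s := by positivity
            linarith) hγ.le (by linarith : 1 - γ ≤ 1)
      rw [add_sub_cancel, Real.div_rpow h1 hs.le, div_le_iff₀ (by positivity)] at hb
      rw [← sub_div, le_div_iff₀ hγ]
      have e : s ^ (1 - γ) = s * s ^ (-γ) := by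
        rw [sub_eq_add_neg, Real.rpow_add hs, Real.rpow_one]
      rw [e] at hb ⊢
      have : (1 + (1 - γ) * (s' / s - 1)) * (s * s ^ (-γ))
          = s * s ^ (-γ) + (1 - γ) * (s' - s) * s ^ (-γ) := by
        field_simp
      rw [this] at hb
      linarith
  calc _ ≤ ∑ k ∈ Finset.range n,
        ((t - c k) ^ (1 - γ) / (1 - γ) - (t - c (k + 1)) ^ (1 - γ) / (1 - γ)) :=
        Finset.sum_le_sum fun k _ => key k
    _ = (t - c 0) ^ (1 - γ) / (1 - γ) - (t - c n) ^ (1 - γ) / (1 - γ) :=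
        Finset.sum_range_sub' (fun k => (t - c k) ^ (1 - γ) / (1 - γ)) n
    _ ≤ _ := by
        have : 0 ≤ (t - c n) ^ (1 - γ) / (1 - γ) :=
          div_nonneg (Real.rpow_nonneg (sub_nonneg.2 (hct n)) _) hγ.le
        linarith

variable {d : ℕ} {α κ : ℝ} {η : Measure ℝ}

/-- The laws `μ k` at the times `τ k` of a chain which moves on `[τ k, τ (k+1)]` by a stable
increment and a drift of speed at most `B`; `D k t x` is the drift accumulated from `τ k` to
`min (τ (k+1)) t` when the chain is at `x` at time `τ k`. The transition enters only through `step`,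
its effect on averages of the stable density. -/
structure IsDriftChain (α B : ℝ) (N : ℕ) (τ : ℕ → ℝ) (μ : ℕ → Measure (Rd d))
    (D : ℕ → ℝ → Rd d → Rd d) : Prop where
  monotone : Monotone τ
  zero : τ 0 = 0
  isProbabilityMeasure : ∀ k ≤ N, IsProbabilityMeasure (μ k)
  measurable : ∀ k t, Measurable (D k t)
  norm_drift_le : ∀ k t x, τ k ≤ t → ‖D k t x‖ ≤ B * (min (τ (k + 1)) t - τ k)
  norm_drift_sub_le : ∀ k s t x, τ k ≤ s → s ≤ t →
    ‖D k t x - D k s x‖ ≤ B * (min (τ (k + 1)) t - min (τ (k + 1)) s)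
  step : ∀ k < N, ∀ s : ℝ, 0 < s → ∀ y, stableAverage α (μ (k + 1)) s y =
    ∫ x, stableDensity d α (s + (τ (k + 1) - τ k)) (x + D k (τ (k + 1)) x - y) ∂(μ k)

/-- The contribution of the drift on `[τ k, τ (k+1)]` to the density at time `t`, which vanishes
for `t ≤ τ k`. -/
def driftTerm (α : ℝ) (τ : ℕ → ℝ) (μ : ℕ → Measure (Rd d)) (D : ℕ → ℝ → Rd d → Rd d) (k : ℕ)
    (t : ℝ) (y : Rd d) : ℝ :=
  if τ k < t then
    ∫ x, (stableDensity d α (t - τ k) (x + D k t x - y) - stableDensity d α (t - τ k) (x - y)) ∂(μ k)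
  else 0

/-- The density at time `t` of the chain: the density without drift, plus all drift terms. -/
def chainDensity (α : ℝ) (N : ℕ) (τ : ℕ → ℝ) (μ : ℕ → Measure (Rd d)) (D : ℕ → ℝ → Rd d → Rd d)
    (t : ℝ) (y : Rd d) : ℝ :=
  stableAverage α (μ 0) t y + ∑ k ∈ Finset.range N, driftTerm α τ μ D k t y

lemma abs_integral_le_mul_integral {Ω : Type*} [MeasurableSpace Ω] {μ : Measure Ω} {f g : Ω → ℝ}
    {A : ℝ} (hg : Integrable g μ) (h : ∀ x, |f x| ≤ A * g x) : |∫ x, f x ∂μ| ≤ A * ∫ x, g x ∂μ := by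
  rw [← Real.norm_eq_abs, ← integral_const_mul]
  exact norm_integral_le_of_norm_le (hg.const_mul A) (ae_of_all _ h)

namespace IsDriftChain

variable {B T : ℝ} {N : ℕ} {τ : ℕ → ℝ} {μ : ℕ → Measure (Rd d)} {D : ℕ → ℝ → Rd d → Rd d}

lemma nonneg (hc : IsDriftChain α B N τ μ D) (k : ℕ) : 0 ≤ τ k := by
  rw [← hc.zero]
  exact hc.monotone k.zero_le

lemma monotone_min (hc : IsDriftChain α B N τ μ D) (t : ℝ) : Monotone fun k => min (τ k) t :=
  fun _ _ hij => min_le_min_right t (hc.monotone hij)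

lemma weight_nonneg (hc : IsDriftChain α B N τ μ D) (γ t : ℝ) (k : ℕ) :
    0 ≤ singularWeight γ (fun k => min (τ k) t) t k :=
  singularWeight_nonneg (hc.monotone_min t) (fun _ => min_le_right _ _) k

lemma weight_eq {γ t : ℝ} {k : ℕ} (hk : τ k < t) :
    singularWeight γ (fun k => min (τ k) t) t k
      = (min (τ (k + 1)) t - τ k) * (t - τ k) ^ (-γ) := by
  rw [singularWeight, min_eq_left hk.le]

lemma sum_weight_le (hc : IsDriftChain α B N τ μ D) {γ t : ℝ} (hγ0 : 0 < γ) (hγ1 : γ < 1)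
    (ht : 0 ≤ t) (n : ℕ) :
    ∑ k ∈ Finset.range n, singularWeight γ (fun k => min (τ k) t) t k ≤ t ^ (1 - γ) / (1 - γ) := by
  have := sum_singularWeight_le hγ0 hγ1 (hc.monotone_min t) (fun _ => min_le_right _ _) n (t := t)
  rwa [hc.zero, min_eq_left ht, sub_zero] at this

lemma drift_eq (hc : IsDriftChain α B N τ μ D) {k : ℕ} {t : ℝ} (ht : τ (k + 1) ≤ t) (x : Rd d) :
    D k t x = D k (τ (k + 1)) x := by
  have := hc.norm_drift_sub_le k (τ (k + 1)) t x (hc.monotone k.le_succ) ht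
  rw [min_eq_left ht, min_self, sub_self, mul_zero] at this
  exact sub_eq_zero.1 (norm_le_zero_iff.1 this)

lemma integrable_density (hc : IsDriftChain α B N τ μ D) (h : IsSubordination d α κ η) {k : ℕ}
    (hk : k ≤ N) {s : ℝ} (hs : 0 < s) (t : ℝ) (y : Rd d) :
    Integrable (fun x => stableDensity d α s (x + D k t x - y)) (μ k) := by
  have := hc.isProbabilityMeasure k hk
  have := hc.measurable k t
  exact h.integrable_stableDensity_of_isFiniteMeasure hs _ (by fun_prop)

lemma integrable_density' (hc : IsDriftChain α B N τ μ D) (h : IsSubordination d α κ η) {k : ℕ}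
    (hk : k ≤ N) {s : ℝ} (hs : 0 < s) (y : Rd d) :
    Integrable (fun x => stableDensity d α s (x - y)) (μ k) := by
  have := hc.isProbabilityMeasure k hk
  exact h.integrable_stableDensity_of_isFiniteMeasure hs _ (by fun_prop)

/-- The drift term of index `k` switches on the drift after time `τ k`. -/
lemma average_add_driftTerm (hc : IsDriftChain α B N τ μ D) (h : IsSubordination d α κ η) {k : ℕ}
    (hk : k ≤ N) {t : ℝ} (ht : τ k < t) (y : Rd d) :
    stableAverage α (μ k) (t - τ k) y + driftTerm α τ μ D k t y
      = ∫ x, stableDensity d α (t - τ k) (x + D k t x - y) ∂(μ k) := by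
  have hs : 0 < t - τ k := sub_pos.2 ht
  rw [driftTerm, if_pos ht, integral_sub (hc.integrable_density h hk hs t y)
    (hc.integrable_density' h hk hs y), stableAverage, add_sub_cancel]

/-- Telescoping: each passage from `τ k` to `τ (k+1)` adds the drift term of index `k`. -/
lemma average_eq (hc : IsDriftChain α B N τ μ D) (h : IsSubordination d α κ η) {n : ℕ}
    (hn : n ≤ N) {t : ℝ} (ht : τ n < t) (y : Rd d) :
    stableAverage α (μ n) (t - τ n) y
      = stableAverage α (μ 0) t y + ∑ k ∈ Finset.range n, driftTerm α τ μ D k t y := by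
  induction n with
  | zero => simp [hc.zero]
  | succ n ih =>
    have ht' : τ n < t := (hc.monotone n.le_succ).trans_lt ht
    rw [Finset.sum_range_succ, ← add_assoc, ← ih (by omega) ht',
      hc.average_add_driftTerm h (by omega) ht', hc.step n (by omega) _ (sub_pos.2 ht)]
    simp_rw [hc.drift_eq ht.le]
    rw [sub_add_sub_cancel]

/-- The sum over all `k < N` stops by itself at the step containing `t`, since later drift terms
vanish. -/
lemma chainDensity_eq (hc : IsDriftChain α B N τ μ D) (h : IsSubordination d α κ η) {n : ℕ}
    (hn : n < N) {t : ℝ} (ht : τ n < t) (ht' : t ≤ τ (n + 1)) (y : Rd d) :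
    chainDensity α N τ μ D t y = stableAverage α ((μ n).map fun x => x + D n t x) (t - τ n) y := by
  have hm := hc.measurable n t
  have hp : Continuous fun x => stableDensity d α (t - τ n) (x - y) :=
    (h.continuous_stableDensity (sub_pos.2 ht)).comp (by fun_prop)
  rw [stableAverage, integral_map (by fun_prop) hp.aestronglyMeasurable,
    ← hc.average_add_driftTerm h hn.le ht, hc.average_eq h hn.le ht, add_assoc,
    ← Finset.sum_range_succ, chainDensity]
  congr 1
  refine (Finset.sum_subset (Finset.range_mono hn) fun k _ hk => ?_).symm
  rw [Finset.mem_range, not_lt] at hk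
  rw [driftTerm, if_neg (not_lt.2 (ht'.trans (hc.monotone hk)))]

lemma mul_le_mul_rpow (h1 : 1 < α) (hB : 0 ≤ B) {s : ℝ} (hs : 0 < s) (hsT : s ≤ T) :
    B * s ≤ B * T ^ (1 - 1 / α) * s ^ (1 / α) := by
  have hα : 1 / α < 1 := by rw [div_lt_one (by linarith)]; exact h1
  have e : s = s ^ (1 - 1 / α) * s ^ (1 / α) := by
    rw [← Real.rpow_add hs, sub_add_cancel, Real.rpow_one]
  calc B * s = B * (s ^ (1 - 1 / α) * s ^ (1 / α)) := by rw [← e]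
    _ ≤ B * (T ^ (1 - 1 / α) * s ^ (1 / α)) := by gcongr
    _ = _ := by ring

/-- The drift accumulated up to time `t` is of at most the order of the stable scale. -/
lemma norm_drift_le_scale (hc : IsDriftChain α B N τ μ D) (h1 : 1 < α) (hB : 0 ≤ B) {k : ℕ}
    {s t : ℝ} (hs : τ k < s) (hst : s ≤ t) (htT : t ≤ T) (x : Rd d) :
    ‖D k s x‖ ≤ B * T ^ (1 - 1 / α) * (t - τ k) ^ (1 / α) := by
  have hk := hc.nonneg k
  refine (hc.norm_drift_le k s x hs.le).trans ?_
  refine le_trans ?_ (mul_le_mul_rpow h1 hB (by linarith : 0 < t - τ k) (by linarith : t - τ k ≤ T))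
  gcongr
  exact (min_le_right _ _).trans hst

lemma norm_drift_div_le (hc : IsDriftChain α B N τ μ D) {k : ℕ} {t : ℝ} (ht : τ k < t)
    (γ : ℝ) (x : Rd d) :
    ‖D k t x‖ / (t - τ k) ^ γ ≤ B * singularWeight γ (fun k => min (τ k) t) t k := by
  have hs : 0 < t - τ k := sub_pos.2 ht
  rw [weight_eq ht, Real.rpow_neg hs.le, ← mul_assoc, ← div_eq_mul_inv]
  gcongr
  exact hc.norm_drift_le k t x ht.le

end IsDriftChain

/-! ### Estimates for the drift terms -/

namespace IsSubordination

variable {B T : ℝ}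

lemma one_div_lt_one (h : IsSubordination d α κ η) : 1 / α < 1 := by
  rw [div_lt_one h.pos]; exact h.one_lt

lemma exists_abs_driftTerm_le_average (h : IsSubordination d α κ η) (hB : 0 ≤ B) (T : ℝ) :
    ∃ C : ℝ, 0 < C ∧ ∀ (N : ℕ) (τ : ℕ → ℝ) (μ : ℕ → Measure (Rd d)) (D : ℕ → ℝ → Rd d → Rd d),
      IsDriftChain α B N τ μ D → ∀ k ≤ N, ∀ t ≤ T, τ k < t → ∀ y : Rd d,
      |driftTerm α τ μ D k t y| ≤ C * B * singularWeight (1 / α) (fun k => min (τ k) t) t k *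
        stableAverage α (μ k) (t - τ k) y := by
  obtain ⟨C, hC, hM⟩ := h.exists_abs_stableDensity_sub_le (B * T ^ (1 - 1 / α))
  refine ⟨C, hC, fun N τ μ D hc k hk t htT ht y => ?_⟩
  have hs : 0 < t - τ k := sub_pos.2 ht
  rw [driftTerm, if_pos ht]
  refine abs_integral_le_mul_integral (hc.integrable_density' h hk hs y) fun x => ?_
  have := hM (t - τ k) hs (x - y) (D k t x)
    (hc.norm_drift_le_scale h.one_lt hB ht le_rfl htT x)
  rw [sub_add_eq_add_sub] at this
  refine this.trans ?_
  have h0 := h.stableDensity_nonneg hs (x - y)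
  rw [mul_assoc C B]
  gcongr
  exact hc.norm_drift_div_le ht _ x

/-- A discrete Grönwall argument at fixed `(t, y)`: the density at time `t`, as seen from the
law of the chain at time `τ k` without further drift, stays comparable to the driftless density. -/
lemma exists_average_le (h : IsSubordination d α κ η) (hB : 0 ≤ B) (T : ℝ) :
    ∃ K : ℝ, 0 < K ∧ ∀ (N : ℕ) (τ : ℕ → ℝ) (μ : ℕ → Measure (Rd d)) (D : ℕ → ℝ → Rd d → Rd d),
      IsDriftChain α B N τ μ D → ∀ k ≤ N, ∀ t ≤ T, τ k < t → ∀ y : Rd d,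
      stableAverage α (μ k) (t - τ k) y ≤ K * stableAverage α (μ 0) t y := by
  obtain ⟨C, hC, hM⟩ := h.exists_abs_driftTerm_le_average hB T
  have hα := h.one_div_lt_one
  have hα0 : 0 < 1 / α := by have := h.pos; positivity
  refine ⟨Real.exp (C * B * (T ^ (1 - 1 / α) / (1 - 1 / α))), Real.exp_pos _,
    fun N τ μ D hc n hn t htT ht y => ?_⟩
  have ht0 : 0 < t := (hc.nonneg n).trans_lt ht
  have hE0 := h.stableAverage_nonneg ht0 (μ 0) y
  have key : stableAverage α (μ n) (t - τ n) y ≤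
      Real.exp (C * B * ∑ k ∈ Finset.range n,
        singularWeight (1 / α) (fun k => min (τ k) t) t k) * stableAverage α (μ 0) t y := by
    induction n with
    | zero => simp [hc.zero]
    | succ n ih =>
      have ht' : τ n < t := (hc.monotone n.le_succ).trans_lt ht
      have hw := hc.weight_nonneg (1 / α) t n
      have hEn := h.stableAverage_nonneg (sub_pos.2 ht') (μ n) y
      have h1 : stableAverage α (μ (n + 1)) (t - τ (n + 1)) y
          = stableAverage α (μ n) (t - τ n) y + driftTerm α τ μ D n t y := by
        rw [hc.average_eq h hn ht, hc.average_eq h (by omega) ht', Finset.sum_range_succ, add_assoc]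
      set w := singularWeight (1 / α) (fun k => min (τ k) t) t n with hwdef
      have h2 := (le_abs_self _).trans (hM N τ μ D hc n (by omega) t htT ht' y)
      have h3 := Real.add_one_le_exp (C * B * w)
      rw [h1, Finset.sum_range_succ, mul_add, Real.exp_add]
      calc _ ≤ (C * B * w + 1) * stableAverage α (μ n) (t - τ n) y := by linarith
        _ ≤ Real.exp (C * B * w) * (Real.exp (C * B * ∑ k ∈ Finset.range n,
            singularWeight (1 / α) (fun k => min (τ k) t) t k) * stableAverage α (μ 0) t y) := by
            gcongr
            exact ih (by omega) ht'
        _ = _ := by ring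
  refine key.trans ?_
  gcongr
  refine (hc.sum_weight_le hα0 hα ht0.le n).trans ?_
  have : 0 < 1 - 1 / α := by linarith
  gcongr

lemma exists_abs_driftTerm_le (h : IsSubordination d α κ η) (hB : 0 ≤ B) (T : ℝ) :
    ∃ C : ℝ, 0 < C ∧ ∀ (N : ℕ) (τ : ℕ → ℝ) (μ : ℕ → Measure (Rd d)) (D : ℕ → ℝ → Rd d → Rd d),
      IsDriftChain α B N τ μ D → ∀ k ≤ N, ∀ t ≤ T, 0 < t → ∀ y : Rd d,
      |driftTerm α τ μ D k t y| ≤ C * singularWeight (1 / α) (fun k => min (τ k) t) t k *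
        stableAverage α (μ 0) t y := by
  obtain ⟨C, hC, hM⟩ := h.exists_abs_driftTerm_le_average hB T
  obtain ⟨K, hK, hE⟩ := h.exists_average_le hB T
  refine ⟨C * (B + 1) * K, by positivity, fun N τ μ D hc k hk t htT ht0 y => ?_⟩
  have hw := hc.weight_nonneg (1 / α) t k
  have hE0 := h.stableAverage_nonneg ht0 (μ 0) y
  by_cases ht : τ k < t
  · calc _ ≤ _ := hM N τ μ D hc k hk t htT ht y
      _ ≤ C * (B + 1) * singularWeight (1 / α) (fun k => min (τ k) t) t k *
          (K * stableAverage α (μ 0) t y) := by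
          gcongr
          · exact h.stableAverage_nonneg (sub_pos.2 ht) _ _
          · linarith
          · exact hE N τ μ D hc k hk t htT ht y
      _ = _ := by ring
  · rw [driftTerm, if_neg ht, abs_zero]
    positivity

variable {β : ℝ}

/-- The difference in `y` of a drift term is a second difference of the stable density, which costs
an additional factor `(t - τ k) ^ (-β / α)`. -/
lemma exists_abs_driftTerm_space_sub_le (h : IsSubordination d α κ η) (hB : 0 ≤ B) (T : ℝ)
    (hβ0 : 0 < β) (hβ1 : β ≤ 1) :
    ∃ C : ℝ, 0 < C ∧ ∀ (N : ℕ) (τ : ℕ → ℝ) (μ : ℕ → Measure (Rd d)) (D : ℕ → ℝ → Rd d → Rd d),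
      IsDriftChain α B N τ μ D → ∀ k ≤ N, ∀ t ≤ T, 0 < t → ∀ y₁ y₂ : Rd d,
      |driftTerm α τ μ D k t y₂ - driftTerm α τ μ D k t y₁| ≤
        C * singularWeight ((1 + β) / α) (fun k => min (τ k) t) t k * ‖y₂ - y₁‖ ^ β *
        (stableAverage α (μ 0) t y₁ + stableAverage α (μ 0) t y₂) := by
  obtain ⟨C, hC, hM⟩ :=
    h.exists_stableDensity_increment_space_hoelder (B * T ^ (1 - 1 / α)) hβ0 hβ1
  obtain ⟨K, hK, hE⟩ := h.exists_average_le hB T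
  refine ⟨C * (B + 1) * K, by positivity, fun N τ μ D hc k hk t htT ht0 y₁ y₂ => ?_⟩
  have hw := hc.weight_nonneg ((1 + β) / α) t k
  have hE1 := h.stableAverage_nonneg ht0 (μ 0) y₁
  have hE2 := h.stableAverage_nonneg ht0 (μ 0) y₂
  by_cases ht : τ k < t
  · have hs : 0 < t - τ k := sub_pos.2 ht
    have i1 := hc.integrable_density' h hk hs y₁
    have i2 := hc.integrable_density' h hk hs y₂
    have j1 := hc.integrable_density h hk hs t y₁
    have j2 := hc.integrable_density h hk hs t y₂
    have e : (t - τ k) ^ ((1 + β) / α) = (t - τ k) ^ (1 / α) * ((t - τ k) ^ (1 / α)) ^ β := by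
      rw [← Real.rpow_mul hs.le, ← Real.rpow_add hs]
      congr 1
      ring
    have hs1 : 0 < (t - τ k) ^ (1 / α) := Real.rpow_pos_of_pos hs _
    have hs2 : 0 < ((t - τ k) ^ (1 / α)) ^ β := Real.rpow_pos_of_pos hs1 _
    rw [driftTerm, driftTerm, if_pos ht, if_pos ht,
      ← integral_sub (by exact j2.sub i2) (by exact j1.sub i1)]
    calc _ ≤ C * (B * singularWeight ((1 + β) / α) (fun k => min (τ k) t) t k) * ‖y₂ - y₁‖ ^ β *
          ∫ x, (stableDensity d α (t - τ k) (x - y₁) + stableDensity d α (t - τ k) (x - y₂)) ∂(μ k) := by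
          refine abs_integral_le_mul_integral (by exact i1.add i2) fun x => ?_
          have hx := hM (t - τ k) hs (x - y₁) (x - y₂) (D k t x)
            (hc.norm_drift_le_scale h.one_lt hB ht le_rfl htT x)
          rw [sub_add_eq_add_sub, sub_add_eq_add_sub, show x - y₂ - (x - y₁) = -(y₂ - y₁) by abel,
            norm_neg, Real.div_rpow (norm_nonneg _) hs1.le] at hx
          refine hx.trans ?_
          have h0 := h.stableDensity_nonneg hs (x - y₁)
          have h0' := h.stableDensity_nonneg hs (x - y₂)
          have hd := hc.norm_drift_div_le ht ((1 + β) / α) x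
          rw [e] at hd
          calc _ = C * (‖D k t x‖ / ((t - τ k) ^ (1 / α) * ((t - τ k) ^ (1 / α)) ^ β)) *
                ‖y₂ - y₁‖ ^ β * (stableDensity d α (t - τ k) (x - y₁) +
                stableDensity d α (t - τ k) (x - y₂)) := by
                field_simp
            _ ≤ _ := by gcongr
      _ ≤ C * ((B + 1) * singularWeight ((1 + β) / α) (fun k => min (τ k) t) t k) * ‖y₂ - y₁‖ ^ β *
          (K * stableAverage α (μ 0) t y₁ + K * stableAverage α (μ 0) t y₂) := by
          rw [integral_add i1 i2]
          have a1 := hE N τ μ D hc k hk t htT ht y₁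
          have a2 := hE N τ μ D hc k hk t htT ht y₂
          have a3 := h.stableAverage_nonneg hs (μ k) y₁
          have a4 := h.stableAverage_nonneg hs (μ k) y₂
          unfold stableAverage at a1 a2 a3 a4 ⊢
          gcongr
          linarith
      _ = _ := by ring
  · rw [driftTerm, driftTerm, if_neg ht, if_neg ht, sub_zero, abs_zero]
    positivity

end IsSubordination

end Chain

section ChainEstimates

variable {d : ℕ} {α κ : ℝ} {η : Measure ℝ} {B β : ℝ}

namespace IsSubordination

/-- The difference in time of a drift term. The first part is the second difference caused by the
drift accumulated up to `s`; the second part is the first difference caused by the drift accumulated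
between `s` and `t`, and its weight belongs to the partition restricted to `[s, t]`. -/
lemma exists_abs_driftTerm_time_sub_le (h : IsSubordination d α κ η) (hB : 0 ≤ B) (T : ℝ)
    (hβ0 : 0 < β) (hβ1 : β ≤ 1) :
    ∃ C : ℝ, 0 < C ∧ ∀ (N : ℕ) (τ : ℕ → ℝ) (μ : ℕ → Measure (Rd d)) (D : ℕ → ℝ → Rd d → Rd d),
      IsDriftChain α B N τ μ D → ∀ k ≤ N, ∀ s t : ℝ, 0 < s → s < t → t ≤ T → ∀ y : Rd d,
      |driftTerm α τ μ D k t y - driftTerm α τ μ D k s y| ≤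
        C * (singularWeight ((1 + β) / α) (fun k => min (τ k) s) s k * (t - s) ^ (β / α) *
          (stableAverage α (μ 0) s y + stableAverage α (μ 0) t y) +
        singularWeight (1 / α) (fun k => min (max (τ k) s) t) t k * stableAverage α (μ 0) t y) := by
  have hα := h.one_lt
  have hα0 := h.pos
  obtain ⟨C₀, hC₀, hM₀⟩ := h.exists_abs_driftTerm_le hB T
  obtain ⟨C₁, hC₁, hM₁⟩ := h.exists_abs_stableDensity_sub_le (B * T ^ (1 - 1 / α))
  obtain ⟨C₂, hC₂, hM₂⟩ := h.exists_stableDensity_increment_time_hoelder (β := β / α)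
    (B * T ^ (1 - 1 / α)) (by positivity) (by rw [div_le_one hα0]; linarith)
  obtain ⟨K, hK, hE⟩ := h.exists_average_le hB T
  set A : ℝ := 1 + C₁ * |B * T ^ (1 - 1 / α)| with hA
  have hA0 : 0 < A := by positivity
  refine ⟨C₀ + C₁ * (B + 1) * A * K + C₂ * (B + 1) * K, by positivity,
    fun N τ μ D hc k hk s t hs0 hst htT y => ?_⟩
  have ht0 : 0 < t := hs0.trans hst
  have hcm : Monotone fun k => min (max (τ k) s) t :=
    fun i j hij => min_le_min_right t (max_le_max_right s (hc.monotone hij))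
  set v := singularWeight ((1 + β) / α) (fun k => min (τ k) s) s k with hv
  have hv0 : 0 ≤ v := hc.weight_nonneg ((1 + β) / α) s k
  set w := singularWeight (1 / α) (fun k => min (max (τ k) s) t) t k with hw
  have hw0 : 0 ≤ w := singularWeight_nonneg hcm (fun _ => min_le_right _ _) k
  have hE1 := h.stableAverage_nonneg hs0 (μ 0) y
  have hE2 := h.stableAverage_nonneg ht0 (μ 0) y
  have hts : 0 < t - s := sub_pos.2 hst
  have hmono := hc.monotone k.le_succ
  rcases le_or_gt s (τ k) with hks | hks
  · -- only the later time sees this drift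
    rw [show driftTerm α τ μ D k s y = 0 by rw [driftTerm, if_neg (not_lt.2 hks)], sub_zero]
    have e : singularWeight (1 / α) (fun k => min (τ k) t) t k = w := by
      rw [hw, singularWeight, singularWeight, max_eq_left hks, max_eq_left (hks.trans hmono)]
    have := hM₀ N τ μ D hc k hk t htT ht0 y
    rw [e] at this
    refine this.trans ?_
    have p1 : 0 ≤ v * (t - s) ^ (β / α) * (stableAverage α (μ 0) s y + stableAverage α (μ 0) t y) := by
      positivity
    calc _ = C₀ * (w * stableAverage α (μ 0) t y) := by ring
      _ ≤ _ := by
          gcongr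
          · have : 0 ≤ C₁ * (B + 1) * A * K + C₂ * (B + 1) * K := by positivity
            linarith
          · linarith
  · have hkt : τ k < t := hks.trans hst
    have hs : 0 < s - τ k := sub_pos.2 hks
    have ht : 0 < t - τ k := sub_pos.2 hkt
    have hτ0 := hc.nonneg k
    have i1 := hc.integrable_density' h hk hs y
    have i2 := hc.integrable_density' h hk ht y
    have j1 := hc.integrable_density h hk hs s y
    have j2 := hc.integrable_density h hk ht t y
    have hl : 0 < (s - τ k) ^ (1 / α) := Real.rpow_pos_of_pos hs _
    have hlt : 0 < (t - τ k) ^ (1 / α) := Real.rpow_pos_of_pos ht _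
    -- the drift accumulated between the two times is weighted by the distance `t - s`, which is
    -- smaller than `t - τ k`
    have hdiff : ∀ x, ‖D k t x - D k s x‖ / (t - τ k) ^ (1 / α) ≤ B * w := by
      intro x
      have e1 : w = (min (τ (k + 1)) t - min (τ (k + 1)) s) * (t - s) ^ (-(1 / α)) := by
        rw [hw, singularWeight, max_eq_right hks.le, min_eq_left hst.le]
        congr 1
        rcases le_total (τ (k + 1)) s with hle | hle
        · rw [max_eq_right hle, min_eq_left hst.le, min_eq_left hle, min_eq_left (hle.trans hst.le)]
          ring
        · rw [max_eq_left hle, min_eq_right hle]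
      have hd0 : 0 ≤ min (τ (k + 1)) t - min (τ (k + 1)) s :=
        sub_nonneg.2 (min_le_min_left _ hst.le)
      rw [e1, Real.rpow_neg hts.le, ← mul_assoc, ← div_eq_mul_inv]
      have := hc.norm_drift_sub_le k s t x hks.le hst.le
      have hpow : (t - s) ^ (1 / α) ≤ (t - τ k) ^ (1 / α) := by gcongr
      gcongr
    have hdiffM : ∀ x, ‖D k t x - D k s x‖ ≤ B * T ^ (1 - 1 / α) * (t - τ k) ^ (1 / α) := by
      intro x
      refine (hc.norm_drift_sub_le k s t x hks.le hst.le).trans ?_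
      refine le_trans ?_ (IsDriftChain.mul_le_mul_rpow hα hB ht (by linarith : t - τ k ≤ T))
      have : τ k ≤ min (τ (k + 1)) s := le_min hmono hks.le
      have := min_le_right (τ (k + 1)) t
      gcongr
    have e : (s - τ k) ^ ((1 + β) / α) = (s - τ k) ^ (1 / α) * (s - τ k) ^ (β / α) := by
      rw [← Real.rpow_add hs]
      congr 1
      ring
    have pointwise : ∀ x, |stableDensity d α (t - τ k) (x + D k t x - y) -
        stableDensity d α (t - τ k) (x - y) - (stableDensity d α (s - τ k) (x + D k s x - y) -
        stableDensity d α (s - τ k) (x - y))| ≤ 1 *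
        (C₂ * (B * v) * (t - s) ^ (β / α) * stableDensity d α (s - τ k) (x - y) +
        (C₂ * (B * v) * (t - s) ^ (β / α) + C₁ * (B * w) * A) *
          stableDensity d α (t - τ k) (x - y)) := by
      intro x
      have q1 := h.stableDensity_nonneg hs (x - y)
      have q2 := h.stableDensity_nonneg ht (x - y)
      have b1 : |stableDensity d α (t - τ k) (x + D k t x - y) -
          stableDensity d α (t - τ k) (x + D k s x - y)|
          ≤ C₁ * (B * w) * (A * stableDensity d α (t - τ k) (x - y)) := by
        have := hM₁ (t - τ k) ht (x + D k s x - y) (D k t x - D k s x) (hdiffM x)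
        rw [show x + D k s x - y + (D k t x - D k s x) = x + D k t x - y by abel] at this
        refine this.trans ?_
        have q3 := h.stableDensity_nonneg ht (x + D k s x - y)
        -- the density at the displaced point is comparable to the density at the original one
        have hx : stableDensity d α (t - τ k) (x + D k s x - y)
            ≤ A * stableDensity d α (t - τ k) (x - y) := by
          have hz := hc.norm_drift_le_scale hα hB hks hst.le htT x
          have := hM₁ (t - τ k) ht (x - y) (D k s x) hz
          rw [sub_add_eq_add_sub] at this
          have r1 := (abs_le.1 this).2
          have r2 : ‖D k s x‖ / (t - τ k) ^ (1 / α) ≤ |B * T ^ (1 - 1 / α)| := by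
            rw [div_le_iff₀ hlt]
            refine hz.trans ?_
            gcongr
            exact le_abs_self _
          have r3 : C₁ * (‖D k s x‖ / (t - τ k) ^ (1 / α)) * stableDensity d α (t - τ k) (x - y)
              ≤ C₁ * |B * T ^ (1 - 1 / α)| * stableDensity d α (t - τ k) (x - y) := by gcongr
          rw [hA]
          linarith
        have := hdiff x
        gcongr
      have b2 : |stableDensity d α (t - τ k) (x + D k s x - y) - stableDensity d α (t - τ k) (x - y) -
          (stableDensity d α (s - τ k) (x + D k s x - y) - stableDensity d α (s - τ k) (x - y))|
          ≤ C₂ * (B * v) * (t - s) ^ (β / α) * (stableDensity d α (s - τ k) (x - y) +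
            stableDensity d α (t - τ k) (x - y)) := by
        have := hM₂ (s - τ k) (t - τ k) hs (by linarith) (x - y) (D k s x)
          (hc.norm_drift_le_scale hα hB hks le_rfl (hst.le.trans htT) x)
        rw [sub_add_eq_add_sub, sub_sub_sub_cancel_right, Real.div_rpow hts.le hs.le] at this
        refine this.trans ?_
        have hd := hc.norm_drift_div_le hks ((1 + β) / α) x
        rw [e] at hd
        have hlβ : 0 < (s - τ k) ^ (β / α) := Real.rpow_pos_of_pos hs _
        calc _ = C₂ * (‖D k s x‖ / ((s - τ k) ^ (1 / α) * (s - τ k) ^ (β / α))) *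
              (t - s) ^ (β / α) * (stableDensity d α (s - τ k) (x - y) +
              stableDensity d α (t - τ k) (x - y)) := by field_simp
          _ ≤ _ := by gcongr
      have b3 := abs_add_le (stableDensity d α (t - τ k) (x + D k t x - y) -
          stableDensity d α (t - τ k) (x + D k s x - y)) (stableDensity d α (t - τ k) (x + D k s x - y) -
          stableDensity d α (t - τ k) (x - y) - (stableDensity d α (s - τ k) (x + D k s x - y) -
          stableDensity d α (s - τ k) (x - y)))
      rw [show ∀ a b c e f : ℝ, a - b + (b - c - (e - f)) = a - c - (e - f) by intros; ring] at b3
      linarith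
    rw [driftTerm, driftTerm, if_pos hkt, if_pos hks,
      ← integral_sub (by exact j2.sub i2) (by exact j1.sub i1)]
    refine (abs_integral_le_mul_integral (by exact (i1.const_mul _).add (i2.const_mul _))
      pointwise).trans ?_
    rw [one_mul, integral_add (i1.const_mul _) (i2.const_mul _), integral_const_mul,
      integral_const_mul]
    have a1 := hE N τ μ D hc k hk s (hst.le.trans htT) hks y
    have a2 := hE N τ μ D hc k hk t htT hkt y
    change _ * stableAverage α (μ k) (s - τ k) y + _ * stableAverage α (μ k) (t - τ k) y ≤ _
    set E₁ := stableAverage α (μ 0) s y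
    set E₂ := stableAverage α (μ 0) t y
    have hr : 0 ≤ (t - s) ^ (β / α) := by positivity
    calc _ ≤ C₂ * ((B + 1) * v) * (t - s) ^ (β / α) * (K * E₁) +
          (C₂ * ((B + 1) * v) * (t - s) ^ (β / α) + C₁ * ((B + 1) * w) * A) * (K * E₂) := by
          have g1 := h.stableAverage_nonneg hs (μ k) y
          have g2 := h.stableAverage_nonneg ht (μ k) y
          have g3 : B ≤ B + 1 := by linarith
          gcongr
      _ = (C₂ * (B + 1) * K) * (v * (t - s) ^ (β / α) * (E₁ + E₂)) +
          (C₁ * (B + 1) * A * K) * (w * E₂) := by ring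
      _ ≤ _ := by
          have p1 : 0 ≤ v * (t - s) ^ (β / α) * (E₁ + E₂) := by positivity
          have p2 : 0 ≤ w * E₂ := by positivity
          have c1 : 0 ≤ C₁ * (B + 1) * A * K := by positivity
          have c2 : 0 ≤ C₂ * (B + 1) * K := by positivity
          nlinarith [mul_nonneg hC₀.le p1, mul_nonneg hC₀.le p2, mul_nonneg c1 p1, mul_nonneg c2 p2]

/-! ### Estimates for the density of the chain -/

lemma exists_chainDensity_le (h : IsSubordination d α κ η) (hB : 0 ≤ B) (T : ℝ) :
    ∃ C : ℝ, 0 < C ∧ ∀ (N : ℕ) (τ : ℕ → ℝ) (μ : ℕ → Measure (Rd d)) (D : ℕ → ℝ → Rd d → Rd d),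
      IsDriftChain α B N τ μ D → ∀ t ≤ T, 0 < t → ∀ y : Rd d,
      chainDensity α N τ μ D t y ≤ C * stableAverage α (μ 0) t y := by
  have hα := h.one_div_lt_one
  have hα0 : 0 < 1 / α := by have := h.pos; positivity
  have hα1 : 0 < 1 - 1 / α := by linarith
  obtain ⟨C, hC, hM⟩ := h.exists_abs_driftTerm_le hB T
  refine ⟨1 + C * |T ^ (1 - 1 / α) / (1 - 1 / α)|, by positivity, fun N τ μ D hc t htT ht y => ?_⟩
  have hE0 := h.stableAverage_nonneg ht (μ 0) y
  have hw := hc.sum_weight_le hα0 hα ht.le N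
  have hT : t ^ (1 - 1 / α) / (1 - 1 / α) ≤ |T ^ (1 - 1 / α) / (1 - 1 / α)| := by
    refine le_trans ?_ (le_abs_self _)
    gcongr
  calc _ ≤ stableAverage α (μ 0) t y + ∑ k ∈ Finset.range N,
        C * singularWeight (1 / α) (fun k => min (τ k) t) t k * stableAverage α (μ 0) t y := by
        unfold chainDensity
        gcongr with k hk
        exact (le_abs_self _).trans (hM N τ μ D hc k (Finset.mem_range.1 hk).le t htT ht y)
    _ = (1 + C * ∑ k ∈ Finset.range N, singularWeight (1 / α) (fun k => min (τ k) t) t k) *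
        stableAverage α (μ 0) t y := by
        rw [← Finset.sum_mul, ← Finset.mul_sum]; ring
    _ ≤ _ := by
        gcongr
        exact hw.trans hT

lemma rpow_one_sub_le (h : IsSubordination d α κ η) {t T : ℝ} (ht : 0 < t) (htT : t ≤ T) :
    t ^ (1 - (1 + β) / α) ≤ T ^ (1 - 1 / α) * t ^ (-β / α) := by
  have hα := h.one_div_lt_one
  have e : 1 - (1 + β) / α = 1 - 1 / α + -β / α := by ring
  have hα1 : 0 ≤ 1 - 1 / α := by linarith
  rw [e, Real.rpow_add ht]
  gcongr

lemma exists_chainDensity_space_hoelder (h : IsSubordination d α κ η) (hB : 0 ≤ B) {T : ℝ}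
    (hT : 0 < T) (hβ : β ∈ Set.Ioo 0 (α - 1)) :
    ∃ C : ℝ, 0 < C ∧ ∀ (N : ℕ) (τ : ℕ → ℝ) (μ : ℕ → Measure (Rd d)) (D : ℕ → ℝ → Rd d → Rd d),
      IsDriftChain α B N τ μ D → ∀ t ≤ T, 0 < t → ∀ y₁ y₂ : Rd d,
      |chainDensity α N τ μ D t y₂ - chainDensity α N τ μ D t y₁| ≤
        C * ‖y₂ - y₁‖ ^ β * t ^ (-β / α) *
          (stableAverage α (μ 0) t y₁ + stableAverage α (μ 0) t y₂) := by
  obtain ⟨hβ0, hβ2⟩ := hβ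
  have hα := h.pos
  have hβ1 : β ≤ 1 := by linarith [h.lt_two]
  have hγ0 : 0 < (1 + β) / α := by positivity
  have hγ1 : (1 + β) / α < 1 := by rw [div_lt_one hα]; linarith
  have hγ : 0 < 1 - (1 + β) / α := by linarith
  obtain ⟨C₁, hC₁, hM₁⟩ := h.exists_stableDensity_space_hoelder hβ0 hβ1
  obtain ⟨C₂, hC₂, hM₂⟩ := h.exists_abs_driftTerm_space_sub_le hB T hβ0 hβ1
  refine ⟨C₁ + C₂ * (T ^ (1 - 1 / α) / (1 - (1 + β) / α)), by positivity,
    fun N τ μ D hc t htT ht y₁ y₂ => ?_⟩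
  have hE1 := h.stableAverage_nonneg ht (μ 0) y₁
  have hE2 := h.stableAverage_nonneg ht (μ 0) y₂
  have hw := hc.sum_weight_le hγ0 hγ1 ht.le N
  have i1 := hc.integrable_density' h N.zero_le ht y₁
  have i2 := hc.integrable_density' h N.zero_le ht y₂
  have hl : 0 < t ^ (1 / α) := Real.rpow_pos_of_pos ht _
  have e : (t ^ (1 / α)) ^ β = (t ^ (-β / α))⁻¹ := by
    rw [← Real.rpow_mul ht.le, ← Real.rpow_neg ht.le]
    congr 1
    ring
  have first : |stableAverage α (μ 0) t y₂ - stableAverage α (μ 0) t y₁| ≤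
      C₁ * (‖y₂ - y₁‖ ^ β * t ^ (-β / α)) *
        (stableAverage α (μ 0) t y₁ + stableAverage α (μ 0) t y₂) := by
    unfold stableAverage
    rw [← integral_sub i2 i1, ← integral_add i1 i2]
    refine abs_integral_le_mul_integral (by exact i1.add i2) fun x => ?_
    have := hM₁ t ht (x - y₁) (x - y₂)
    rwa [show x - y₂ - (x - y₁) = -(y₂ - y₁) by abel, norm_neg, Real.div_rpow (norm_nonneg _) hl.le,
      e, div_inv_eq_mul] at this
  unfold chainDensity
  rw [add_sub_add_comm, ← Finset.sum_sub_distrib]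
  set S := stableAverage α (μ 0) t y₁ + stableAverage α (μ 0) t y₂ with hS
  calc _ ≤ C₁ * (‖y₂ - y₁‖ ^ β * t ^ (-β / α)) * S + ∑ k ∈ Finset.range N,
        C₂ * singularWeight ((1 + β) / α) (fun k => min (τ k) t) t k * ‖y₂ - y₁‖ ^ β * S := by
        refine (abs_add_le _ _).trans (add_le_add first
          ((Finset.abs_sum_le_sum_abs _ _).trans (Finset.sum_le_sum fun k hk => ?_)))
        exact hM₂ N τ μ D hc k (Finset.mem_range.1 hk).le t htT ht y₁ y₂
    _ = C₁ * (‖y₂ - y₁‖ ^ β * t ^ (-β / α)) * S + C₂ * (∑ k ∈ Finset.range N,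
        singularWeight ((1 + β) / α) (fun k => min (τ k) t) t k) * ‖y₂ - y₁‖ ^ β * S := by
        rw [← Finset.sum_mul, ← Finset.sum_mul, ← Finset.mul_sum]
    _ ≤ C₁ * (‖y₂ - y₁‖ ^ β * t ^ (-β / α)) * S + C₂ * (T ^ (1 - 1 / α) * t ^ (-β / α) /
        (1 - (1 + β) / α)) * ‖y₂ - y₁‖ ^ β * S := by
        gcongr
        refine hw.trans ?_
        gcongr
        exact h.rpow_one_sub_le ht htT
    _ = _ := by ring

lemma exists_chainDensity_time_hoelder (h : IsSubordination d α κ η) (hB : 0 ≤ B) {T : ℝ}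
    (hT : 0 < T) (hβ : β ∈ Set.Ioo 0 (α - 1)) :
    ∃ C : ℝ, 0 < C ∧ ∀ (N : ℕ) (τ : ℕ → ℝ) (μ : ℕ → Measure (Rd d)) (D : ℕ → ℝ → Rd d → Rd d),
      IsDriftChain α B N τ μ D → ∀ s t : ℝ, 0 < s → s < t → t ≤ T → ∀ y : Rd d,
      |chainDensity α N τ μ D t y - chainDensity α N τ μ D s y| ≤
        C * (t - s) ^ (β / α) * (s ^ (-β / α) * stableAverage α (μ 0) s y +
          t ^ (-β / α) * stableAverage α (μ 0) t y) := by
  obtain ⟨hβ0, hβ2⟩ := hβ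
  have hα := h.pos
  have hβ1 : β ≤ 1 := by linarith [h.lt_two]
  have hγ0 : 0 < (1 + β) / α := by positivity
  have hγ1 : (1 + β) / α < 1 := by rw [div_lt_one hα]; linarith
  have hγ : 0 < 1 - (1 + β) / α := by linarith
  have hα1 := h.one_div_lt_one
  have hα2 : 0 < 1 - 1 / α := by linarith
  obtain ⟨C₁, hC₁, hM₁⟩ := h.exists_stableDensity_time_hoelder (β := β / α) (by positivity)
    (by rw [div_le_one hα]; linarith [h.one_lt])
  obtain ⟨C₂, hC₂, hM₂⟩ := h.exists_abs_driftTerm_time_sub_le hB T hβ0 hβ1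
  set G := T ^ (1 - 1 / α) / (1 - (1 + β) / α) with hG
  set G' := T ^ (1 - 1 / α) / (1 - 1 / α) with hG'
  refine ⟨C₁ + C₂ * G + C₂ * G', by positivity, fun N τ μ D hc s t hs hst htT y => ?_⟩
  have ht : 0 < t := hs.trans hst
  have hts : 0 < t - s := sub_pos.2 hst
  have hE1 := h.stableAverage_nonneg hs (μ 0) y
  have hE2 := h.stableAverage_nonneg ht (μ 0) y
  have i1 := hc.integrable_density' h N.zero_le hs y
  have i2 := hc.integrable_density' h N.zero_le ht y
  have hcm : Monotone fun k => min (max (τ k) s) t :=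
    fun i j hij => min_le_min_right t (max_le_max_right s (hc.monotone hij))
  have neg_exp : ∀ r : ℝ, 0 < r → ((t - s) / r) ^ (β / α) = (t - s) ^ (β / α) * r ^ (-β / α) := by
    intro r hr
    rw [Real.div_rpow hts.le hr.le, neg_div, Real.rpow_neg hr.le, div_eq_mul_inv]
  set E₁ := stableAverage α (μ 0) s y with hE₁
  set E₂ := stableAverage α (μ 0) t y with hE₂
  set ρ := (t - s) ^ (β / α) with hρ
  have hρ0 : 0 ≤ ρ := by positivity
  set S := s ^ (-β / α) * E₁ + t ^ (-β / α) * E₂ with hS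
  have first : |E₂ - E₁| ≤ C₁ * ρ * S := by
    have : |E₂ - E₁| ≤ C₁ * ∫ x, (ρ * s ^ (-β / α) * stableDensity d α s (x - y) +
        ρ * t ^ (-β / α) * stableDensity d α t (x - y)) ∂(μ 0) := by
      rw [hE₁, hE₂]
      unfold stableAverage
      rw [← integral_sub i2 i1]
      refine abs_integral_le_mul_integral (by exact (i1.const_mul _).add (i2.const_mul _)) fun x => ?_
      have := hM₁ s t hs hst.le (x - y)
      rwa [neg_exp s hs, neg_exp t ht] at this
    rw [integral_add (i1.const_mul _) (i2.const_mul _), integral_const_mul,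
      integral_const_mul] at this
    refine this.trans_eq ?_
    rw [hS, hE₁, hE₂]
    unfold stableAverage
    ring
  have sum1 : ∑ k ∈ Finset.range N, singularWeight ((1 + β) / α) (fun k => min (τ k) s) s k
      ≤ s ^ (1 - (1 + β) / α) / (1 - (1 + β) / α) := hc.sum_weight_le hγ0 hγ1 hs.le N
  have sum2 : ∑ k ∈ Finset.range N, singularWeight (1 / α) (fun k => min (max (τ k) s) t) t k
      ≤ ρ * (t ^ (1 - (1 + β) / α) / (1 - 1 / α)) := by
    refine (sum_singularWeight_le (by positivity) hα1 hcm (fun _ => min_le_right _ _) N).trans ?_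
    rw [hc.zero, max_eq_right hs.le, min_eq_left hst.le, ← mul_div_assoc]
    gcongr
    rw [show 1 - 1 / α = β / α + (1 - (1 + β) / α) by ring, Real.rpow_add hts, hρ]
    gcongr
    linarith
  have sE1 : s ^ (1 - (1 + β) / α) * (E₁ + E₂) ≤ T ^ (1 - 1 / α) * S := by
    have b1 := h.rpow_one_sub_le (β := β) hs (hst.le.trans htT)
    have b2 := h.rpow_one_sub_le (β := β) ht htT
    have b3 : s ^ (1 - (1 + β) / α) ≤ t ^ (1 - (1 + β) / α) := by gcongr
    calc _ = s ^ (1 - (1 + β) / α) * E₁ + s ^ (1 - (1 + β) / α) * E₂ := by ring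
      _ ≤ T ^ (1 - 1 / α) * s ^ (-β / α) * E₁ + T ^ (1 - 1 / α) * t ^ (-β / α) * E₂ := by
          gcongr
          exact b3.trans b2
      _ = _ := by ring
  have sE2 : t ^ (1 - (1 + β) / α) * E₂ ≤ T ^ (1 - 1 / α) * S := by
    have b2 := h.rpow_one_sub_le (β := β) ht htT
    calc _ ≤ T ^ (1 - 1 / α) * t ^ (-β / α) * E₂ := by gcongr
      _ ≤ T ^ (1 - 1 / α) * (s ^ (-β / α) * E₁ + t ^ (-β / α) * E₂) := by
          have : 0 ≤ T ^ (1 - 1 / α) * (s ^ (-β / α) * E₁) := by positivity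
          linarith
  unfold chainDensity
  rw [add_sub_add_comm, ← Finset.sum_sub_distrib]
  calc _ ≤ C₁ * ρ * S + ∑ k ∈ Finset.range N,
        C₂ * (singularWeight ((1 + β) / α) (fun k => min (τ k) s) s k * ρ * (E₁ + E₂) +
        singularWeight (1 / α) (fun k => min (max (τ k) s) t) t k * E₂) := by
        refine (abs_add_le _ _).trans (add_le_add first
          ((Finset.abs_sum_le_sum_abs _ _).trans (Finset.sum_le_sum fun k hk => ?_)))
        exact hM₂ N τ μ D hc k (Finset.mem_range.1 hk).le s t hs hst htT y
    _ = C₁ * ρ * S + C₂ * ((∑ k ∈ Finset.range N,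
        singularWeight ((1 + β) / α) (fun k => min (τ k) s) s k) * ρ * (E₁ + E₂) +
        (∑ k ∈ Finset.range N,
          singularWeight (1 / α) (fun k => min (max (τ k) s) t) t k) * E₂) := by
        rw [← Finset.mul_sum, Finset.sum_add_distrib, ← Finset.sum_mul, ← Finset.sum_mul,
          ← Finset.sum_mul]
    _ ≤ C₁ * ρ * S + C₂ * (s ^ (1 - (1 + β) / α) / (1 - (1 + β) / α) * ρ * (E₁ + E₂) +
        ρ * (t ^ (1 - (1 + β) / α) / (1 - 1 / α)) * E₂) := by
        gcongr
    _ = C₁ * ρ * S + C₂ * (ρ / (1 - (1 + β) / α) * (s ^ (1 - (1 + β) / α) * (E₁ + E₂)) +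
        ρ / (1 - 1 / α) * (t ^ (1 - (1 + β) / α) * E₂)) := by ring
    _ ≤ C₁ * ρ * S + C₂ * (ρ / (1 - (1 + β) / α) * (T ^ (1 - 1 / α) * S) +
        ρ / (1 - 1 / α) * (T ^ (1 - 1 / α) * S)) := by gcongr
    _ = _ := by rw [hG, hG']; ring

end IsSubordination

end ChainEstimates

/-! ### The Euler scheme as a drift chain -/

section EulerScheme

variable {d : ℕ} {Ω : Type*} {mΩ : MeasurableSpace Ω}

/-- The displacement `∫ b(s, x) ds` caused by the drift frozen at `x` between the `k`-th point of
the grid with step `δ` and time `t`; the displacement stops at the next grid point. -/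
def frozenDrift (b : ℝ≥0 → Rd d → Rd d) (δ : ℝ) (k : ℕ) (t : ℝ) (x : Rd d) : Rd d :=
  ∫ s in (k * δ : ℝ)..(min ((k + 1 : ℕ) * δ) t), b s.toNNReal x

lemma intervalIntegrable_of_norm_le {f : ℝ → Rd d} (hf : Measurable f) {B : ℝ}
    (hB : ∀ s, ‖f s‖ ≤ B) (u v : ℝ) : IntervalIntegrable f volume u v :=
  (intervalIntegrable_const (c := B)).mono_fun hf.aestronglyMeasurable
    (ae_of_all _ fun s => (hB s).trans (le_abs_self B))

section frozenDrift

variable {b : ℝ≥0 → Rd d → Rd d} {B δ : ℝ}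

lemma measurable_frozenDrift (hb : Measurable (Function.uncurry b)) (k : ℕ) (t : ℝ) :
    Measurable (frozenDrift b δ k t) := by
  have hm : StronglyMeasurable (Function.uncurry fun (x : Rd d) (s : ℝ) => b s.toNNReal x) :=
    (hb.comp ((measurable_real_toNNReal.comp measurable_snd).prodMk
      measurable_fst)).stronglyMeasurable
  unfold frozenDrift
  simp only [intervalIntegral]
  exact (hm.integral_prod_right.sub hm.integral_prod_right).measurable

lemma intervalIntegrable_drift (hb : Measurable (Function.uncurry b)) (hB : ∀ s x, ‖b s x‖ ≤ B)
    (x : Rd d) (u v : ℝ) : IntervalIntegrable (fun s => b s.toNNReal x) volume u v :=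
  intervalIntegrable_of_norm_le
    (hb.comp (measurable_real_toNNReal.prodMk measurable_const)) (fun _ => hB _ x) u v

lemma norm_frozenDrift_sub_le (hb : Measurable (Function.uncurry b)) (hB : ∀ s x, ‖b s x‖ ≤ B)
    (k : ℕ) {s t : ℝ} (hst : s ≤ t) (x : Rd d) :
    ‖frozenDrift b δ k t x - frozenDrift b δ k s x‖ ≤
      B * (min ((k + 1 : ℕ) * δ) t - min ((k + 1 : ℕ) * δ) s) := by
  have hi := intervalIntegrable_drift hb hB x
  rw [frozenDrift, frozenDrift, intervalIntegral.integral_interval_sub_left (hi _ _) (hi _ _),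
    ← abs_of_nonneg (sub_nonneg.2 (min_le_min_left ((k + 1 : ℕ) * δ) hst))]
  exact intervalIntegral.norm_integral_le_of_norm_le_const fun u _ => hB _ x

lemma norm_frozenDrift_le (hδ : 0 ≤ δ) (hB : ∀ s x, ‖b s x‖ ≤ B)
    (k : ℕ) {t : ℝ} (ht : k * δ ≤ t) (x : Rd d) :
    ‖frozenDrift b δ k t x‖ ≤ B * (min ((k + 1 : ℕ) * δ) t - k * δ) := by
  have hk : k * δ ≤ min ((k + 1 : ℕ) * δ) t := le_min (by push_cast; nlinarith) ht
  rw [frozenDrift, ← abs_of_nonneg (sub_nonneg.2 hk)]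
  exact intervalIntegral.norm_integral_le_of_norm_le_const fun u _ => hB _ x

end frozenDrift

lemma gridTime_eq {T : ℝ≥0} {N k : ℕ} (hδ : 0 < T / N) {s : ℝ≥0} (h₁ : k * (T / N) ≤ s)
    (h₂ : s < (k + 1 : ℕ) * (T / N)) : gridTime T N s = k * (T / N) := by
  rw [gridTime, (Nat.floor_eq_iff zero_le).2 ⟨(le_div_iff₀ hδ).2 h₁, ?_⟩]
  exact (div_lt_iff₀ hδ).2 (by exact_mod_cast h₂)

/-- If `X` is independent of `(Y, Z)` and `Y` is independent of `Z`, then `(X, Y)` is independent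
of `Z`. -/
lemma indepFun_prodMk_left {E F G : Type*} [MeasurableSpace E] [MeasurableSpace F]
    [MeasurableSpace G] {P : Measure Ω} [IsProbabilityMeasure P] {X : Ω → E} {Y : Ω → F}
    {Z : Ω → G} (hX : Measurable X) (hY : Measurable Y) (hZ : Measurable Z)
    (hXYZ : IndepFun X (fun ω => (Y ω, Z ω)) P) (hYZ : IndepFun Y Z P) :
    IndepFun (fun ω => (X ω, Y ω)) Z P := by
  have hXY : IndepFun X Y P := hXYZ.comp measurable_id measurable_fst
  rw [indepFun_iff_map_prod_eq_prod_map_map hX.aemeasurable (hY.prodMk hZ).aemeasurable,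
    (indepFun_iff_map_prod_eq_prod_map_map hY.aemeasurable hZ.aemeasurable).1 hYZ] at hXYZ
  rw [indepFun_iff_map_prod_eq_prod_map_map (hX.prodMk hY).aemeasurable hZ.aemeasurable,
    (indepFun_iff_map_prod_eq_prod_map_map hX.aemeasurable hY.aemeasurable).1 hXY]
  have := congrArg (Measure.map MeasurableEquiv.prodAssoc.symm) hXYZ
  rw [Measure.map_map (by fun_prop) (by fun_prop), ← Measure.prodAssoc_prod,
    Measure.map_map (by fun_prop) (by fun_prop)] at this
  rwa [show MeasurableEquiv.prodAssoc.symm ∘ MeasurableEquiv.prodAssoc = id from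
    MeasurableEquiv.prodAssoc.symm_comp_self, Measure.map_id] at this

namespace IsEulerScheme

variable {α B : ℝ} {T : ℝ≥0} {N : ℕ} {b : ℝ≥0 → Rd d → Rd d} {X₀ : Ω → Rd d}
  {L X : ℝ≥0 → Ω → Rd d} {P : Measure Ω}

lemma ae_eq_init (he : IsEulerScheme α T N b X₀ L X P) : X 0 =ᵐ[P] X₀ := by
  filter_upwards [he.eq 0 zero_le, he.stable.zero] with ω h₁ h₂
  simpa [h₂] using h₁

lemma intervalIntegrable_path (hb : Measurable (Function.uncurry b)) (hB : ∀ s x, ‖b s x‖ ≤ B)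
    (ω : Ω) (u v : ℝ) :
    IntervalIntegrable (fun s : ℝ => b s.toNNReal (X (gridTime T N s.toNNReal) ω)) volume u v := by
  refine intervalIntegrable_of_norm_le (hb.comp (measurable_real_toNNReal.prodMk ?_))
    (fun s => hB _ _) u v
  -- the frozen path depends on `s` only through an integer
  have : Measurable fun n : ℕ => X ((n : ℝ≥0) * (T / N)) ω := measurable_from_nat
  exact this.comp (Nat.measurable_floor.comp (measurable_real_toNNReal.div_const _))

/-- Within one step the scheme starts afresh from the last grid point. -/
lemma ae_eq_step (he : IsEulerScheme α T N b X₀ L X P) (hb : Measurable (Function.uncurry b))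
    (hB : ∀ s x, ‖b s x‖ ≤ B) (hδ : 0 < T / N) {k : ℕ} {t : ℝ≥0} (h₁ : k * (T / N) ≤ t)
    (h₂ : t ≤ (k + 1 : ℕ) * (T / N)) (ht : t ≤ T) :
    X t =ᵐ[P] fun ω => X (k * (T / N)) ω +
      frozenDrift b ((T / N : ℝ≥0) : ℝ) k t (X (k * (T / N)) ω) +
      (L t ω - L (k * (T / N)) ω) := by
  filter_upwards [he.eq t ht, he.eq _ (h₁.trans ht)] with ω e₁ e₂
  have hi := intervalIntegrable_path (X := X) (T := T) (N := N) hb hB ω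
  have h₂' : (t : ℝ) ≤ (k + 1 : ℕ) * ((T / N : ℝ≥0) : ℝ) := by exact_mod_cast h₂
  have hc : ((k * (T / N) : ℝ≥0) : ℝ) = k * ((T / N : ℝ≥0) : ℝ) := by push_cast; rfl
  have h₁' : k * ((T / N : ℝ≥0) : ℝ) ≤ t := by exact_mod_cast h₁
  have key : ∫ s in (k * ((T / N : ℝ≥0) : ℝ))..t,
      b s.toNNReal (X (gridTime T N s.toNNReal) ω) =
      frozenDrift b ((T / N : ℝ≥0) : ℝ) k t (X (k * (T / N)) ω) := by
    rw [frozenDrift, min_eq_right h₂', intervalIntegral.integral_of_le h₁',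
      intervalIntegral.integral_of_le h₁', integral_Ioc_eq_integral_Ioo,
      integral_Ioc_eq_integral_Ioo]
    refine setIntegral_congr_fun measurableSet_Ioo fun s hs => ?_
    have hs0 : 0 ≤ s := le_trans (by positivity) hs.1.le
    lift s to ℝ≥0 using hs0
    have hs₁ : k * (T / N) ≤ s := by exact_mod_cast hs.1.le
    have hs₂ : s < (k + 1 : ℕ) * (T / N) := lt_of_lt_of_le (by exact_mod_cast hs.2) h₂
    simp only [Real.toNNReal_coe, gridTime_eq hδ hs₁ hs₂]
  rw [hc] at e₂
  rw [e₁, ← intervalIntegral.integral_add_adjacent_intervals (hi 0 _) (hi _ _), key]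
  generalize frozenDrift b ((T / N : ℝ≥0) : ℝ) k t (X (k * (T / N)) ω) = v
  rw [e₂]
  abel

lemma grid_le {k : ℕ} (hk : k ≤ N) : (k : ℝ≥0) * (T / N) ≤ T := by
  rcases N.eq_zero_or_pos with rfl | hN
  · simp [Nat.le_zero.1 hk]
  have hN' : (0 : ℝ≥0) < N := by exact_mod_cast hN
  rw [mul_div_assoc', div_le_iff₀ hN', mul_comm]
  gcongr

/-- At a grid point the scheme is a measurable function of the initial value and the increments of
the noise over the steps made so far. -/
lemma exists_ae_eq_grid (he : IsEulerScheme α T N b X₀ L X P)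
    (hb : Measurable (Function.uncurry b)) (hB : ∀ s x, ‖b s x‖ ≤ B) (hδ : 0 < T / N) {k : ℕ}
    (hk : k ≤ N) : ∀ j ≤ k, ∃ G : Rd d × (Finset.range k → Rd d) → Rd d, Measurable G ∧
      X (j * (T / N)) =ᵐ[P] fun ω => G (X₀ ω, fun i =>
        L ((i + 1 : ℕ) * (T / N)) ω - L (i * (T / N)) ω) := by
  intro j
  induction j with
  | zero =>
    intro _
    refine ⟨Prod.fst, measurable_fst, ?_⟩
    simpa using he.ae_eq_init
  | succ j ih =>
    intro hj
    obtain ⟨G, hG, hGe⟩ := ih (by omega)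
    refine ⟨fun z => G z + frozenDrift b ((T / N : ℝ≥0) : ℝ) j
      (((j + 1 : ℕ) * (T / N) : ℝ≥0) : ℝ) (G z) + z.2 ⟨j, Finset.mem_range.2 (by omega)⟩, ?_, ?_⟩
    · have := measurable_frozenDrift (δ := ((T / N : ℝ≥0) : ℝ)) hb j
        (((j + 1 : ℕ) * (T / N) : ℝ≥0) : ℝ)
      exact (hG.add (this.comp hG)).add ((measurable_pi_apply _).comp measurable_snd)
    · filter_upwards [he.ae_eq_step hb hB hδ (k := j) (t := (j + 1 : ℕ) * (T / N))
        (by gcongr; omega) le_rfl (grid_le (by omega)), hGe] with ω e₁ e₂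
      rw [e₁, e₂]

lemma aemeasurable_grid (he : IsEulerScheme α T N b X₀ L X P)
    (hb : Measurable (Function.uncurry b)) (hB : ∀ s x, ‖b s x‖ ≤ B) (hδ : 0 < T / N) {k : ℕ}
    (hk : k ≤ N) : AEMeasurable (X (k * (T / N))) P := by
  obtain ⟨G, hG, hGe⟩ := he.exists_ae_eq_grid hb hB hδ hk k le_rfl
  have hL := he.stable.measurable
  have hX := he.measurable_init
  exact AEMeasurable.congr (by fun_prop) hGe.symm

lemma charFun_increment (he : IsEulerScheme α T N b X₀ L X P) {s t : ℝ≥0} (hst : s ≤ t)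
    (ξ : Rd d) : charFun (P.map fun ω => L t ω - L s ω) ξ =
      Complex.exp (((t - s : ℝ) : ℂ) * levyExponent d α ξ) := by
  rw [he.stable.stationary_increments s t hst, he.stable.charFun_eq, NNReal.coe_sub hst]

variable [IsProbabilityMeasure P]

/-- The position at a grid point is independent of the later increments of the noise. -/
lemma indepFun_increment (he : IsEulerScheme α T N b X₀ L X P)
    (hb : Measurable (Function.uncurry b)) (hB : ∀ s x, ‖b s x‖ ≤ B) (hδ : 0 < T / N) {k : ℕ}
    (hk : k ≤ N) {t : ℝ≥0} (ht : k * (T / N) ≤ t) :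
    IndepFun (X (k * (T / N))) (fun ω => L t ω - L (k * (T / N)) ω) P := by
  obtain ⟨G, hG, hGe⟩ := he.exists_ae_eq_grid hb hB hδ hk k le_rfl
  have hL := he.stable.measurable
  -- the grid points up to the `k`-th one, followed by `t`
  let σ : ℕ → ℝ≥0 := fun i => if i ≤ k then i * (T / N) else t
  have hσ : Monotone σ := by
    intro i j hij
    simp only [σ]
    split_ifs with h₁ h₂ h₂
    · gcongr
    · exact le_trans (by gcongr) ht
    · omega
    · exact le_rfl
  have hind := he.stable.indep_increments.nat hσ
  have h₁ := hind.indepFun_finset (Finset.range k) {k} (by simp)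
    (fun i => (hL _).sub (hL _))
  have h₂ : IndepFun (fun ω (i : Finset.range k) =>
      L ((i + 1 : ℕ) * (T / N)) ω - L (i * (T / N)) ω) (fun ω => L t ω - L (k * (T / N)) ω) P := by
    have := h₁.comp measurable_id
      (measurable_pi_apply (⟨k, Finset.mem_singleton_self k⟩ : ({k} : Finset ℕ)))
    convert this using 1
    · funext ω i
      have hi := Finset.mem_range.1 i.2
      simp [σ, hi.le, hi]
    · funext ω
      simp [σ]
  have h₃ := he.indep.comp (φ := id) (ψ := fun f : ℝ≥0 → Rd d =>
    ((fun i : Finset.range k => f ((i + 1 : ℕ) * (T / N)) - f (i * (T / N))),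
      f t - f (k * (T / N)))) measurable_id (by fun_prop)
  have h₄ := indepFun_prodMk_left he.measurable_init (by fun_prop)
    (by fun_prop) h₃ h₂
  exact (h₄.comp hG measurable_id).congr hGe.symm .rfl

/-- The law of the scheme within a step is the law at the last grid point, displaced by the drift
and convolved with a stable law. -/
lemma map_eq_conv (he : IsEulerScheme α T N b X₀ L X P) (hb : Measurable (Function.uncurry b))
    (hB : ∀ s x, ‖b s x‖ ≤ B) (hδ : 0 < T / N) {k : ℕ} (hk : k < N) {t : ℝ≥0}
    (h₁ : k * (T / N) ≤ t) (h₂ : t ≤ (k + 1 : ℕ) * (T / N)) (ht : t ≤ T) :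
    P.map (X t) = ((P.map (X (k * (T / N)))).map
      fun x => x + frozenDrift b ((T / N : ℝ≥0) : ℝ) k t x) ∗
        P.map (fun ω => L t ω - L (k * (T / N)) ω) := by
  have hL := he.stable.measurable
  have hX := he.aemeasurable_grid hb hB hδ hk.le
  have hD := measurable_frozenDrift (δ := ((T / N : ℝ≥0) : ℝ)) hb k t
  have hind := (he.indepFun_increment hb hB hδ hk.le h₁).comp
    (φ := fun x => x + frozenDrift b ((T / N : ℝ≥0) : ℝ) k t x) (measurable_id.add hD)
    measurable_id
  rw [Measure.map_congr (he.ae_eq_step hb hB hδ h₁ h₂ ht),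
    AEMeasurable.map_map_of_aemeasurable (by fun_prop) hX]
  exact hind.map_add_eq_map_conv_map₀ (by fun_prop) (by fun_prop)

/-- The laws of the scheme at the grid points form a drift chain. -/
lemma isDriftChain {κ : ℝ} {η : Measure ℝ} (h : IsSubordination d α κ η)
    (he : IsEulerScheme α T N b X₀ L X P) (hb : Measurable (Function.uncurry b))
    (hB : ∀ s x, ‖b s x‖ ≤ B) (hδ : 0 < T / N) :
    IsDriftChain α B N (fun k => k * ((T / N : ℝ≥0) : ℝ)) (fun k => P.map (X (k * (T / N))))
      (frozenDrift b ((T / N : ℝ≥0) : ℝ)) where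
  monotone i j hij := by dsimp only; gcongr
  zero := by simp
  isProbabilityMeasure k hk :=
    Measure.isProbabilityMeasure_map (he.aemeasurable_grid hb hB hδ hk)
  measurable := measurable_frozenDrift hb
  norm_drift_le k t x ht := norm_frozenDrift_le (NNReal.coe_nonneg _) hB k ht x
  norm_drift_sub_le k s t x _ hst := norm_frozenDrift_sub_le hb hB k hst x
  step k hk s hs y := by
    have hle : k * (T / N) ≤ (k + 1 : ℕ) * (T / N) := by gcongr; omega
    have hX := he.aemeasurable_grid hb hB hδ hk.le
    have hL := he.stable.measurable
    have hc : (((k + 1 : ℕ) * (T / N) : ℝ≥0) : ℝ) = (k + 1 : ℕ) * ((T / N : ℝ≥0) : ℝ) := by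
      push_cast; rfl
    have hc' : ((k * (T / N) : ℝ≥0) : ℝ) = k * ((T / N : ℝ≥0) : ℝ) := by push_cast; rfl
    have hD := measurable_frozenDrift (δ := ((T / N : ℝ≥0) : ℝ)) hb k
      (((k + 1 : ℕ) * (T / N) : ℝ≥0) : ℝ)
    have hsub : 0 ≤ (((k + 1 : ℕ) * (T / N) : ℝ≥0) : ℝ) - ((k * (T / N) : ℝ≥0) : ℝ) :=
      sub_nonneg.2 (NNReal.coe_le_coe.2 hle)
    have hp : Continuous fun x => stableDensity d α
        (s + ((((k + 1 : ℕ) * (T / N) : ℝ≥0) : ℝ) - ((k * (T / N) : ℝ≥0) : ℝ))) (x - y) :=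
      (h.continuous_stableDensity (by positivity)).comp (by fun_prop)
    rw [he.map_eq_conv hb hB hδ hk hle le_rfl (grid_le hk),
      h.stableAverage_conv hs hsub _ _ fun ξ => ?_, stableAverage,
      integral_map (by fun_prop) hp.aestronglyMeasurable, hc, hc']
    rw [he.charFun_increment hle, Complex.ofReal_sub]

/-- At positive times the law of the scheme has the density of its drift chain, because the noise of
the step containing `t` smooths it. -/
lemma isContinuousDensity_chainDensity {κ : ℝ} {η : Measure ℝ} (h : IsSubordination d α κ η)
    (he : IsEulerScheme α T N b X₀ L X P) (hb : Measurable (Function.uncurry b))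
    (hB : ∀ s x, ‖b s x‖ ≤ B) (hN : 1 ≤ N) {t : ℝ≥0} (ht : t ∈ Set.Ioc 0 T) :
    IsContinuousDensity (P.map (X t))
      (chainDensity α N (fun k => k * ((T / N : ℝ≥0) : ℝ)) (fun k => P.map (X (k * (T / N))))
        (frozenDrift b ((T / N : ℝ≥0) : ℝ)) t) := by
  have hN' : (0 : ℝ≥0) < N := by exact_mod_cast hN
  have hδ : 0 < T / N := div_pos (ht.1.trans_le ht.2) hN'
  obtain ⟨n, hn, h₁, h₂⟩ : ∃ n < N, n * (T / N) < t ∧ t ≤ (n + 1 : ℕ) * (T / N) := by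
    have hpos : 0 < ⌈t / (T / N)⌉₊ := Nat.ceil_pos.2 (div_pos ht.1 hδ)
    have hle : ⌈t / (T / N)⌉₊ ≤ N := by
      refine Nat.ceil_le.2 ((div_le_iff₀ hδ).2 ?_)
      rw [mul_div_cancel₀ _ hN'.ne']
      exact ht.2
    refine ⟨⌈t / (T / N)⌉₊ - 1, by omega, ?_, ?_⟩
    · exact (lt_div_iff₀ hδ).1 (Nat.lt_ceil.1 (by omega))
    · rw [Nat.sub_add_cancel hpos]
      exact (div_le_iff₀ hδ).1 (Nat.le_ceil _)
  have h₁' : n * ((T / N : ℝ≥0) : ℝ) < t := by exact_mod_cast h₁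
  have h₂' : (t : ℝ) ≤ (n + 1 : ℕ) * ((T / N : ℝ≥0) : ℝ) := by exact_mod_cast h₂
  have hc' : ((n * (T / N) : ℝ≥0) : ℝ) = n * ((T / N : ℝ≥0) : ℝ) := by push_cast; rfl
  have hX := he.aemeasurable_grid hb hB hδ hn.le
  rw [funext ((he.isDriftChain h hb hB hδ).chainDensity_eq h hn h₁' h₂'),
    he.map_eq_conv hb hB hδ hn h₁.le h₂ ht.2]
  refine h.isContinuousDensity_conv (sub_pos.2 h₁') _ _ fun ξ => ?_
  rw [he.charFun_increment h₁.le, hc', Complex.ofReal_sub]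

end IsEulerScheme

end EulerScheme

end StableEuler

end

theorem corollary4p3 (d : ℕ) (hd : 1 ≤ d) (α : ℝ) (hα₁ : 1 < α) (hα₂ : α < 2)
    (T : ℝ≥0) (hT : 0 < T) (B : ℝ) :
    ∃ c : ℝ, 0 < c ∧ ∃ C : ℝ → ℝ, (∀ β ∈ Set.Ioo 0 (α - 1), 0 < C β) ∧
      ∀ (b : ℝ≥0 → StableEuler.Rd d → StableEuler.Rd d),
        Measurable (Function.uncurry b) → (∀ s x, ‖b s x‖ ≤ B) →
      ∀ (Ω : Type*) (mΩ : MeasurableSpace Ω) (P : Measure Ω), IsProbabilityMeasure P →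
      ∀ (N : ℕ), 1 ≤ N →
      ∀ (X₀ : Ω → StableEuler.Rd d) (L X : ℝ≥0 → Ω → StableEuler.Rd d),
        StableEuler.IsEulerScheme α T N b X₀ L X P →
      ∃ p : ℝ≥0 → StableEuler.Rd d → ℝ,
        (∀ t ∈ Set.Ioc 0 T, StableEuler.IsContinuousDensity (P.map (X t)) (p t)) ∧
        (∀ t ∈ Set.Ioc 0 T, ∀ y,
          p t y ≤ c * StableEuler.stableAverage α (P.map X₀) t y) ∧
        (∀ β ∈ Set.Ioo 0 (α - 1), ∀ t ∈ Set.Ioc 0 T, ∀ y₁ y₂,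
          |p t y₂ - p t y₁| ≤ C β * ‖y₂ - y₁‖ ^ β * (t : ℝ) ^ (-β / α) *
            (StableEuler.stableAverage α (P.map X₀) t y₁ +
              StableEuler.stableAverage α (P.map X₀) t y₂)) ∧
        (∀ β ∈ Set.Ioo 0 (α - 1), ∀ t₁ ∈ Set.Ioc 0 T, ∀ t₂ ∈ Set.Ioc 0 T, ∀ y,
          |p t₂ y - p t₁ y| ≤ C β * |(t₂ : ℝ) - t₁| ^ (β / α) *
            ((t₁ : ℝ) ^ (-β / α) * StableEuler.stableAverage α (P.map X₀) t₁ y +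
              (t₂ : ℝ) ^ (-β / α) * StableEuler.stableAverage α (P.map X₀) t₂ y)) := by
  obtain ⟨κ, η, h⟩ := StableEuler.exists_isSubordination hd hα₁ hα₂
  have hT' : (0 : ℝ) < T := by exact_mod_cast hT
  obtain ⟨c, hc, hup⟩ := h.exists_chainDensity_le (abs_nonneg B) (T : ℝ)
  choose! C₁ hC₁ hspace using fun β (hβ : β ∈ Set.Ioo 0 (α - 1)) =>
    h.exists_chainDensity_space_hoelder (abs_nonneg B) hT' hβ
  choose! C₂ hC₂ htime using fun β (hβ : β ∈ Set.Ioo 0 (α - 1)) =>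
    h.exists_chainDensity_time_hoelder (abs_nonneg B) hT' hβ
  refine ⟨c, hc, fun β => max (C₁ β) (C₂ β), fun β hβ => lt_max_of_lt_left (hC₁ β hβ), ?_⟩
  intro b hb hbB Ω _ P hP N hN X₀ L X he
  -- `B` may be negative only if there is no drift `b` at all, so `|B|` serves as the bound
  have hB : ∀ s x, ‖b s x‖ ≤ |B| := fun s x => (hbB s x).trans (le_abs_self B)
  have hδ : 0 < T / N := div_pos hT (by exact_mod_cast hN)
  have hchain := he.isDriftChain h hb hB hδ
  have hinit : P.map (X ((0 : ℕ) * (T / N))) = P.map X₀ := by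
    rw [Nat.cast_zero, zero_mul]
    exact Measure.map_congr he.ae_eq_init
  have hpos : ∀ t ∈ Set.Ioc 0 T, (0 : ℝ) < t ∧ (t : ℝ) ≤ T := fun t ht =>
    ⟨NNReal.coe_pos.2 ht.1, NNReal.coe_le_coe.2 ht.2⟩
  have havg : ∀ t ∈ Set.Ioc 0 T, ∀ y, 0 ≤ StableEuler.stableAverage α (P.map X₀) t y :=
    fun t ht y => h.stableAverage_nonneg (hpos t ht).1 _ y
  refine ⟨fun t => StableEuler.chainDensity α N (fun k => k * ((T / N : ℝ≥0) : ℝ))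
    (fun k => P.map (X (k * (T / N)))) (StableEuler.frozenDrift b ((T / N : ℝ≥0) : ℝ)) t,
    fun t ht => he.isContinuousDensity_chainDensity h hb hB hN ht, fun t ht y => ?_,
    fun β hβ t ht y₁ y₂ => ?_, fun β hβ => ?_⟩
  · have := hup N _ _ _ hchain t (hpos t ht).2 (hpos t ht).1 y
    rwa [hinit] at this
  · have := hspace β hβ N _ _ _ hchain t (hpos t ht).2 (hpos t ht).1 y₁ y₂
    rw [hinit] at this
    have h₁ := havg t ht y₁
    have h₂ := havg t ht y₂
    refine this.trans ?_
    gcongr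
    exact le_max_left _ _
  · have hlt : ∀ s ∈ Set.Ioc 0 T, ∀ t ∈ Set.Ioc 0 T, s < t → ∀ y,
        |StableEuler.chainDensity α N (fun k => k * ((T / N : ℝ≥0) : ℝ))
            (fun k => P.map (X (k * (T / N)))) (StableEuler.frozenDrift b ((T / N : ℝ≥0) : ℝ)) t y -
          StableEuler.chainDensity α N (fun k => k * ((T / N : ℝ≥0) : ℝ))
            (fun k => P.map (X (k * (T / N)))) (StableEuler.frozenDrift b ((T / N : ℝ≥0) : ℝ)) s y| ≤
          max (C₁ β) (C₂ β) * |(t : ℝ) - s| ^ (β / α) *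
            ((s : ℝ) ^ (-β / α) * StableEuler.stableAverage α (P.map X₀) s y +
              (t : ℝ) ^ (-β / α) * StableEuler.stableAverage α (P.map X₀) t y) := by
      intro s hs t ht hst y
      have hst' : (s : ℝ) < t := NNReal.coe_lt_coe.2 hst
      have := htime β hβ N _ _ _ hchain s t (hpos s hs).1 hst' (hpos t ht).2 y
      rw [hinit, ← abs_of_pos (sub_pos.2 hst')] at this
      have h₁ := havg s hs y
      have h₂ := havg t ht y
      refine this.trans ?_
      gcongr
      exact le_max_right _ _
    intro t₁ ht₁ t₂ ht₂ y
    rcases lt_trichotomy t₁ t₂ with hlt' | rfl | hlt'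
    · exact hlt t₁ ht₁ t₂ ht₂ hlt' y
    · -- the left side vanishes, whatever the value of `0 ^ (β / α)`
      have h₁ := havg t₁ ht₁ y
      have : 0 < max (C₁ β) (C₂ β) := lt_max_of_lt_left (hC₁ β hβ)
      rw [sub_self, abs_zero]
      positivity
    · rw [abs_sub_comm, abs_sub_comm (t₂ : ℝ), add_comm (_ * _)]
      exact hlt t₂ ht₂ t₁ ht₁ hlt' y
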